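/- Let $G$ be a compact Hausdorff topological group, $\widehat G$ its dual object (the set of unitary equivalence classes of continuous irreducible unitary representations, $\pi$ having degree $d_\pi$), and let $E$ be an operator space, that is, a complex vector space with norms on the spaces $M_n(E)$, $n\ge 1$, satisfying Ruan's axioms, complete for the norm of $M_1(E)=E$. Let $E^\star=cb(E,\mathbb C)$ be the dual operator space, the norm of $M_n(E^\star)$ being that of $cb(E,M_n)$. Write $S_n^\infty(E)=M_n(E)$ with $M_k(S_n^\infty(E))=M_{kn}(E)$; let $S_n^1$ be the space $M_n$ with the operator space structure of $(S_n^\infty)^\star$ under the pairing $(a,b)\mapsto \mathrm{tr}(ab)$, and let $S_n^1(E)=S_n^1\otimes^{\wedge}E$ (operator space projective tensor product) as a space of $E$-valued $n\times n$ matrices. Let $\mathcal L^1_{E^\star}(\widehat G)$ be the space of families $A=(A^\pi)_{\pi\in\widehat G}$, $A^\pi\in M_{d_\pi}\otimes E^\star$, with $$\|A\|_{\mathcal L^1_{E^\star}(\widehat G)}=\sum_{\pi\in\widehat G} d_\pi\,\|A^\pi\|_{S^1_{d_\pi}(E^\star)}<\infty ,$$ with the operator space structure of the $\ell_1$-sum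 of the spaces $S^1_{d_\pi}(E^\star)$ with weights $d_\pi$: the norm of $x=(x_{ab})\in M_k(\mathcal L^1_{E^\star}(\widehat G))$ is the supremum of $\big\|\big(\sum_\pi d_\pi u_\pi(x_{ab}^\pi)\big)_{a,b}\big\|_{M_k(M_m)}$ over all $m$ and all families of complete contractions $u_\pi:S^1_{d_\pi}(E^\star)\to M_m$. Let $C_0(\widehat G,E)$ be the space of bounded families $B=(B^\pi)_{\pi\in\widehat G}$, $B^\pi\in S^\infty_{d_\pi}(E)$, such that for every $\varepsilon>0$ one has $\|B^\pi\|_{S^\infty_{d_\pi}(E)}<\varepsilon$ for all but finitely many $\pi$, with the matrix norms of the $\ell_\infty$-sum of the spaces $S^\infty_{d_\pi}(E)$. Proposition. The formula $$\Lambda(A)(B)=\sum_{\pi\in\widehat G} d_\pi\,\mathrm{tr}(A^\pi B^\pi),\qquad \mathrm{tr}(A^\pi B^\pi)=\sum_{i,j}A^\pi_{ij}(B^\pi_{ji}),$$ where the series converges absolutely, defines a completely isometric linear isomorphism $\Lambda:\mathcal L^1_{E^\star}(\widehat G)\to C_0(\widehat G,E)^\star$ onto the dual operator space. In particular $\|\Lambda(A)\|=\sum_\pi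 d_\pi\|A^\pi\|_{S^1_{d_\pi}(E^\star)}$. -/

import Mathlib

open scoped ENNReal Matrix TensorProduct

noncomputable section

namespace OpSpace

/-! ### Matrix norms -/

section OpNorm

variable {l m n : Type*} [Fintype l] [Fintype m] [Fintype n]
  [DecidableEq l] [DecidableEq m] [DecidableEq n]

open scoped Matrix.Norms.L2Operator in
/-- The operator norm of a (rectangular) complex matrix, acting between Euclidean spaces. -/
def opNorm (A : Matrix m n ℂ) : ℝ≥0∞ := ‖A‖ₑ

end OpNorm

/-- A family of `[0, ∞]`-valued size functions on the spaces `M_n(E)` of `n × n` matrices. -/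
abbrev MatGauge (E : Type*) := ∀ n : ℕ, Matrix (Fin n) (Fin n) E → ℝ≥0∞

/-- The product `α x β` of a scalar, an `E`-valued, and a scalar matrix. -/
def sandwich {E : Type*} [AddCommGroup E] [Module ℂ E] {m n p q : Type*} [Fintype n] [Fintype p]
    (α : Matrix m n ℂ) (x : Matrix n p E) (β : Matrix p q ℂ) : Matrix m q E :=
  Matrix.of fun i j => ∑ r, ∑ s, (α i r * β s j) • x r s

/-- The block diagonal matrix `x ⊕ y`. -/
def directSum {E : Type*} [Zero E] {m n : ℕ} (x : Matrix (Fin m) (Fin m) E)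
    (y : Matrix (Fin n) (Fin n) E) : Matrix (Fin (m + n)) (Fin (m + n)) E :=
  Matrix.reindex finSumFinEquiv finSumFinEquiv (Matrix.fromBlocks x 0 0 y)

/-- The identification `M_k(M_n(E)) = M_{kn}(E)`. -/
def flatten {E : Type*} {k n : ℕ} (x : Matrix (Fin k) (Fin k) (Matrix (Fin n) (Fin n) E)) :
    Matrix (Fin (k * n)) (Fin (k * n)) E :=
  Matrix.reindex finProdFinEquiv finProdFinEquiv (Matrix.comp _ _ _ _ _ x)

/-- The norm on `E` underlying a family of matrix norms, through `E = M_1(E)`. -/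
def norm₁ {E : Type*} (N : MatGauge E) (x : E) : ℝ≥0∞ := N 1 (Matrix.of fun _ _ => x)

/-- An (abstract, complete) operator space: a complex vector space with a norm on every `M_n(E)`
satisfying Ruan's axioms, and complete for the norm of `M_1(E) = E`. -/
class OperatorSpace (E : Type*) [AddCommGroup E] [Module ℂ E] where
  /-- the norm of `M_n(E)` -/
  mnorm : MatGauge E
  mnorm_ne_top : ∀ n x, mnorm n x ≠ ∞
  mnorm_add_le : ∀ n x y, mnorm n (x + y) ≤ mnorm n x + mnorm n y
  mnorm_smul : ∀ n (c : ℂ) x, mnorm n (c • x) = ‖c‖ₑ * mnorm n x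
  eq_zero_of_mnorm : ∀ n x, mnorm n x = 0 → x = 0
  mnorm_directSum : ∀ m n x y, mnorm (m + n) (directSum x y) = max (mnorm m x) (mnorm n y)
  mnorm_sandwich_le : ∀ m n (α : Matrix (Fin m) (Fin n) ℂ) x (β : Matrix (Fin n) (Fin m) ℂ),
    mnorm m (sandwich α x β) ≤ opNorm α * mnorm n x * opNorm β
  complete : ∀ s : ℕ → E,
    (∀ ε : ℝ≥0∞, 0 < ε → ∃ K, ∀ i ≥ K, ∀ j ≥ K, norm₁ mnorm (s i - s j) < ε) →
    ∃ a, ∀ ε : ℝ≥0∞, 0 < ε → ∃ K, ∀ i ≥ K, norm₁ mnorm (s i - a) < ε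

/-- The matrix norms of `ℂ`: the operator norm on `M_n`. -/
def scalarGauge : MatGauge ℂ := fun _ x => opNorm x

/-- The matrix norms of `M_n(E)` (which is `S_n^∞(E)`): `M_k(M_n(E)) = M_{kn}(E)`. -/
def matGauge {E : Type*} (n : ℕ) (N : MatGauge E) : MatGauge (Matrix (Fin n) (Fin n) E) :=
  fun k x => N (k * n) (flatten x)

/-! ### Complete boundedness and duality -/

/-- The completely bounded norm of a linear map. -/
def cbNorm {E F : Type*} [AddCommGroup E] [Module ℂ E] [AddCommGroup F] [Module ℂ F]
    (N : MatGauge E) (N' : MatGauge F) (u : E →ₗ[ℂ] F) : ℝ≥0∞ :=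
  ⨆ (n : ℕ) (x : Matrix (Fin n) (Fin n) E) (_ : N n x ≤ 1), N' n (x.map u)

/-- `u` preserves the norm of `M_n(E)` for every `n`. -/
def IsCompleteIsometry {E F : Type*} [AddCommGroup E] [Module ℂ E] [AddCommGroup F] [Module ℂ F]
    (N : MatGauge E) (N' : MatGauge F) (u : E →ₗ[ℂ] F) : Prop :=
  ∀ n (x : Matrix (Fin n) (Fin n) E), N' n (x.map u) = N n x

/-- A matrix of functionals on `E`, seen as a map from `E` to matrices. -/
def matrixMap {E : Type*} [AddCommGroup E] [Module ℂ E] {k : ℕ}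
    (f : Matrix (Fin k) (Fin k) (E →ₗ[ℂ] ℂ)) : E →ₗ[ℂ] Matrix (Fin k) (Fin k) ℂ where
  toFun x := f.map fun φ => φ x
  map_add' _ _ := by ext; simp
  map_smul' _ _ := by ext; simp

/-- The norm of `cb(E, M_k)` on `k × k` matrices of functionals. -/
def functionalGauge {E : Type*} [AddCommGroup E] [Module ℂ E] (N : MatGauge E) :
    MatGauge (E →ₗ[ℂ] ℂ) :=
  fun k f => cbNorm N (matGauge k scalarGauge) (matrixMap f)

/-! ### Projective tensor product, trace class -/

/-- The operator space projective tensor norm of `u ∈ M_n(E ⊗ F)`: the infimum of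
`‖α‖ ‖x‖ ‖y‖ ‖β‖` over all factorizations `u = α (x ⊗ y) β`, where `x ∈ M_p(E)`, `y ∈ M_q(F)` and
`α`, `β` are scalar matrices of sizes `n × pq` and `pq × n`. -/
def projGauge {E F : Type*} [AddCommGroup E] [Module ℂ E] [AddCommGroup F] [Module ℂ F]
    (N : MatGauge E) (N' : MatGauge F) : MatGauge (E ⊗[ℂ] F) := fun n u =>
  ⨅ (p : ℕ) (q : ℕ) (x : Matrix (Fin p) (Fin p) E) (y : Matrix (Fin q) (Fin q) F)
    (α : Matrix (Fin n) (Fin p × Fin q) ℂ) (β : Matrix (Fin p × Fin q) (Fin n) ℂ)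
    (_ : u = sandwich α (Matrix.of fun a b => x a.1 b.1 ⊗ₜ[ℂ] y a.2 b.2) β),
    opNorm α * N p x * N' q y * opNorm β

/-- The functional `b ↦ tr(ab)` on `M_n`. -/
def traceFunctional {n : ℕ} (a : Matrix (Fin n) (Fin n) ℂ) : Matrix (Fin n) (Fin n) ℂ →ₗ[ℂ] ℂ :=
  Matrix.traceLinearMap (Fin n) ℂ ℂ ∘ₗ LinearMap.mulLeft ℂ a

/-- The matrix norms of `S_n^1`, the dual of `S_n^∞ = M_n` under the pairing `tr(ab)`. -/
def traceClassGauge (n : ℕ) : MatGauge (Matrix (Fin n) (Fin n) ℂ) :=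
  fun k x => functionalGauge (matGauge n scalarGauge) k (x.map traceFunctional)

/-- The identification of `E`-valued `n × n` matrices with `M_n ⊗ E`. -/
def matTensor {E : Type*} [AddCommGroup E] [Module ℂ E] (n : ℕ) :
    Matrix (Fin n) (Fin n) E →ₗ[ℂ] Matrix (Fin n) (Fin n) ℂ ⊗[ℂ] E where
  toFun A := ∑ i, ∑ j, Matrix.single i j (1 : ℂ) ⊗ₜ[ℂ] A i j
  map_add' _ _ := by simp [TensorProduct.tmul_add, Finset.sum_add_distrib]
  map_smul' _ _ := by simp [TensorProduct.tmul_smul, Finset.smul_sum]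

/-- The matrix norms of `S_n^1(E)`, the projective tensor product of `S_n^1` and `E`. -/
def schattenOneGauge {E : Type*} [AddCommGroup E] [Module ℂ E] (n : ℕ) (N : MatGauge E) :
    MatGauge (Matrix (Fin n) (Fin n) E) :=
  fun k u => projGauge (traceClassGauge n) N k (u.map (matTensor n))

/-- The matrix norms of the weighted `ℓ^1`-sum `{x : ∑ w_i ‖x_i‖ < ∞}` of operator spaces: the norm
of `x` is the supremum of `‖∑ w_i u_i(x_i)‖` over all families of complete contractions
`u_i : E_i → M_m`, `m ∈ ℕ`. -/
def ellOneGauge {ι : Type*} {E : ι → Type*} [∀ i, AddCommGroup (E i)] [∀ i, Module ℂ (E i)]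
    (w : ι → ℕ) (N : ∀ i, MatGauge (E i)) : MatGauge (∀ i, E i) := fun k x =>
  ⨆ (m : ℕ) (u : ∀ i, E i →ₗ[ℂ] Matrix (Fin m) (Fin m) ℂ)
    (_ : ∀ i, cbNorm (N i) (matGauge m scalarGauge) (u i) ≤ 1),
    matGauge m scalarGauge k
      (Matrix.of fun a b => ∑' i, (w i : ℂ) • u i (x a b i))

/-- The matrix norms of an `ℓ^∞`-sum of operator spaces. -/
def ellInftyGauge {ι : Type*} {E : ι → Type*} (N : ∀ i, MatGauge (E i)) : MatGauge (∀ i, E i) :=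
  fun k x => ⨆ i, N i k (x.map fun y => y i)

/-! ### The dual object of a compact group -/

/-- A continuous irreducible unitary representation of `G` on `ℂ^d`. -/
structure IrrepU (G : Type*) [Group G] [TopologicalSpace G] where
  d : ℕ
  toHom : G →* Matrix.unitaryGroup (Fin d) ℂ
  continuous_toHom : Continuous toHom
  d_pos : 0 < d
  irreducible : ∀ W : Submodule ℂ (Fin d → ℂ),
    (∀ g, ∀ v ∈ W, (toHom g : Matrix (Fin d) (Fin d) ℂ) *ᵥ v ∈ W) → W = ⊥ ∨ W = ⊤

/-- Unitary equivalence of representations. -/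
def IrrepU.Equivalent {G : Type*} [Group G] [TopologicalSpace G] (π ρ : IrrepU G) : Prop :=
  ∃ U : Matrix (Fin ρ.d) (Fin π.d) ℂ, Uᴴ * U = 1 ∧ U * Uᴴ = 1 ∧
    ∀ g, U * (π.toHom g : Matrix (Fin π.d) (Fin π.d) ℂ) =
      (ρ.toHom g : Matrix (Fin ρ.d) (Fin ρ.d) ℂ) * U

theorem IrrepU.Equivalent.d_eq {G : Type*} [Group G] [TopologicalSpace G] {π ρ : IrrepU G}
    (h : π.Equivalent ρ) : π.d = ρ.d := by
  obtain ⟨U, h1, h2, -⟩ := h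
  have e := Matrix.trace_mul_comm Uᴴ U
  rw [h1, h2] at e
  simpa using e

instance irrepSetoid (G : Type*) [Group G] [TopologicalSpace G] : Setoid (IrrepU G) where
  r := IrrepU.Equivalent
  iseqv :=
    { refl := fun π => ⟨1, by simp, by simp, by simp⟩
      symm := by
        rintro π ρ ⟨U, h1, h2, h3⟩
        refine ⟨Uᴴ, by simpa using h2, by simpa using h1, fun g => ?_⟩
        calc Uᴴ * (ρ.toHom g : Matrix (Fin ρ.d) (Fin ρ.d) ℂ)
            = Uᴴ * ((ρ.toHom g : Matrix (Fin ρ.d) (Fin ρ.d) ℂ) * U) * Uᴴ := by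
              rw [Matrix.mul_assoc, Matrix.mul_assoc, h2, Matrix.mul_one]
          _ = _ := by rw [← h3, ← Matrix.mul_assoc, h1, Matrix.one_mul]
      trans := by
        rintro π ρ σ ⟨U, h1, h2, h3⟩ ⟨V, k1, k2, k3⟩
        refine ⟨V * U, ?_, ?_, fun g => ?_⟩
        · rw [Matrix.conjTranspose_mul, Matrix.mul_assoc, ← Matrix.mul_assoc Vᴴ, k1,
            Matrix.one_mul, h1]
        · rw [Matrix.conjTranspose_mul, Matrix.mul_assoc, ← Matrix.mul_assoc U, h2,
            Matrix.one_mul, k2]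
        · rw [Matrix.mul_assoc, h3, ← Matrix.mul_assoc, k3, Matrix.mul_assoc] }

/-- The dual object `Ĝ`: the set of unitary equivalence classes of continuous irreducible unitary
representations of `G`. -/
def DualObject (G : Type*) [Group G] [TopologicalSpace G] := Quotient (irrepSetoid G)

/-- The degree `d_π` of `π ∈ Ĝ`. -/
def DualObject.deg {G : Type*} [Group G] [TopologicalSpace G] (π : DualObject G) : ℕ :=
  Quotient.lift IrrepU.d (fun _ _ h => IrrepU.Equivalent.d_eq h) π

/-- Families `(A^π)` with `A^π` a `d_π × d_π` matrix over `E`. -/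
abbrev MatFamily (G : Type*) [Group G] [TopologicalSpace G] (E : Type*) :=
  ∀ π : DualObject G, Matrix (Fin π.deg) (Fin π.deg) E

/-! ### Facts about the operator norm of matrices -/

section OpNormLemmas

set_option linter.unusedSectionVars false

open scoped Matrix.Norms.L2Operator

variable {l m n p : Type*} [Fintype l] [Fintype m] [Fintype n] [Fintype p]
  [DecidableEq l] [DecidableEq m] [DecidableEq n] [DecidableEq p]

theorem opNorm_ne_top (A : Matrix m n ℂ) : opNorm A ≠ ∞ := enorm_ne_top

theorem opNorm_zero : opNorm (0 : Matrix m n ℂ) = 0 := enorm_zero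

theorem opNorm_eq_zero {A : Matrix m n ℂ} : opNorm A = 0 ↔ A = 0 := enorm_eq_zero

theorem opNorm_add_le (A B : Matrix m n ℂ) : opNorm (A + B) ≤ opNorm A + opNorm B :=
  enorm_add_le A B

theorem opNorm_smul (c : ℂ) (A : Matrix m n ℂ) : opNorm (c • A) = ‖c‖ₑ * opNorm A :=
  enorm_smul c A

theorem opNorm_mul_le (A : Matrix l m ℂ) (B : Matrix m n ℂ) :
    opNorm (A * B) ≤ opNorm A * opNorm B := by
  have h := Matrix.l2_opNNNorm_mul A B
  unfold opNorm
  simp only [enorm_eq_nnnorm]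
  exact_mod_cast h

theorem opNorm_le_iff (A : Matrix m n ℂ) (C : ℝ) (hC : 0 ≤ C) :
    opNorm A ≤ ENNReal.ofReal C ↔ ∀ v : n → ℂ, ∑ i, ‖(A *ᵥ v) i‖ ^ 2 ≤ C ^ 2 * ∑ j, ‖v j‖ ^ 2 := by
  unfold opNorm
  rw [← ofReal_norm, ENNReal.ofReal_le_ofReal_iff hC, Matrix.l2_opNorm_def,
    ContinuousLinearMap.opNorm_le_iff hC]
  constructor
  · intro h v
    have := h (WithLp.toLp 2 v)
    rw [← sq_le_sq₀ (by positivity) (by positivity), mul_pow, EuclideanSpace.norm_sq_eq,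
      EuclideanSpace.norm_sq_eq] at this
    simpa using this
  · intro h v
    rw [← sq_le_sq₀ (by positivity) (by positivity), mul_pow, EuclideanSpace.norm_sq_eq,
      EuclideanSpace.norm_sq_eq]
    simpa using h v.ofLp

theorem opNorm_le_iff' (A : Matrix m n ℂ) (c : ℝ≥0∞) (hc : c ≠ ∞) :
    opNorm A ≤ c ↔ ∀ v : n → ℂ, ∑ i, ‖(A *ᵥ v) i‖ ^ 2 ≤ c.toReal ^ 2 * ∑ j, ‖v j‖ ^ 2 := by
  rw [← opNorm_le_iff _ _ ENNReal.toReal_nonneg, ENNReal.ofReal_toReal hc]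

theorem opNorm_mulVec_le (A : Matrix m n ℂ) (v : n → ℂ) :
    ∑ i, ‖(A *ᵥ v) i‖ ^ 2 ≤ (opNorm A).toReal ^ 2 * ∑ j, ‖v j‖ ^ 2 :=
  (opNorm_le_iff' A _ (opNorm_ne_top A)).1 le_rfl v

theorem opNorm_reindex_le (A : Matrix m n ℂ) (e : m ≃ l) (f : n ≃ p) :
    opNorm (Matrix.reindex e f A) ≤ opNorm A := by
  rw [opNorm_le_iff' _ _ (opNorm_ne_top A)]
  intro v
  have h := opNorm_mulVec_le A (v ∘ f)
  have h1 : ∀ i, (Matrix.reindex e f A *ᵥ v) i = (A *ᵥ (v ∘ f)) (e.symm i) := by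
    intro i
    simp only [Matrix.mulVec, dotProduct, Matrix.reindex_apply, Matrix.submatrix_apply,
      Function.comp]
    exact (Equiv.sum_comp f (fun j => A (e.symm i) (f.symm j) * v j)).symm.trans
      (by simp)
  simp only [h1]
  rw [Equiv.sum_comp e.symm (fun i => ‖(A *ᵥ (v ∘ f)) i‖ ^ 2)]
  refine h.trans_eq ?_
  congr 1
  exact Equiv.sum_comp f (fun j => ‖v j‖ ^ 2)

theorem opNorm_reindex (A : Matrix m n ℂ) (e : m ≃ l) (f : n ≃ p) :
    opNorm (Matrix.reindex e f A) = opNorm A := by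
  refine le_antisymm (opNorm_reindex_le A e f) ?_
  have := opNorm_reindex_le (Matrix.reindex e f A) e.symm f.symm
  simpa using this

theorem opNorm_fromBlocks_le (A : Matrix m n ℂ) (B : Matrix l p ℂ) :
    opNorm (Matrix.fromBlocks A 0 0 B) ≤ max (opNorm A) (opNorm B) := by
  have ht : max (opNorm A) (opNorm B) ≠ ∞ := by simp [opNorm_ne_top]
  rw [opNorm_le_iff' _ _ ht]
  intro v
  have e : v = Sum.elim (v ∘ Sum.inl) (v ∘ Sum.inr) := by simp
  have hA := opNorm_mulVec_le A (v ∘ Sum.inl)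
  have hB := opNorm_mulVec_le B (v ∘ Sum.inr)
  rw [Matrix.fromBlocks_mulVec]
  simp only [Fintype.sum_sum_type, Sum.elim_inl, Sum.elim_inr, Matrix.zero_mulVec, add_zero,
    zero_add, mul_add]
  have ha : (opNorm A).toReal ≤ (max (opNorm A) (opNorm B)).toReal :=
    ENNReal.toReal_mono ht (le_max_left _ _)
  have hb : (opNorm B).toReal ≤ (max (opNorm A) (opNorm B)).toReal :=
    ENNReal.toReal_mono ht (le_max_right _ _)
  refine add_le_add (hA.trans ?_) (hB.trans ?_)
  · simp only [Function.comp]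
    gcongr
  · simp only [Function.comp]
    gcongr

theorem opNorm_submatrix_le (A : Matrix m n ℂ) {e : l → m} {f : p → n}
    (he : Function.Injective e) (hf : Function.Injective f) :
    opNorm (A.submatrix e f) ≤ opNorm A := by
  rw [opNorm_le_iff' _ _ (opNorm_ne_top A)]
  intro v
  have h := opNorm_mulVec_le A (Function.extend f v 0)
  have h1 : ∀ i, (A.submatrix e f *ᵥ v) i = (A *ᵥ Function.extend f v 0) (e i) := by
    intro i
    simp only [Matrix.mulVec, dotProduct, Matrix.submatrix_apply]
    refine (Fintype.sum_of_injective f hf _ _ ?_ ?_)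
    · intro j hj
      rw [Function.extend_apply' _ _ _ (by simpa using hj)]
      simp
    · intro j
      rw [hf.extend_apply]
  have h2 : ∑ j, ‖Function.extend f v 0 j‖ ^ 2 = ∑ j, ‖v j‖ ^ 2 := by
    symm
    refine Fintype.sum_of_injective f hf _ _ ?_ ?_
    · intro j hj
      rw [Function.extend_apply' _ _ _ (by simpa using hj)]
      simp
    · intro j
      rw [hf.extend_apply]
  rw [h2] at h
  refine le_trans ?_ h
  simp only [h1]
  refine (Finset.sum_map Finset.univ ⟨e, he⟩
    (fun i => ‖(A *ᵥ Function.extend f v 0) i‖ ^ 2)).symm.trans_le ?_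
  exact Finset.sum_le_sum_of_subset_of_nonneg (Finset.subset_univ _) (fun _ _ _ => by positivity)

/-- The matrix `1 ⊗ α`. -/
def ampl (k : Type*) [DecidableEq k] (α : Matrix m n ℂ) : Matrix (k × m) (k × n) ℂ :=
  Matrix.of fun a b => if a.1 = b.1 then α a.2 b.2 else 0

theorem opNorm_ampl_le (α : Matrix m n ℂ) : opNorm (ampl p α) ≤ opNorm α := by
  rw [opNorm_le_iff' _ _ (opNorm_ne_top α)]
  intro v
  rw [Fintype.sum_prod_type, Fintype.sum_prod_type, Finset.mul_sum]
  refine Finset.sum_le_sum fun a _ => ?_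
  refine le_trans (le_of_eq ?_) (opNorm_mulVec_le α (fun j => v (a, j)))
  refine Finset.sum_congr rfl fun i _ => ?_
  simp [Matrix.mulVec, dotProduct, ampl, Fintype.sum_prod_type, ite_mul, Finset.sum_ite_irrel]

theorem opNorm_sq (δ : Matrix m n ℂ) : opNorm δ ^ 2 = opNorm (δ * δᴴ) := by
  have h1 := Matrix.l2_opNNNorm_conjTranspose_mul_self δᴴ
  rw [Matrix.conjTranspose_conjTranspose, Matrix.l2_opNNNorm_conjTranspose] at h1
  unfold opNorm
  simp only [enorm_eq_nnnorm]
  rw [h1, sq]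
  push_cast
  rfl

theorem opNorm_sq_add_le (α : Matrix n m ℂ) (β : Matrix n p ℂ) (γ : Matrix n l ℂ)
    (h : γ * γᴴ = α * αᴴ + β * βᴴ) : opNorm γ ^ 2 ≤ opNorm α ^ 2 + opNorm β ^ 2 := by
  rw [opNorm_sq γ, opNorm_sq α, opNorm_sq β, h]
  exact opNorm_add_le _ _

theorem opNorm_one_le : opNorm (1 : Matrix m m ℂ) ≤ 1 := by
  rw [opNorm_le_iff' _ _ ENNReal.one_ne_top]
  simp

theorem opNorm_conjTranspose (A : Matrix m n ℂ) : opNorm Aᴴ = opNorm A := by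
  unfold opNorm
  simp only [enorm_eq_nnnorm, Matrix.l2_opNNNorm_conjTranspose]

theorem tendsto_opNorm {ι : Type*} {f : Filter ι} {A : ι → Matrix m n ℂ} {B : Matrix m n ℂ}
    (h : Filter.Tendsto A f (nhds B)) :
    Filter.Tendsto (fun i => opNorm (A i)) f (nhds (opNorm B)) :=
  (continuous_enorm.tendsto B).comp h

end OpNormLemmas

/-! ### The dual operator space -/

section Dual

variable {E : Type*} [AddCommGroup E] [Module ℂ E]

/-- The block matrix `(f_ij(x_ab))`. -/
def blk {n k : ℕ} (f : Matrix (Fin k) (Fin k) (E →ₗ[ℂ] ℂ)) (x : Matrix (Fin n) (Fin n) E) :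
    Matrix (Fin n × Fin k) (Fin n × Fin k) ℂ :=
  Matrix.of fun a b => f a.2 b.2 (x a.1 b.1)

theorem matGauge_matrixMap {n k : ℕ} (f : Matrix (Fin k) (Fin k) (E →ₗ[ℂ] ℂ))
    (x : Matrix (Fin n) (Fin n) E) :
    matGauge k scalarGauge n (x.map (matrixMap f)) = opNorm (blk f x) := by
  unfold matGauge scalarGauge flatten
  rw [opNorm_reindex]
  rfl

theorem functionalGauge_le_iff {N : MatGauge E} {k : ℕ}
    {f : Matrix (Fin k) (Fin k) (E →ₗ[ℂ] ℂ)} {C : ℝ≥0∞} :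
    functionalGauge N k f ≤ C ↔
      ∀ n (x : Matrix (Fin n) (Fin n) E), N n x ≤ 1 → opNorm (blk f x) ≤ C := by
  simp only [functionalGauge, cbNorm, iSup_le_iff, matGauge_matrixMap]

theorem opNorm_blk_le (N : MatGauge E) {n k : ℕ} (f : Matrix (Fin k) (Fin k) (E →ₗ[ℂ] ℂ))
    (x : Matrix (Fin n) (Fin n) E) (hx : N n x ≤ 1) : opNorm (blk f x) ≤ functionalGauge N k f :=
  functionalGauge_le_iff.1 le_rfl n x hx

theorem cbNorm_scalar_le_iff {N : MatGauge E} {φ : E →ₗ[ℂ] ℂ} {C : ℝ≥0∞} :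
    cbNorm N scalarGauge φ ≤ C ↔
      ∀ n (x : Matrix (Fin n) (Fin n) E), N n x ≤ 1 → opNorm (x.map φ) ≤ C := by
  simp only [cbNorm, iSup_le_iff, scalarGauge]

theorem opNorm_map_le (N : MatGauge E) {n : ℕ} (φ : E →ₗ[ℂ] ℂ)
    (x : Matrix (Fin n) (Fin n) E) (hx : N n x ≤ 1) :
    opNorm (x.map φ) ≤ cbNorm N scalarGauge φ :=
  cbNorm_scalar_le_iff.1 le_rfl n x hx

theorem norm₁_functionalGauge (N : MatGauge E) (φ : E →ₗ[ℂ] ℂ) :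
    norm₁ (functionalGauge N) φ = cbNorm N scalarGauge φ := by
  have h : ∀ (n : ℕ) (x : Matrix (Fin n) (Fin n) E),
      opNorm (blk (Matrix.of fun _ _ : Fin 1 => φ) x) = opNorm (x.map φ) := by
    intro n x
    rw [← opNorm_reindex (x.map φ) (Equiv.prodUnique (Fin n) (Fin 1)).symm
      (Equiv.prodUnique (Fin n) (Fin 1)).symm]
    rfl
  refine eq_of_forall_ge_iff fun C => ?_
  rw [norm₁, functionalGauge_le_iff, cbNorm_scalar_le_iff]
  simp only [h]

theorem functionalGauge_add_le (N : MatGauge E) (k : ℕ)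
    (f g : Matrix (Fin k) (Fin k) (E →ₗ[ℂ] ℂ)) :
    functionalGauge N k (f + g) ≤ functionalGauge N k f + functionalGauge N k g := by
  refine functionalGauge_le_iff.2 fun n x hx => ?_
  have : blk (f + g) x = blk f x + blk g x := by ext; simp [blk]
  rw [this]
  exact (opNorm_add_le _ _).trans (add_le_add (opNorm_blk_le N f x hx) (opNorm_blk_le N g x hx))

theorem functionalGauge_zero (N : MatGauge E) (k : ℕ) :
    functionalGauge N k 0 = 0 := by
  refine le_antisymm (functionalGauge_le_iff.2 fun n x hx => ?_) zero_le
  have : blk (0 : Matrix (Fin k) (Fin k) (E →ₗ[ℂ] ℂ)) x = 0 := by ext; simp [blk]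
  rw [this, opNorm_zero]

theorem functionalGauge_smul_le (N : MatGauge E) (k : ℕ) (c : ℂ)
    (f : Matrix (Fin k) (Fin k) (E →ₗ[ℂ] ℂ)) :
    functionalGauge N k (c • f) ≤ ‖c‖ₑ * functionalGauge N k f := by
  refine functionalGauge_le_iff.2 fun n x hx => ?_
  have : blk (c • f) x = c • blk f x := by ext; simp [blk]
  rw [this, opNorm_smul]
  gcongr
  exact opNorm_blk_le N f x hx

theorem smul_eq_of_smul_le {V : Type*} [AddCommGroup V] [Module ℂ V] (g : V → ℝ≥0∞)
    (h : ∀ (c : ℂ) v, g (c • v) ≤ ‖c‖ₑ * g v) (c : ℂ) (v : V) :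
    g (c • v) = ‖c‖ₑ * g v := by
  refine le_antisymm (h c v) ?_
  rcases eq_or_ne c 0 with rfl | hc
  · simp
  · have h1 := h c⁻¹ (c • v)
    rw [inv_smul_smul₀ hc] at h1
    calc ‖c‖ₑ * g v ≤ ‖c‖ₑ * (‖c⁻¹‖ₑ * g (c • v)) := by gcongr
      _ = ‖c * c⁻¹‖ₑ * g (c • v) := by rw [enorm_mul, mul_assoc]
      _ = g (c • v) := by rw [mul_inv_cancel₀ hc]; simp

theorem functionalGauge_smul (N : MatGauge E) (k : ℕ) (c : ℂ)
    (f : Matrix (Fin k) (Fin k) (E →ₗ[ℂ] ℂ)) :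
    functionalGauge N k (c • f) = ‖c‖ₑ * functionalGauge N k f :=
  smul_eq_of_smul_le _ (functionalGauge_smul_le N k) c f

theorem functionalGauge_directSum (N : MatGauge E) (m n : ℕ)
    (f : Matrix (Fin m) (Fin m) (E →ₗ[ℂ] ℂ)) (g : Matrix (Fin n) (Fin n) (E →ₗ[ℂ] ℂ)) :
    functionalGauge N (m + n) (directSum f g) =
      max (functionalGauge N m f) (functionalGauge N n g) := by
  apply le_antisymm
  · refine functionalGauge_le_iff.2 fun k x hx => ?_
    have e : blk (directSum f g) x =
        Matrix.reindex ((Equiv.prodSumDistrib (Fin k) (Fin m) (Fin n)).symm.trans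
            ((Equiv.refl _).prodCongr finSumFinEquiv))
          ((Equiv.prodSumDistrib (Fin k) (Fin m) (Fin n)).symm.trans
            ((Equiv.refl _).prodCongr finSumFinEquiv))
          (Matrix.fromBlocks (blk f x) 0 0 (blk g x)) := by
      ext ⟨a, i⟩ ⟨b, j⟩
      obtain ⟨i, rfl⟩ := finSumFinEquiv.surjective i
      obtain ⟨j, rfl⟩ := finSumFinEquiv.surjective j
      rcases i with i | i <;> rcases j with j | j <;> simp [blk, directSum]
    rw [e, opNorm_reindex]
    exact (opNorm_fromBlocks_le _ _).trans
      (max_le_max (opNorm_blk_le N f x hx) (opNorm_blk_le N g x hx))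
  · refine max_le (functionalGauge_le_iff.2 fun k x hx => ?_)
      (functionalGauge_le_iff.2 fun k x hx => ?_)
    · have e : blk f x = (blk (directSum f g) x).submatrix
          (Prod.map id (Fin.castAdd n)) (Prod.map id (Fin.castAdd n)) := by
        ext ⟨a, i⟩ ⟨b, j⟩
        simp [blk, directSum]
      rw [e]
      refine (opNorm_submatrix_le _ ?_ ?_).trans (opNorm_blk_le N _ x hx) <;>
        exact Function.injective_id.prodMap (Fin.castAdd_injective m n)
    · have e : blk g x = (blk (directSum f g) x).submatrix
          (Prod.map id (Fin.natAdd m)) (Prod.map id (Fin.natAdd m)) := by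
        ext ⟨a, i⟩ ⟨b, j⟩
        simp [blk, directSum]
      rw [e]
      refine (opNorm_submatrix_le _ ?_ ?_).trans (opNorm_blk_le N _ x hx) <;>
        exact Function.injective_id.prodMap (Fin.natAdd_injective n m)

theorem functionalGauge_sandwich_le (N : MatGauge E) (m n : ℕ) (α : Matrix (Fin m) (Fin n) ℂ)
    (f : Matrix (Fin n) (Fin n) (E →ₗ[ℂ] ℂ)) (β : Matrix (Fin n) (Fin m) ℂ) :
    functionalGauge N m (sandwich α f β) ≤ opNorm α * functionalGauge N n f * opNorm β := by
  refine functionalGauge_le_iff.2 fun k x hx => ?_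
  have e : blk (sandwich α f β) x = ampl (Fin k) α * blk f x * ampl (Fin k) β := by
    ext ⟨a, i⟩ ⟨b, j⟩
    simp only [blk, sandwich, ampl, Matrix.mul_apply, Matrix.of_apply, Fintype.sum_prod_type,
      LinearMap.sum_apply, LinearMap.smul_apply, ite_mul, zero_mul, mul_ite, mul_zero,
      Finset.sum_ite_irrel, Finset.sum_const_zero, Finset.sum_ite_eq, Finset.sum_ite_eq',
      Finset.mem_univ, if_true, Finset.sum_mul, smul_eq_mul]
    rw [Finset.sum_comm]
    refine Finset.sum_congr rfl fun s _ => Finset.sum_congr rfl fun r _ => ?_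
    ring
  rw [e]
  refine (opNorm_mul_le _ _).trans ?_
  gcongr
  · refine (opNorm_mul_le _ _).trans ?_
    gcongr
    · exact opNorm_ampl_le α
    · exact opNorm_blk_le N f x hx
  · exact opNorm_ampl_le β

theorem functionalGauge_ne_top (N : MatGauge E) (k : ℕ)
    (f : Matrix (Fin k) (Fin k) (E →ₗ[ℂ] ℂ)) (hf : ∀ i j, cbNorm N scalarGauge (f i j) ≠ ∞) :
    functionalGauge N k f ≠ ∞ := by
  have h : functionalGauge N k f ≤ ∑ i, ∑ j, cbNorm N scalarGauge (f i j) := by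
    refine functionalGauge_le_iff.2 fun n x hx => ?_
    have e : blk f x = ∑ i, ∑ j,
        (1 : Matrix (Fin n × Fin k) (Fin n × Fin k) ℂ).submatrix id (fun a => (a, i)) *
          x.map (f i j) *
          (1 : Matrix (Fin n × Fin k) (Fin n × Fin k) ℂ).submatrix (fun a => (a, j)) id := by
      ext ⟨a, i⟩ ⟨b, j⟩
      simp [blk, Matrix.sum_apply, Matrix.mul_apply, Matrix.one_apply, Prod.ext_iff, ite_and]
    have s : ∀ {ι : Type} (t : Finset ι)
        (A : ι → Matrix (Fin n × Fin k) (Fin n × Fin k) ℂ),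
        opNorm (∑ i ∈ t, A i) ≤ ∑ i ∈ t, opNorm (A i) := fun t A =>
      Finset.le_sum_of_subadditive _ opNorm_zero.le opNorm_add_le _ _
    rw [e]
    refine (s _ _).trans (Finset.sum_le_sum fun i _ => (s _ _).trans
      (Finset.sum_le_sum fun j _ => ?_))
    refine (opNorm_mul_le _ _).trans ?_
    have h1 : opNorm ((1 : Matrix (Fin n × Fin k) (Fin n × Fin k) ℂ).submatrix id
        (fun a => (a, i))) ≤ 1 :=
      (opNorm_submatrix_le _ Function.injective_id (Prod.mk_left_injective i)).trans opNorm_one_le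
    have h2 : opNorm ((1 : Matrix (Fin n × Fin k) (Fin n × Fin k) ℂ).submatrix
        (fun a => (a, j)) id) ≤ 1 :=
      (opNorm_submatrix_le _ (Prod.mk_left_injective j) Function.injective_id).trans opNorm_one_le
    calc _ ≤ (1 * cbNorm N scalarGauge (f i j)) * 1 :=
          mul_le_mul' ((opNorm_mul_le _ _).trans (mul_le_mul' h1 (opNorm_map_le N _ x hx))) h2
      _ = _ := by simp
  refine ne_top_of_le_ne_top ?_ h
  simp [ENNReal.sum_eq_top, hf]

/-- The dual `E* = cb(E, ℂ)`, as a space of functionals. -/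
def cbDual (N : MatGauge E) : Submodule ℂ (E →ₗ[ℂ] ℂ) where
  carrier := {φ | cbNorm N scalarGauge φ ≠ ∞}
  add_mem' {φ ψ} hφ hψ := by
    simp only [Set.mem_ofPred_eq, ← norm₁_functionalGauge] at hφ hψ ⊢
    exact ne_top_of_le_ne_top (ENNReal.add_ne_top.2 ⟨hφ, hψ⟩) (functionalGauge_add_le N 1 _ _)
  zero_mem' := by
    simp only [Set.mem_ofPred_eq, ← norm₁_functionalGauge]
    have := functionalGauge_zero N 1
    exact ne_of_eq_of_ne this ENNReal.zero_ne_top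
  smul_mem' c φ hφ := by
    simp only [Set.mem_ofPred_eq, ← norm₁_functionalGauge] at hφ ⊢
    exact ne_top_of_le_ne_top (ENNReal.mul_ne_top enorm_ne_top hφ)
      (functionalGauge_smul_le N 1 c _)

/-- The matrix norms of `E*`: the norm of `M_n(E*)` is that of `cb(E, M_n)`. -/
def dualGauge (N : MatGauge E) : MatGauge (cbDual N) :=
  fun k f => functionalGauge N k (f.map fun φ => (φ : E →ₗ[ℂ] ℂ))

theorem norm₁_dualGauge (N : MatGauge E) (φ : cbDual N) :
    norm₁ (dualGauge N) φ = cbNorm N scalarGauge (φ : E →ₗ[ℂ] ℂ) := by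
  rw [← norm₁_functionalGauge]
  rfl

theorem enorm_apply_le [OperatorSpace E] (φ : E →ₗ[ℂ] ℂ) (x : E)
    (hx : norm₁ OperatorSpace.mnorm x ≤ 1) :
    ‖φ x‖ₑ ≤ cbNorm OperatorSpace.mnorm scalarGauge φ := by
  refine le_trans ?_ (opNorm_map_le _ φ (Matrix.of fun _ _ : Fin 1 => x) hx)
  have : (Matrix.of fun _ _ : Fin 1 => x).map φ = φ x • (1 : Matrix (Fin 1) (Fin 1) ℂ) := by
    ext i j
    simp [Subsingleton.elim i j]
  rw [this, opNorm_smul]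
  have h1 : (1 : ℝ≥0∞) ≤ opNorm (1 : Matrix (Fin 1) (Fin 1) ℂ) := by
    unfold opNorm
    open scoped Matrix.Norms.L2Operator in
    simp [enorm_eq_nnnorm]
  calc ‖φ x‖ₑ = ‖φ x‖ₑ * 1 := (mul_one _).symm
    _ ≤ _ := by gcongr

theorem exists_smul_norm₁_le [OperatorSpace E] (x : E) :
    ∃ c : ℂ, c ≠ 0 ∧ norm₁ OperatorSpace.mnorm (c • x) ≤ 1 := by
  have hs : ∀ c : ℂ, norm₁ OperatorSpace.mnorm (c • x) = ‖c‖ₑ * norm₁ OperatorSpace.mnorm x :=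
    fun c => OperatorSpace.mnorm_smul 1 c (Matrix.of fun _ _ => x)
  have ht : norm₁ OperatorSpace.mnorm x ≠ ∞ := OperatorSpace.mnorm_ne_top 1 _
  set t := norm₁ OperatorSpace.mnorm x
  refine ⟨((t.toReal + 1)⁻¹ : ℝ), ?_, ?_⟩
  · have : (0 : ℝ) < t.toReal + 1 := by positivity
    exact_mod_cast (inv_pos.2 this).ne'
  · rw [hs, ← ENNReal.ofReal_toReal ht, ← ofReal_norm, ← ENNReal.ofReal_mul (norm_nonneg _)]
    rw [ENNReal.ofReal_le_one, Complex.norm_real, Real.norm_of_nonneg (by positivity)]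
    rw [inv_mul_le_iff₀ (by positivity)]
    simp [ENNReal.toReal_ofReal]

theorem cbDual_complete [OperatorSpace E] (s : ℕ → cbDual (OperatorSpace.mnorm (E := E)))
    (hs : ∀ ε : ℝ≥0∞, 0 < ε → ∃ K, ∀ i ≥ K, ∀ j ≥ K,
      cbNorm OperatorSpace.mnorm scalarGauge ((s i : E →ₗ[ℂ] ℂ) - (s j : E →ₗ[ℂ] ℂ)) < ε) :
    ∃ a : cbDual (OperatorSpace.mnorm (E := E)), ∀ ε : ℝ≥0∞, 0 < ε → ∃ K, ∀ i ≥ K,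
      cbNorm OperatorSpace.mnorm scalarGauge ((s i : E →ₗ[ℂ] ℂ) - (a : E →ₗ[ℂ] ℂ)) < ε := by
  have hlim : ∀ x : E, ∃ y : ℂ, Filter.Tendsto (fun i => (s i : E →ₗ[ℂ] ℂ) x) Filter.atTop
      (nhds y) := by
    intro x
    obtain ⟨c, hc, hx⟩ := exists_smul_norm₁_le x
    have hcs : CauchySeq (fun i => (s i : E →ₗ[ℂ] ℂ) (c • x)) := by
      rw [EMetric.cauchySeq_iff]
      intro ε hε
      obtain ⟨K, hK⟩ := hs ε hε
      refine ⟨K, fun i hi j hj => ?_⟩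
      rw [edist_eq_enorm_sub]
      exact (enorm_apply_le ((s i : E →ₗ[ℂ] ℂ) - (s j : E →ₗ[ℂ] ℂ)) _ hx).trans_lt (hK i hi j hj)
    obtain ⟨y, hy⟩ := cauchySeq_tendsto_of_complete hcs
    refine ⟨c⁻¹ * y, ?_⟩
    have := hy.const_mul c⁻¹
    simpa [hc] using this
  choose a ha using hlim
  let φ : E →ₗ[ℂ] ℂ := linearMapOfTendsto a (fun i => (s i : E →ₗ[ℂ] ℂ)) (tendsto_pi_nhds.2 ha)
  have hφ : ∀ ε : ℝ≥0∞, 0 < ε → ∃ K, ∀ i ≥ K,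
      cbNorm OperatorSpace.mnorm scalarGauge ((s i : E →ₗ[ℂ] ℂ) - φ) ≤ ε := by
    intro ε hε
    obtain ⟨K, hK⟩ := hs ε hε
    refine ⟨K, fun i hi => cbNorm_scalar_le_iff.2 fun n x hx => ?_⟩
    have ht : Filter.Tendsto (fun j => x.map ((s i : E →ₗ[ℂ] ℂ) - (s j : E →ₗ[ℂ] ℂ)))
        Filter.atTop (nhds (x.map ((s i : E →ₗ[ℂ] ℂ) - φ))) := by
      refine tendsto_pi_nhds.2 fun p => tendsto_pi_nhds.2 fun q => ?_
      exact (tendsto_const_nhds.sub (ha (x p q)))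
    refine le_of_tendsto (tendsto_opNorm ht) ?_
    filter_upwards [Filter.eventually_ge_atTop K] with j hj
    exact (opNorm_map_le _ _ x hx).trans (hK i hi j hj).le
  have hmem : φ ∈ cbDual (OperatorSpace.mnorm (E := E)) := by
    obtain ⟨K, hK⟩ := hφ 1 one_pos
    have h1 : ((s K : E →ₗ[ℂ] ℂ) - φ) ∈ cbDual (OperatorSpace.mnorm (E := E)) :=
      ne_top_of_le_ne_top ENNReal.one_ne_top (hK K le_rfl)
    simpa using Submodule.sub_mem _ (s K).2 h1
  refine ⟨⟨φ, hmem⟩, fun ε hε => ?_⟩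
  obtain ⟨δ, hδ, hδε⟩ := exists_between hε
  obtain ⟨K, hK⟩ := hφ δ hδ
  exact ⟨K, fun i hi => (hK i hi).trans_lt hδε⟩

/-- The dual of an operator space is an operator space. -/
instance [OperatorSpace E] : OperatorSpace (cbDual (OperatorSpace.mnorm (E := E))) where
  mnorm := dualGauge _
  mnorm_ne_top n f := functionalGauge_ne_top _ n _ fun i j => (f i j).2
  mnorm_add_le n f g := functionalGauge_add_le _ n _ _
  mnorm_smul n c f := functionalGauge_smul _ n c _
  eq_zero_of_mnorm n f h := by
    ext i j x
    obtain ⟨c, hc, hx⟩ := exists_smul_norm₁_le x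
    have h1 := (opNorm_blk_le OperatorSpace.mnorm
      (f.map fun φ => (φ : E →ₗ[ℂ] ℂ)) (Matrix.of fun _ _ : Fin 1 => c • x) hx).trans h.le
    have h2 := opNorm_eq_zero.1 (le_antisymm h1 zero_le)
    have h3 := congrFun (congrFun h2 (0, i)) (0, j)
    simpa [blk, hc] using h3
  mnorm_directSum m n f g := by
    have : (directSum f g).map (fun φ => (φ : E →ₗ[ℂ] ℂ)) =
        directSum (f.map fun φ => (φ : E →ₗ[ℂ] ℂ)) (g.map fun φ => (φ : E →ₗ[ℂ] ℂ)) := by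
      ext1 i j
      obtain ⟨i, rfl⟩ := finSumFinEquiv.surjective i
      obtain ⟨j, rfl⟩ := finSumFinEquiv.surjective j
      rcases i with i | i <;> rcases j with j | j <;> simp [directSum]
    unfold dualGauge
    rw [this, functionalGauge_directSum]
  mnorm_sandwich_le m n α f β := by
    have : (sandwich α f β).map (fun φ => (φ : E →ₗ[ℂ] ℂ)) =
        sandwich α (f.map fun φ => (φ : E →ₗ[ℂ] ℂ)) β := by
      ext1 i j
      simp [sandwich]
    unfold dualGauge
    rw [this]
    exact functionalGauge_sandwich_le _ m n α _ β
  complete s hs := by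
    simp only [norm₁_dualGauge, Submodule.coe_sub] at hs ⊢
    exact cbDual_complete s hs

end Dual

/-! ### The projective tensor norm is a seminorm -/

section Proj

theorem traceClassGauge_smul {n : ℕ} (k : ℕ) (c : ℂ)
    (x : Matrix (Fin k) (Fin k) (Matrix (Fin n) (Fin n) ℂ)) :
    traceClassGauge n k (c • x) = ‖c‖ₑ * traceClassGauge n k x := by
  have : (c • x).map traceFunctional = c • x.map traceFunctional := by
    ext i j b
    simp [traceFunctional]
  rw [traceClassGauge, this, functionalGauge_smul, traceClassGauge]

theorem traceClassGauge_directSum {n : ℕ} (p q : ℕ)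
    (x : Matrix (Fin p) (Fin p) (Matrix (Fin n) (Fin n) ℂ))
    (y : Matrix (Fin q) (Fin q) (Matrix (Fin n) (Fin n) ℂ)) :
    traceClassGauge n (p + q) (directSum x y) =
      max (traceClassGauge n p x) (traceClassGauge n q y) := by
  have h0 : traceFunctional (0 : Matrix (Fin n) (Fin n) ℂ) = 0 := by
    ext b
    simp [traceFunctional]
  have : (directSum x y).map traceFunctional =
      directSum (x.map traceFunctional) (y.map traceFunctional) := by
    ext1 i j
    obtain ⟨i, rfl⟩ := finSumFinEquiv.surjective i
    obtain ⟨j, rfl⟩ := finSumFinEquiv.surjective j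
    rcases i with i | i <;> rcases j with j | j <;> simp [directSum, h0]
  rw [traceClassGauge, this, functionalGauge_directSum]
  rfl

variable {E F : Type*} [AddCommGroup E] [Module ℂ E] [AddCommGroup F] [Module ℂ F]

/-- The matrix `x ⊗ y`. -/
def kron {p q : ℕ} (x : Matrix (Fin p) (Fin p) E) (y : Matrix (Fin q) (Fin q) F) :
    Matrix (Fin p × Fin q) (Fin p × Fin q) (E ⊗[ℂ] F) :=
  Matrix.of fun a b => x a.1 b.1 ⊗ₜ[ℂ] y a.2 b.2

theorem projGauge_le (N : MatGauge E) (N' : MatGauge F) {n p q : ℕ}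
    {u : Matrix (Fin n) (Fin n) (E ⊗[ℂ] F)} (x : Matrix (Fin p) (Fin p) E)
    (y : Matrix (Fin q) (Fin q) F)
    (α : Matrix (Fin n) (Fin p × Fin q) ℂ) (β : Matrix (Fin p × Fin q) (Fin n) ℂ)
    (h : u = sandwich α (kron x y) β) :
    projGauge N N' n u ≤ opNorm α * N p x * N' q y * opNorm β :=
  iInf_le_of_le p <| iInf_le_of_le q <| iInf_le_of_le x <| iInf_le_of_le y <|
    iInf_le_of_le α <| iInf_le_of_le β <| iInf_le_of_le h le_rfl

theorem projGauge_lt_iff (N : MatGauge E) (N' : MatGauge F) {n : ℕ}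
    {u : Matrix (Fin n) (Fin n) (E ⊗[ℂ] F)} {c : ℝ≥0∞} :
    projGauge N N' n u < c ↔ ∃ (p q : ℕ) (x : Matrix (Fin p) (Fin p) E)
      (y : Matrix (Fin q) (Fin q) F)
      (α : Matrix (Fin n) (Fin p × Fin q) ℂ) (β : Matrix (Fin p × Fin q) (Fin n) ℂ),
      u = sandwich α (kron x y) β ∧ opNorm α * N p x * N' q y * opNorm β < c := by
  simp only [projGauge, iInf_lt_iff, exists_prop]
  rfl

theorem projGauge_zero (N : MatGauge E) (N' : MatGauge F) (n : ℕ) : projGauge N N' n 0 = 0 := by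
  refine le_antisymm ?_ zero_le
  refine (projGauge_le N N' (p := 0) (q := 0) 0 0 0 0 ?_).trans ?_
  · ext i j
    simp [sandwich]
  · simp [opNorm_zero]

theorem projGauge_smul_le (N : MatGauge E) (N' : MatGauge F) (n : ℕ) (c : ℂ)
    (u : Matrix (Fin n) (Fin n) (E ⊗[ℂ] F)) :
    projGauge N N' n (c • u) ≤ ‖c‖ₑ * projGauge N N' n u := by
  rcases eq_or_ne c 0 with rfl | hc
  · rw [zero_smul, projGauge_zero]
    exact zero_le
  have hc' : ‖c‖ₑ ≠ 0 := by simpa using hc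
  refine ENNReal.le_of_forall_pos_le_add ?_ |>.trans le_rfl
  intro ε hε hlt
  have hu : projGauge N N' n u < projGauge N N' n u + ε / ‖c‖ₑ := by
    refine ENNReal.lt_add_right ?_ ?_
    · intro h
      rw [h, ENNReal.mul_top hc'] at hlt
      exact lt_irrefl _ hlt
    · exact (ENNReal.div_pos (by exact_mod_cast hε.ne') enorm_ne_top).ne'
  obtain ⟨p, q, x, y, α, β, rfl, h⟩ := (projGauge_lt_iff N N').1 hu
  set t := projGauge N N' n (sandwich α (kron x y) β)
  refine (projGauge_le N N' x y (c • α) β ?_).trans ?_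
  · ext1 i j
    simp [sandwich, Finset.smul_sum, smul_smul, mul_assoc]
  · rw [opNorm_smul]
    calc ‖c‖ₑ * opNorm α * N p x * N' q y * opNorm β
        = ‖c‖ₑ * (opNorm α * N p x * N' q y * opNorm β) := by ring
      _ ≤ ‖c‖ₑ * (t + ε / ‖c‖ₑ) := by gcongr
      _ = ‖c‖ₑ * t + ε := by
          rw [mul_add, ENNReal.mul_div_cancel hc' enorm_ne_top]

/-- A factorization of cost less than `c` can be normalized. -/
theorem projGauge_normalize [OperatorSpace F] (N : MatGauge E)
    (hN : ∀ k (c : ℂ) x, N k (c • x) = ‖c‖ₑ * N k x) {n : ℕ}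
    {u : Matrix (Fin n) (Fin n) (E ⊗[ℂ] F)} {c : ℝ} (hc : 0 < c)
    (h : projGauge N OperatorSpace.mnorm n u < ENNReal.ofReal c) :
    ∃ (p q : ℕ) (x : Matrix (Fin p) (Fin p) E) (y : Matrix (Fin q) (Fin q) F)
      (α : Matrix (Fin n) (Fin p × Fin q) ℂ) (β : Matrix (Fin p × Fin q) (Fin n) ℂ),
      u = sandwich α (kron x y) β ∧ N p x ≤ 1 ∧ OperatorSpace.mnorm q y ≤ 1 ∧
        opNorm α ^ 2 ≤ ENNReal.ofReal c ∧ opNorm β ^ 2 ≤ ENNReal.ofReal c := by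
  obtain ⟨p, q, x, y, α, β, hu, hlt⟩ := (projGauge_lt_iff N _).1 h
  by_cases h0 : α = 0 ∨ y = 0 ∨ β = 0
  · refine ⟨0, 0, (0 : ℂ) • 0, (0 : ℂ) • 0, 0, 0, ?_, ?_, ?_, ?_, ?_⟩
    · rw [hu]
      ext i j
      rcases h0 with rfl | rfl | rfl <;> simp [sandwich, kron]
    · rw [hN]; simp
    · rw [OperatorSpace.mnorm_smul]; simp
    · simp [opNorm_zero]
    · simp [opNorm_zero]
  push Not at h0
  obtain ⟨hα, hy, hβ⟩ := h0
  set a := (opNorm α).toReal with ha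
  set b := (opNorm β).toReal with hb
  set Y := (OperatorSpace.mnorm q y).toReal with hY
  have eY : OperatorSpace.mnorm q y = ENNReal.ofReal Y :=
    (ENNReal.ofReal_toReal (OperatorSpace.mnorm_ne_top q y)).symm
  have ea : opNorm α = ENNReal.ofReal a := (ENNReal.ofReal_toReal (opNorm_ne_top α)).symm
  have eb : opNorm β = ENNReal.ofReal b := (ENNReal.ofReal_toReal (opNorm_ne_top β)).symm
  have pa : 0 < a := ENNReal.toReal_pos (fun e => hα (opNorm_eq_zero.1 e)) (opNorm_ne_top α)
  have pb : 0 < b := ENNReal.toReal_pos (fun e => hβ (opNorm_eq_zero.1 e)) (opNorm_ne_top β)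
  have pY : 0 < Y := ENNReal.toReal_pos
    (fun e => hy (OperatorSpace.eq_zero_of_mnorm q y e)) (OperatorSpace.mnorm_ne_top q y)
  have hsc : ∀ r : ℝ, 0 ≤ r → ‖(r : ℂ)‖ₑ = ENNReal.ofReal r := fun r hr => by
    rw [← ofReal_norm, Complex.norm_real, Real.norm_of_nonneg hr]
  have key : ENNReal.ofReal (a * b * Y / c) * N p x ≤ 1 := by
    have h1 : ENNReal.ofReal (a * b * Y) * N p x ≤ ENNReal.ofReal c := by
      refine le_trans (le_of_eq ?_) hlt.le
      rw [ENNReal.ofReal_mul (by positivity), ENNReal.ofReal_mul (by positivity), ea, eb, eY]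
      ring
    rw [div_eq_mul_inv, mul_comm (a * b * Y), ENNReal.ofReal_mul (by positivity), mul_assoc]
    calc ENNReal.ofReal c⁻¹ * (ENNReal.ofReal (a * b * Y) * N p x)
        ≤ ENNReal.ofReal c⁻¹ * ENNReal.ofReal c := by gcongr
      _ = 1 := by
        rw [← ENNReal.ofReal_mul (by positivity), inv_mul_cancel₀ hc.ne', ENNReal.ofReal_one]
  refine ⟨p, q, ((a * b * Y / c : ℝ) : ℂ) • x, ((Y⁻¹ : ℝ) : ℂ) • y,
    ((Real.sqrt c / a : ℝ) : ℂ) • α, ((Real.sqrt c / b : ℝ) : ℂ) • β, ?_, ?_, ?_, ?_, ?_⟩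
  · rw [hu]
    ext1 i j
    simp only [sandwich, kron, Matrix.of_apply, Matrix.smul_apply, TensorProduct.smul_tmul_smul,
      smul_smul, smul_eq_mul]
    refine Finset.sum_congr rfl fun r _ => Finset.sum_congr rfl fun s _ => ?_
    congr 1
    have hs : ((Real.sqrt c : ℝ) : ℂ) * (Real.sqrt c : ℝ) = c := by
      exact_mod_cast Real.mul_self_sqrt hc.le
    have ca : (a : ℂ) ≠ 0 := by exact_mod_cast pa.ne'
    have cb : (b : ℂ) ≠ 0 := by exact_mod_cast pb.ne'
    have cY : (Y : ℂ) ≠ 0 := by exact_mod_cast pY.ne'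
    have cc : (c : ℂ) ≠ 0 := by exact_mod_cast hc.ne'
    push_cast
    calc α i r * β s j = (c / c) * (α i r * β s j) := by rw [div_self cc, one_mul]
      _ = (((Real.sqrt c : ℝ) : ℂ) * (Real.sqrt c : ℝ)) / c * (α i r * β s j) := by rw [hs]
      _ = _ := by field_simp
  · rw [hN, hsc _ (by positivity)]
    exact key
  · rw [OperatorSpace.mnorm_smul, hsc _ (by positivity), eY,
      ← ENNReal.ofReal_mul (by positivity), inv_mul_cancel₀ pY.ne', ENNReal.ofReal_one]
  · rw [opNorm_smul, hsc _ (by positivity), ea, ← ENNReal.ofReal_mul (by positivity),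
      div_mul_cancel₀ _ pa.ne', ← ENNReal.ofReal_pow (by positivity), Real.sq_sqrt hc.le]
  · rw [opNorm_smul, hsc _ (by positivity), eb, ← ENNReal.ofReal_mul (by positivity),
      div_mul_cancel₀ _ pb.ne', ← ENNReal.ofReal_pow (by positivity), Real.sq_sqrt hc.le]

/-- The row `(α, α')`, padded by zeros. -/
def padRow {n p p' q q' : ℕ} (α : Matrix (Fin n) (Fin p × Fin q) ℂ)
    (α' : Matrix (Fin n) (Fin p' × Fin q') ℂ) :
    Matrix (Fin n) (Fin (p + p') × Fin (q + q')) ℂ :=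
  Matrix.of fun i r => match finSumFinEquiv.symm r.1, finSumFinEquiv.symm r.2 with
    | Sum.inl a, Sum.inl b => α i (a, b)
    | Sum.inr a, Sum.inr b => α' i (a, b)
    | _, _ => 0

theorem sum_pad {M : Type*} [AddCommMonoid M] {p p' q q' : ℕ}
    (g : Fin (p + p') × Fin (q + q') → M) :
    ∑ r, g r = (∑ a : Fin p × Fin q, g (Fin.castAdd p' a.1, Fin.castAdd q' a.2)
      + ∑ a : Fin p × Fin q', g (Fin.castAdd p' a.1, Fin.natAdd q a.2))
      + (∑ a : Fin p' × Fin q, g (Fin.natAdd p a.1, Fin.castAdd q' a.2)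
      + ∑ a : Fin p' × Fin q', g (Fin.natAdd p a.1, Fin.natAdd q a.2)) := by
  simp only [Fintype.sum_prod_type, Fin.sum_univ_add, Finset.sum_add_distrib]
  exact add_add_add_comm _ _ _ _

theorem padRow_mul_conjTranspose {n p p' q q' : ℕ} (α : Matrix (Fin n) (Fin p × Fin q) ℂ)
    (α' : Matrix (Fin n) (Fin p' × Fin q') ℂ) :
    padRow α α' * (padRow α α')ᴴ = α * αᴴ + α' * α'ᴴ := by
  ext i j
  simp [Matrix.mul_apply, sum_pad, padRow]

theorem sandwich_pad {n p p' q q' : ℕ} (α : Matrix (Fin n) (Fin p × Fin q) ℂ)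
    (α' : Matrix (Fin n) (Fin p' × Fin q') ℂ) (β : Matrix (Fin p × Fin q) (Fin n) ℂ)
    (β' : Matrix (Fin p' × Fin q') (Fin n) ℂ)
    (x : Matrix (Fin p) (Fin p) E) (y : Matrix (Fin q) (Fin q) F)
    (x' : Matrix (Fin p') (Fin p') E) (y' : Matrix (Fin q') (Fin q') F) :
    sandwich (padRow α α') (kron (directSum x x') (directSum y y')) (padRow βᴴ β'ᴴ)ᴴ =
      sandwich α (kron x y) β + sandwich α' (kron x' y') β' := by
  ext1 i j
  simp [sandwich, sum_pad, padRow, kron, directSum]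

theorem projGauge_add_le [OperatorSpace F] (N : MatGauge E)
    (hN : ∀ k (c : ℂ) x, N k (c • x) = ‖c‖ₑ * N k x)
    (hN' : ∀ p q x y, N (p + q) (directSum x y) = max (N p x) (N q y)) (n : ℕ)
    (u v : Matrix (Fin n) (Fin n) (E ⊗[ℂ] F)) :
    projGauge N OperatorSpace.mnorm n (u + v) ≤
      projGauge N OperatorSpace.mnorm n u + projGauge N OperatorSpace.mnorm n v := by
  refine ENNReal.le_of_forall_pos_le_add fun ε hε hlt => ?_
  obtain ⟨hu, hv⟩ := ENNReal.add_lt_top.1 hlt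
  set s := projGauge N OperatorSpace.mnorm n u
  set t := projGauge N OperatorSpace.mnorm n v
  have hε2 : (0 : ℝ) < ε / 2 := by positivity
  have aux : ∀ {r : ℝ≥0∞}, r < ∞ → r < ENNReal.ofReal (r.toReal + ε / 2) := by
    intro r hr
    rw [ENNReal.lt_ofReal_iff_toReal_lt hr.ne]
    linarith
  obtain ⟨p, q, x, y, α, β, hu', hx, hy, hα, hβ⟩ :=
    projGauge_normalize N hN (by positivity) (aux hu)
  obtain ⟨p', q', x', y', α', β', hv', hx', hy', hα', hβ'⟩ :=
    projGauge_normalize N hN (by positivity) (aux hv)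
  set c := s.toReal + ε / 2
  set d := t.toReal + ε / 2
  have hc : 0 ≤ c := by positivity
  have hd : 0 ≤ d := by positivity
  have row : ∀ (γ : Matrix (Fin n) (Fin p × Fin q) ℂ) (γ' : Matrix (Fin n) (Fin p' × Fin q') ℂ),
      opNorm γ ^ 2 ≤ ENNReal.ofReal c → opNorm γ' ^ 2 ≤ ENNReal.ofReal d →
      opNorm (padRow γ γ') ≤ ENNReal.ofReal (Real.sqrt (c + d)) := by
    intro γ γ' h1 h2
    have h3 := (opNorm_sq_add_le γ γ' (padRow γ γ') (padRow_mul_conjTranspose γ γ')).trans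
      (add_le_add h1 h2)
    rw [← ENNReal.ofReal_add hc hd, ← Real.sq_sqrt (add_nonneg hc hd),
      ENNReal.ofReal_pow (Real.sqrt_nonneg _)] at h3
    exact (ENNReal.pow_le_pow_left_iff two_ne_zero).1 h3
  have h1 := row α α' hα hα'
  have h2 := row βᴴ β'ᴴ ((congrArg (· ^ 2) (opNorm_conjTranspose β)).trans_le hβ)
    ((congrArg (· ^ 2) (opNorm_conjTranspose β')).trans_le hβ')
  refine (projGauge_le N OperatorSpace.mnorm (directSum x x') (directSum y y') (padRow α α')
    (padRow βᴴ β'ᴴ)ᴴ (by rw [sandwich_pad, ← hu', ← hv'])).trans ?_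
  rw [hN', OperatorSpace.mnorm_directSum, opNorm_conjTranspose]
  refine (mul_le_mul' (mul_le_mul' (mul_le_mul' h1 (max_le hx hx')) (max_le hy hy')) h2).trans ?_
  calc ENNReal.ofReal (Real.sqrt (c + d)) * 1 * 1 * ENNReal.ofReal (Real.sqrt (c + d))
      = ENNReal.ofReal (c + d) := by
        rw [mul_one, mul_one, ← ENNReal.ofReal_mul (Real.sqrt_nonneg _),
          Real.mul_self_sqrt (add_nonneg hc hd)]
    _ ≤ s + t + ε := by
        refine le_of_eq ?_
        have : c + d = s.toReal + t.toReal + ε := by simp only [c, d]; ring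
        rw [this, ENNReal.ofReal_add (by positivity) (by positivity),
          ENNReal.ofReal_add (by positivity) (by positivity), ENNReal.ofReal_toReal hu.ne,
          ENNReal.ofReal_toReal hv.ne]
        simp

theorem schattenOne_add_le [OperatorSpace E] (n k : ℕ)
    (u v : Matrix (Fin k) (Fin k) (Matrix (Fin n) (Fin n) E)) :
    schattenOneGauge n OperatorSpace.mnorm k (u + v) ≤
      schattenOneGauge n OperatorSpace.mnorm k u + schattenOneGauge n OperatorSpace.mnorm k v := by
  have : (u + v).map (matTensor n) = u.map (matTensor n) + v.map (matTensor n) := by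
    ext1 i j
    simp
  unfold schattenOneGauge
  rw [this]
  exact projGauge_add_le _ traceClassGauge_smul traceClassGauge_directSum k _ _

theorem schattenOne_smul_le [OperatorSpace E] (n k : ℕ) (c : ℂ)
    (u : Matrix (Fin k) (Fin k) (Matrix (Fin n) (Fin n) E)) :
    schattenOneGauge n OperatorSpace.mnorm k (c • u) ≤
      ‖c‖ₑ * schattenOneGauge n OperatorSpace.mnorm k u := by
  have : (c • u).map (matTensor n) = c • u.map (matTensor n) := by
    ext1 i j
    simp
  unfold schattenOneGauge
  rw [this]
  exact projGauge_smul_le _ _ k c _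

theorem schattenOne_zero [OperatorSpace E] (n k : ℕ) :
    schattenOneGauge n (OperatorSpace.mnorm (E := E)) k 0 = 0 := by
  have h := schattenOne_smul_le (E := E) n k 0 0
  simpa using h

end Proj

/-! ### The spaces `L^1_E(Ĝ)` and `C_0(Ĝ, E)` -/

section Spaces

variable (G : Type*) [Group G] [TopologicalSpace G]
  (E : Type*) [AddCommGroup E] [Module ℂ E] [OperatorSpace E]

/-- The dual operator space `E* = cb(E, ℂ)` of an operator space. -/
abbrev Dual := cbDual (OperatorSpace.mnorm (E := E))

/-- The norm `∑ d_π ‖A^π‖_{S^1(E)}`. -/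
def normL1 (A : MatFamily G E) : ℝ≥0∞ :=
  ∑' π, (π.deg : ℝ≥0∞) * norm₁ (schattenOneGauge π.deg OperatorSpace.mnorm) (A π)

/-- The space `L^1_E(Ĝ)`. -/
def L1 : Submodule ℂ (MatFamily G E) where
  carrier := {A | normL1 G E A < ∞}
  add_mem' {A B} hA hB := by
    refine lt_of_le_of_lt ?_ (ENNReal.add_lt_top.2 ⟨hA, hB⟩)
    unfold normL1
    rw [← ENNReal.tsum_add]
    refine ENNReal.tsum_le_tsum fun π => ?_
    rw [← mul_add]
    gcongr
    exact schattenOne_add_le π.deg 1 _ _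
  zero_mem' := by
    have : normL1 G E 0 = 0 := by
      refine ENNReal.tsum_eq_zero.2 fun π => ?_
      have h : norm₁ (schattenOneGauge π.deg (OperatorSpace.mnorm (E := E))) 0 = 0 :=
        schattenOne_zero π.deg 1
      rw [Pi.zero_apply, h, mul_zero]
    exact this.trans_lt ENNReal.zero_lt_top
  smul_mem' c A hA := by
    refine lt_of_le_of_lt ?_ (ENNReal.mul_lt_top (enorm_lt_top (x := c)) hA)
    unfold normL1
    rw [← ENNReal.tsum_mul_left]
    refine ENNReal.tsum_le_tsum fun π => ?_
    rw [mul_left_comm]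
    gcongr
    exact schattenOne_smul_le π.deg 1 c _

/-- The matrix norms of `L^1_E(Ĝ)`, the `ℓ^1`-sum of the `S^1_{d_π}(E)` with weights `d_π`. -/
def gaugeL1 : MatGauge (L1 G E) := fun k x =>
  ellOneGauge DualObject.deg (fun π : DualObject G => schattenOneGauge π.deg OperatorSpace.mnorm) k
    (x.map fun A => (A : MatFamily G E))

/-- The norm `sup_π ‖A^π‖_{S^∞(E)}`. -/
def normLInfty (A : MatFamily G E) : ℝ≥0∞ := ⨆ π, OperatorSpace.mnorm _ (A π)

theorem mnorm_zero (n : ℕ) : OperatorSpace.mnorm n (0 : Matrix (Fin n) (Fin n) E) = 0 := by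
  have h := OperatorSpace.mnorm_smul n (0 : ℂ) (0 : Matrix (Fin n) (Fin n) E)
  simpa using h

/-- The space `C_0(Ĝ, E)`. -/
def C0 : Submodule ℂ (MatFamily G E) where
  carrier := {A | normLInfty G E A < ∞ ∧
    ∀ ε : ℝ≥0∞, 0 < ε → {π | ¬ OperatorSpace.mnorm _ (A π) < ε}.Finite}
  add_mem' {A B} hA hB := by
    refine ⟨lt_of_le_of_lt ?_ (ENNReal.add_lt_top.2 ⟨hA.1, hB.1⟩), fun ε hε => ?_⟩
    · refine iSup_le fun π => (OperatorSpace.mnorm_add_le _ _ _).trans (add_le_add ?_ ?_)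
      · exact le_iSup (fun π => OperatorSpace.mnorm _ (A π)) π
      · exact le_iSup (fun π => OperatorSpace.mnorm _ (B π)) π
    · have h2 : 0 < ε / 2 := ENNReal.half_pos hε.ne'
      refine ((hA.2 _ h2).union (hB.2 _ h2)).subset fun π hπ => ?_
      by_contra hc
      simp only [Set.mem_union, Set.mem_ofPred_eq, not_or, not_not] at hc
      refine hπ ((OperatorSpace.mnorm_add_le _ _ _).trans_lt ?_)
      calc _ < ε / 2 + ε / 2 := ENNReal.add_lt_add hc.1 hc.2
        _ = ε := ENNReal.add_halves ε
  zero_mem' := by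
    refine ⟨?_, fun ε hε => ?_⟩
    · simp [normLInfty, mnorm_zero]
    · simp [mnorm_zero, hε]
  smul_mem' c A hA := by
    rcases eq_or_ne c 0 with rfl | hc
    · refine ⟨?_, fun ε hε => ?_⟩
      · simp [normLInfty, mnorm_zero]
      · simp [mnorm_zero, hε]
    have hc' : ‖c‖ₑ ≠ 0 := by simpa using hc
    refine ⟨?_, fun ε hε => ?_⟩
    · have : normLInfty G E (c • A) = ‖c‖ₑ * normLInfty G E A := by
        simp [normLInfty, OperatorSpace.mnorm_smul, ENNReal.mul_iSup]
      rw [this]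
      exact ENNReal.mul_lt_top enorm_lt_top hA.1
    · refine (hA.2 (ε / ‖c‖ₑ) (ENNReal.div_pos hε.ne' enorm_ne_top)).subset fun π hπ => ?_
      simp only [Set.mem_ofPred_eq, Pi.smul_apply, OperatorSpace.mnorm_smul] at hπ ⊢
      rwa [ENNReal.lt_div_iff_mul_lt (Or.inl hc') (Or.inl enorm_ne_top), mul_comm]

/-- The matrix norms of `C_0(Ĝ, E)`, a subspace of the `ℓ^∞`-sum of the `S^∞_{d_π}(E)`. -/
def gaugeC0 : MatGauge (C0 G E) := fun k x =>
  ellInftyGauge (fun π : DualObject G => matGauge π.deg OperatorSpace.mnorm) k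
    (x.map fun A => (A : MatFamily G E))

end Spaces

end OpSpace

end

noncomputable section

namespace OpSpace

open scoped Kronecker ComplexOrder


/-! ### Sandwiches and bilinear tests for the operator norm -/

section Tests

set_option linter.unusedSectionVars false

variable {m n p q l r : Type*} [Fintype m] [Fintype n] [Fintype p] [Fintype q]
  [Fintype l] [Fintype r]

/-! The duality between a C_0-sum and an ℓ^1-sum is elementary once two facts about a single block
are known. First, under the trace pairing S_n^1(E*) is completely isometrically the dual of S_n^∞(E)
= M_n(E) (`schattenOneGauge_eq`). Second, every complete contraction S_n^1(E*) → M_m can be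
approximated, on finitely many points, by the trace pairing with an element of the unit ball of
M_m(M_n(E)) (`exists_trPair_approx`, a matricial Goldstine theorem).

Both rest on a factorization theorem (`exists_factorization`). For every C > 1, a complete
contraction φ : M_n(X) → M_k has the form φ(x) = α (id ⊗ f)(x) β, with f : X → M_{kn} a complete
contraction and α, β scalar matrices of norm at most C. It comes from Hahn–Banach. Testing φ on
vectors bounds Re ψ(U* v W) by (tr T + tr S)/2 whenever U*U ≤ T ⊗ 1, W*W ≤ S ⊗ 1 and v is in the
unit ball, where ψ is the functional on M_{kn}(X) made of the entries of φ. A separating linear form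
replaces the two traces by positive forms ρ(U*U) and σ(W*W). The densities of ρ and σ, made
invertible, have factors A and B: the entries of A and B give α and β, and their inverses turn ψ
into f.

For the first fact, the factorization of an element of M_k((M_n(E))*) is literally an admissible
factorization in the projective tensor product, because the matrix of matrix units (e_ji) represents
the identity of M_n and so has norm at most 1 in M_n(S_n^1). The opposite estimate is a direct
computation. For the second, apply the factorization with k = 1 to functionals on M_m(M_n(E)): a
functional in the unit ball is α F β with F nearly optimal in M_m(S_n^1(E*)). A complete contraction
u sends F to a contraction, so its pairing with the functional is at most 1, and finite-dimensional
separation concludes.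

For the sums, an element of the unit ball of M_r(C_0) is a family of complete contractions S^1 →
M_r, which gives one inequality of matrix norms. The other is obtained by truncating the ℓ^1-series
to finitely many classes and approximating each u_π by an element of the unit ball. Surjectivity
holds because finitely supported families are dense in C_0. -/

theorem sandwich_sandwich {E : Type*} [AddCommGroup E] [Module ℂ E] (α : Matrix m n ℂ)
    (β : Matrix n p ℂ) (x : Matrix p q E) (γ : Matrix q l ℂ) (δ : Matrix l r ℂ) :
    sandwich α (sandwich β x γ) δ = sandwich (α * β) x (γ * δ) := by
  ext1 i j
  simp only [sandwich, Matrix.of_apply, Matrix.mul_apply, Finset.smul_sum, smul_smul,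
    Finset.sum_mul_sum, Finset.sum_smul]
  rw [Finset.sum_congr rfl fun _ _ => Finset.sum_comm, Finset.sum_comm]
  refine Finset.sum_congr rfl fun u _ => ?_
  rw [Finset.sum_congr rfl fun _ _ => Finset.sum_congr rfl fun _ _ => rfl,
    Finset.sum_congr rfl fun _ _ => Finset.sum_comm, Finset.sum_comm]
  refine Finset.sum_congr rfl fun v _ => Finset.sum_congr rfl fun a _ =>
    Finset.sum_congr rfl fun b _ => ?_
  congr 1
  ring

theorem sandwich_one {E : Type*} [AddCommGroup E] [Module ℂ E] [DecidableEq m] [DecidableEq n]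
    (x : Matrix m n E) : sandwich 1 x 1 = x := by
  ext1 i j
  simp [sandwich, Matrix.one_apply]

theorem reindex_sandwich {E : Type*} [AddCommGroup E] [Module ℂ E] (e : m ≃ l) (f : r ≃ q)
    (α : Matrix m n ℂ) (x : Matrix n p E) (β : Matrix p r ℂ) :
    Matrix.reindex e f (sandwich α x β) =
      sandwich (Matrix.reindex e (Equiv.refl _) α) x (Matrix.reindex (Equiv.refl _) f β) := rfl

theorem sum_norm_mul_le {ι : Type*} [Fintype ι] (ξ η : ι → ℂ) :
    (star ξ ⬝ᵥ η).re ≤ (∑ i, ‖ξ i‖ ^ 2 + ∑ i, ‖η i‖ ^ 2) / 2 := by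
  rw [dotProduct, Complex.re_sum, ← Finset.sum_add_distrib, Finset.sum_div]
  refine Finset.sum_le_sum fun i _ => ?_
  have h := Complex.re_le_norm ((star ξ) i * η i)
  rw [norm_mul, Pi.star_apply, norm_star] at h
  rw [Pi.star_apply]
  nlinarith [sq_nonneg (‖ξ i‖ - ‖η i‖)]

theorem star_dotProduct_self_re {ι : Type*} [Fintype ι] (ξ : ι → ℂ) :
    (star ξ ⬝ᵥ ξ).re = ∑ i, ‖ξ i‖ ^ 2 := by
  rw [dotProduct, Complex.re_sum]
  refine Finset.sum_congr rfl fun i _ => ?_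
  rw [Pi.star_apply, Complex.star_def, Complex.conj_mul', ← Complex.ofReal_pow, Complex.ofReal_re]

variable [DecidableEq m] [DecidableEq n]

/-- The arithmetic mean in place of ‖ξ‖‖η‖ keeps the bound additive in squared norms, as the
Hahn–Banach argument needs. For the converse, test with ξ = Aη. -/
theorem opNorm_le_one_iff (A : Matrix m n ℂ) :
    opNorm A ≤ 1 ↔ ∀ ξ η, (star ξ ⬝ᵥ A *ᵥ η).re ≤ (∑ i, ‖ξ i‖ ^ 2 + ∑ i, ‖η i‖ ^ 2) / 2 := by
  rw [opNorm_le_iff' _ _ ENNReal.one_ne_top]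
  simp only [ENNReal.toReal_one, one_pow, one_mul]
  constructor
  · intro h ξ η
    have := sum_norm_mul_le ξ (A *ᵥ η)
    linarith [h η]
  · intro h η
    have := h (A *ᵥ η) η
    rw [star_dotProduct_self_re] at this
    linarith

theorem opNorm_le_sqrt_of_mul_conjTranspose (A : Matrix m n ℂ) {C : ℝ} (hC : 0 ≤ C)
    (h : ∀ ξ : m → ℂ, (star ξ ⬝ᵥ (A * Aᴴ) *ᵥ ξ).re ≤ C * ∑ i, ‖ξ i‖ ^ 2) :
    opNorm A ≤ ENNReal.ofReal (Real.sqrt C) := by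
  rw [← opNorm_conjTranspose, opNorm_le_iff _ _ (Real.sqrt_nonneg _), Real.sq_sqrt hC]
  intro ξ
  refine le_trans (le_of_eq ?_) (h ξ)
  rw [← star_dotProduct_self_re, Matrix.star_mulVec, ← Matrix.dotProduct_mulVec,
    Matrix.conjTranspose_conjTranspose, Matrix.mulVec_mulVec]

theorem opNorm_kronecker_one_le {k : Type*} [Fintype k] [DecidableEq k] (A : Matrix m n ℂ) :
    opNorm (A ⊗ₖ (1 : Matrix k k ℂ)) ≤ opNorm A := by
  have e : A ⊗ₖ (1 : Matrix k k ℂ) =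
      Matrix.reindex (Equiv.prodComm k m) (Equiv.prodComm k n) (ampl k A) := by
    ext ⟨i, a⟩ ⟨j, b⟩
    simp [ampl, Matrix.one_apply]
  rw [e, opNorm_reindex]
  exact opNorm_ampl_le A

end Tests

/-! ### Gauges satisfying Ruan's axioms -/

/-- The part of Ruan's axioms on the behaviour of matrix norms under direct sums and scalar
matrices. -/
structure RuanGauge {X : Type*} [AddCommGroup X] [Module ℂ X] (N : MatGauge X) : Prop where
  directSum_le : ∀ m n x y, N (m + n) (directSum x y) ≤ max (N m x) (N n y)
  sandwich_le : ∀ m n (α : Matrix (Fin m) (Fin n) ℂ) x (β : Matrix (Fin n) (Fin m) ℂ),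
    N m (sandwich α x β) ≤ opNorm α * N n x * opNorm β

theorem ruanGauge_mnorm {E : Type*} [AddCommGroup E] [Module ℂ E] [OperatorSpace E] :
    RuanGauge (OperatorSpace.mnorm (E := E)) :=
  ⟨fun m n x y => (OperatorSpace.mnorm_directSum m n x y).le, OperatorSpace.mnorm_sandwich_le⟩

namespace RuanGauge

set_option linter.unusedSectionVars false

variable {X : Type*} [AddCommGroup X] [Module ℂ X] {N : MatGauge X}

theorem zero (hN : RuanGauge N) (k : ℕ) : N k 0 = 0 := by
  have h := hN.sandwich_le k k 0 0 0
  have e : sandwich (0 : Matrix (Fin k) (Fin k) ℂ) (0 : Matrix (Fin k) (Fin k) X)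
      (0 : Matrix (Fin k) (Fin k) ℂ) = 0 := by
    ext1 i j
    simp [sandwich]
  rw [e, opNorm_zero] at h
  simpa using h

theorem sandwich_le_one (hN : RuanGauge N) {m n : ℕ} {α : Matrix (Fin m) (Fin n) ℂ}
    {x : Matrix (Fin n) (Fin n) X} {β : Matrix (Fin n) (Fin m) ℂ} (hα : opNorm α ≤ 1)
    (hx : N n x ≤ 1) (hβ : opNorm β ≤ 1) : N m (sandwich α x β) ≤ 1 := by
  refine (hN.sandwich_le m n α x β).trans ?_
  calc _ ≤ (1 : ℝ≥0∞) * 1 * 1 := by gcongr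
    _ = 1 := by simp

theorem submatrix_le (hN : RuanGauge N) {m n : ℕ} (x : Matrix (Fin n) (Fin n) X)
    {e f : Fin m → Fin n} (he : Function.Injective e) (hf : Function.Injective f) :
    N m (x.submatrix e f) ≤ N n x := by
  have h := hN.sandwich_le m n ((1 : Matrix (Fin n) (Fin n) ℂ).submatrix e id) x
    ((1 : Matrix (Fin n) (Fin n) ℂ).submatrix id f)
  have e1 : sandwich ((1 : Matrix (Fin n) (Fin n) ℂ).submatrix e id) x
      ((1 : Matrix (Fin n) (Fin n) ℂ).submatrix id f) = x.submatrix e f := by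
    ext1 i j
    simp [sandwich, Matrix.one_apply]
  rw [e1] at h
  refine h.trans ?_
  have h1 := (opNorm_submatrix_le (1 : Matrix (Fin n) (Fin n) ℂ) he
    Function.injective_id).trans opNorm_one_le
  have h2 := (opNorm_submatrix_le (1 : Matrix (Fin n) (Fin n) ℂ)
    Function.injective_id hf).trans opNorm_one_le
  calc _ ≤ 1 * N n x * 1 := by gcongr
    _ = N n x := by simp

theorem reindex_eq (hN : RuanGauge N) {m n : ℕ} (x : Matrix (Fin n) (Fin n) X)
    (e f : Fin n ≃ Fin m) : N m (Matrix.reindex e f x) = N n x := by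
  refine le_antisymm (hN.submatrix_le x e.symm.injective f.symm.injective) ?_
  have := hN.submatrix_le (Matrix.reindex e f x) e.injective f.injective
  simpa using this

/-- The unit ball of `M_k(X)` is convex. -/
theorem convex_le_one (hN : RuanGauge N) {k : ℕ} {x y : Matrix (Fin k) (Fin k) X}
    (hx : N k x ≤ 1) (hy : N k y ≤ 1) {a b : ℝ} (ha : 0 ≤ a) (hb : 0 ≤ b) (hab : a + b = 1) :
    N k ((a : ℂ) • x + (b : ℂ) • y) ≤ 1 := by
  -- The row α = (√a · 1, √b · 1) satisfies α αᴴ = 1, and compressing x ⊕ y by it gives ax + by.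
  set α : Matrix (Fin k) (Fin (k + k)) ℂ := Matrix.of fun i r => Sum.elim
    (fun j => if i = j then ((Real.sqrt a : ℝ) : ℂ) else 0)
    (fun j => if i = j then ((Real.sqrt b : ℝ) : ℂ) else 0) (finSumFinEquiv.symm r) with hα
  have ha' : ((Real.sqrt a : ℝ) : ℂ) * (Real.sqrt a : ℝ) = a := by
    exact_mod_cast Real.mul_self_sqrt ha
  have hb' : ((Real.sqrt b : ℝ) : ℂ) * (Real.sqrt b : ℝ) = b := by
    exact_mod_cast Real.mul_self_sqrt hb
  have e : (a : ℂ) • x + (b : ℂ) • y = sandwich α (directSum x y) αᴴ := by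
    ext1 i j
    simp only [sandwich, hα, directSum, ← finSumFinEquiv.sum_comp, Fintype.sum_sum_type,
      Matrix.of_apply, Matrix.conjTranspose_apply, Matrix.reindex_apply, Matrix.submatrix_apply,
      Equiv.symm_apply_apply]
    simp [ha', hb', apply_ite (starRingEnd ℂ)]
  have h1 : opNorm α ≤ 1 := by
    have h : α * αᴴ = 1 := by
      ext i j
      have hab' : (a : ℂ) + b = 1 := by exact_mod_cast hab
      simp only [Matrix.mul_apply, hα, ← finSumFinEquiv.sum_comp, Fintype.sum_sum_type,
        Matrix.of_apply, Matrix.conjTranspose_apply, Equiv.symm_apply_apply, Matrix.one_apply]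
      by_cases h : i = j
      · subst h
        simp [ha', hb', apply_ite (starRingEnd ℂ), hab']
      · simp [h, apply_ite (starRingEnd ℂ)]
    have h2 := opNorm_sq α
    rw [h] at h2
    have h3 : opNorm α ^ 2 ≤ 1 ^ 2 := by rw [h2, one_pow]; exact opNorm_one_le
    exact (ENNReal.pow_le_pow_left_iff two_ne_zero).1 h3
  rw [e]
  exact hN.sandwich_le_one h1 ((hN.directSum_le _ _ _ _).trans (max_le hx hy))
    ((opNorm_conjTranspose α).trans_le h1)

theorem flatten_directSum {m n d : ℕ} (x : Matrix (Fin m) (Fin m) (Matrix (Fin d) (Fin d) X))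
    (y : Matrix (Fin n) (Fin n) (Matrix (Fin d) (Fin d) X)) :
    flatten (directSum x y) =
      Matrix.reindex (finCongr (add_mul m n d).symm) (finCongr (add_mul m n d).symm)
        (directSum (flatten x) (flatten y)) := by
  have key : ∀ (i : Fin m ⊕ Fin n) (c : Fin d),
      (finCongr (add_mul m n d).symm).symm (finProdFinEquiv (finSumFinEquiv i, c)) =
        finSumFinEquiv (i.map (fun a => finProdFinEquiv (a, c)) fun a => finProdFinEquiv (a, c)) := by
    rintro (i | i) c
    · ext; simp
    · ext; simp; ring
  ext1 i j
  obtain ⟨⟨i, c⟩, rfl⟩ := finProdFinEquiv.surjective i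
  obtain ⟨⟨j, c'⟩, rfl⟩ := finProdFinEquiv.surjective j
  obtain ⟨i, rfl⟩ := finSumFinEquiv.surjective i
  obtain ⟨j, rfl⟩ := finSumFinEquiv.surjective j
  rw [Matrix.reindex_apply _ _ (directSum _ _), Matrix.submatrix_apply, key, key]
  rcases i with i | i <;> rcases j with j | j <;>
    simp [directSum, flatten, -finSumFinEquiv_apply_left, -finSumFinEquiv_apply_right]

/-- A scalar matrix α acts on M_k(M_d(X)) as α ⊗ 1 on M_{kd}(X), which has no larger norm. The
axioms pass to M_d(X), so the factorization theorem can also be applied with M_d(X) as coefficient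
space. -/
theorem matGauge (hN : RuanGauge N) (d : ℕ) : RuanGauge (matGauge d N) where
  directSum_le m n x y := by
    unfold OpSpace.matGauge
    rw [flatten_directSum, hN.reindex_eq]
    exact hN.directSum_le _ _ _ _
  sandwich_le m n α x β := by
    have e : flatten (sandwich α x β) =
        sandwich (Matrix.reindex finProdFinEquiv finProdFinEquiv
            (α ⊗ₖ (1 : Matrix (Fin d) (Fin d) ℂ))) (flatten x)
          (Matrix.reindex finProdFinEquiv finProdFinEquiv
            (β ⊗ₖ (1 : Matrix (Fin d) (Fin d) ℂ))) := by
      ext1 i j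
      obtain ⟨i, rfl⟩ := finProdFinEquiv.surjective i
      obtain ⟨j, rfl⟩ := finProdFinEquiv.surjective j
      simp only [flatten, sandwich, Matrix.reindex_apply, Matrix.submatrix_apply, Matrix.of_apply,
        Matrix.comp_apply, ← finProdFinEquiv.sum_comp, Equiv.symm_apply_apply,
        Fintype.sum_prod_type, Matrix.kroneckerMap_apply, Matrix.one_apply, Matrix.sum_apply,
        Matrix.smul_apply]
      simp [ite_mul, mul_ite, ite_smul, Finset.sum_ite_irrel]
    unfold OpSpace.matGauge
    rw [e]
    refine (hN.sandwich_le _ _ _ _ _).trans ?_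
    rw [opNorm_reindex, opNorm_reindex]
    gcongr <;> exact opNorm_kronecker_one_le _

end RuanGauge


/-- A form of the Hahn–Banach theorem: a convex cone over a real vector space whose fibre over `0`
is nonnegative lies above the graph of a linear form. -/
theorem exists_linear_le_of_cone {V : Type*} [AddCommGroup V] [Module ℝ V] (C : V → ℝ → Prop)
    (hadd : ∀ v w s t, C v s → C w t → C (v + w) (s + t))
    (hsmul : ∀ (c : ℝ) v t, 0 < c → C v t → C (c • v) (c * t))
    (hex : ∀ v, ∃ t, C v t) (h0 : ∀ t, C 0 t → 0 ≤ t) :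
    ∃ g : V →ₗ[ℝ] ℝ, ∀ v t, C v t → g v ≤ t := by
  have hbdd : ∀ v, BddBelow {t | C v t} := by
    intro v
    obtain ⟨s, hs⟩ := hex (-v)
    refine ⟨-s, fun t ht => ?_⟩
    have h := h0 (t + s) (by simpa using hadd _ _ _ _ ht hs)
    linarith
  -- The lower envelope of the cone is sublinear. It is finite because adding a point of the fibre
  -- over `-v` to the fibre over `v` lands in the fibre over 0. The required form extends the zero
  -- form on `⊥` below `q`.
  set q : V → ℝ := fun v => sInf {t | C v t} with hq
  have hle : ∀ v t, C v t → q v ≤ t := fun v t ht => csInf_le (hbdd v) ht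
  have hge : ∀ v s, (∀ t, C v t → s ≤ t) → s ≤ q v := fun v s h => le_csInf (hex v) h
  have hhom : ∀ c : ℝ, 0 < c → ∀ v, c * q v ≤ q (c • v) := by
    intro c hc v
    refine hge _ _ fun t ht => ?_
    have h1 := hle v (c⁻¹ * t) (by simpa [hc.ne'] using hsmul c⁻¹ _ _ (inv_pos.2 hc) ht)
    rwa [← le_div_iff₀' hc, div_eq_inv_mul]
  obtain ⟨g, -, hg⟩ := exists_extension_of_le_sublinear (⊥ : V →ₗ.[ℝ] ℝ) q
    (fun c hc v => by
      refine le_antisymm ?_ (hhom c hc v)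
      have h := hhom c⁻¹ (inv_pos.2 hc) (c • v)
      rw [inv_smul_smul₀ hc.ne'] at h
      rwa [← div_le_iff₀' hc, div_eq_inv_mul])
    (fun v w => by
      rw [← sub_le_iff_le_add]
      refine hge _ _ fun t ht => ?_
      rw [sub_le_comm]
      refine hge _ _ fun s hs => ?_
      have := hle _ _ (hadd _ _ _ _ ht hs)
      linarith)
    (fun x => by
      have hx : x = 0 := Subtype.ext ((Submodule.mem_bot ℝ).1 x.2)
      rw [hx]
      simpa using hge 0 0 h0)
  exact ⟨g, fun v t ht => (hg v).trans (hle v t ht)⟩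

/-- The functional `Z ↦ ∑ ψ_pq(Z_pq)` on matrices defined by a matrix of functionals. -/
def matPair {X : Type*} [AddCommGroup X] [Module ℂ X] {p q : Type*} [Fintype p] [Fintype q]
    (ψ : Matrix p q (X →ₗ[ℂ] ℂ)) : Matrix p q X →ₗ[ℂ] ℂ where
  toFun Z := ∑ i, ∑ j, ψ i j (Z i j)
  map_add' _ _ := by simp [Finset.sum_add_distrib]
  map_smul' _ _ := by simp [Finset.mul_sum]

/-! ### Domination of a completely contractive map on M_n(X) by positive forms -/

section Factorization

variable {X : Type*} [AddCommGroup X] [Module ℂ X] {N : MatGauge X} {k n : ℕ}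

/-- Scalar matrices acting on the ℂ^k index alone become vectors of ℂ^k ⊗ ℂ^k between which the
amplified φ is tested. Their Euclidean norms are the Hilbert–Schmidt norms of `t` and `s`; this is
where traces enter. -/
theorem matPair_sandwich_kronecker {φ : Matrix (Fin k) (Fin k) (Matrix (Fin n) (Fin n) X →ₗ[ℂ] ℂ)}
    {ψ : Matrix (Fin k × Fin n) (Fin k × Fin n) (X →ₗ[ℂ] ℂ)}
    (hψ : ∀ a b x, φ a b x = ∑ i, ∑ j, ψ (a, i) (b, j) (x i j))
    (z : Matrix (Fin k) (Fin k) (Matrix (Fin n) (Fin n) X)) (t s : Matrix (Fin k) (Fin k) ℂ) :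
    matPair ψ (sandwich (t ⊗ₖ (1 : Matrix (Fin n) (Fin n) ℂ))ᴴ (Matrix.comp _ _ _ _ _ z)
      (s ⊗ₖ (1 : Matrix (Fin n) (Fin n) ℂ))) =
      (star fun c : Fin k × Fin k => t c.1 c.2) ⬝ᵥ (blk φ z *ᵥ fun d => s d.1 d.2) := by
  simp only [matPair, LinearMap.coe_mk, AddHom.coe_mk, sandwich, Matrix.of_apply, dotProduct,
    Matrix.mulVec, blk, hψ, Fintype.sum_prod_type, Matrix.conjTranspose_apply,
    Matrix.kroneckerMap_apply, Matrix.one_apply, Matrix.comp_apply, map_sum, map_smul,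
    Pi.star_apply, smul_eq_mul, Finset.mul_sum, Finset.sum_mul]
  simp only [mul_ite, mul_one, mul_zero, apply_ite (star : ℂ → ℂ), star_zero, ite_mul, zero_mul,
    Finset.sum_ite_irrel, Finset.sum_const_zero, Finset.sum_ite_eq',
    Finset.mem_univ, if_true]
  -- Both sides are sums of the same terms over six indices in different orders; the equivalence
  -- permutes the indices.
  have e := Fintype.sum_equiv
    (⟨fun x => (x.2.2.2.2.1, x.1, x.2.2.2.2.2, x.2.2.1, x.2.1, x.2.2.2.1),
      fun y => (y.2.1, y.2.2.2.2.1, y.2.2.2.1, y.2.2.2.2.2, y.1, y.2.2.1), fun _ => rfl,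
      fun _ => rfl⟩ : Fin k × Fin n × Fin k × Fin n × Fin k × Fin k ≃
        Fin k × Fin k × Fin k × Fin k × Fin n × Fin n)
    (fun (a, i, b, j, c, d) => star (t c a) * s d b * ψ (a, i) (b, j) (z c d i j))
    (fun (c, a, d, b, i, j) => star (t c a) * (ψ (a, i) (b, j) (z c d i j) * s d b))
    fun _ => by simp only [Equiv.coe_fn_mk]; ring
  simpa only [Fintype.sum_prod_type] using e

/-- Write T = tᴴt and S = sᴴs. The constraints say that U and W are contractions times t ⊗ 1 and s ⊗
1. The contractions are absorbed into v, giving z in the unit ball of M_k(M_n(X)), and the left side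
is ⟨t, φ(z) s⟩, at most half the sum of the squared Hilbert–Schmidt norms. -/
theorem re_matPair_le_of_posDef (hN : RuanGauge N)
    {φ : Matrix (Fin k) (Fin k) (Matrix (Fin n) (Fin n) X →ₗ[ℂ] ℂ)}
    (hφ : functionalGauge (matGauge n N) k φ ≤ 1)
    {ψ : Matrix (Fin k × Fin n) (Fin k × Fin n) (X →ₗ[ℂ] ℂ)}
    (hψ : ∀ a b x, φ a b x = ∑ i, ∑ j, ψ (a, i) (b, j) (x i j))
    {T S : Matrix (Fin k) (Fin k) ℂ} (hT : T.PosDef) (hS : S.PosDef) {r : ℕ}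
    {U W : Matrix (Fin r) (Fin k × Fin n) ℂ} {v : Matrix (Fin r) (Fin r) X} (hv : N r v ≤ 1)
    (hU : ∀ x, ∑ i, ‖(U *ᵥ x) i‖ ^ 2 ≤
      (star x ⬝ᵥ (T ⊗ₖ (1 : Matrix (Fin n) (Fin n) ℂ)) *ᵥ x).re)
    (hW : ∀ x, ∑ i, ‖(W *ᵥ x) i‖ ^ 2 ≤
      (star x ⬝ᵥ (S ⊗ₖ (1 : Matrix (Fin n) (Fin n) ℂ)) *ᵥ x).re) :
    (matPair ψ (sandwich Uᴴ v W)).re ≤ (T.trace.re + S.trace.re) / 2 := by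
  -- The contraction is Y = U (t⁻¹ ⊗ 1), and invertibility of t is why T is positive definite here.
  have key : ∀ {T : Matrix (Fin k) (Fin k) ℂ} {U : Matrix (Fin r) (Fin k × Fin n) ℂ},
      T.PosDef → (∀ x, ∑ i, ‖(U *ᵥ x) i‖ ^ 2 ≤
        (star x ⬝ᵥ (T ⊗ₖ (1 : Matrix (Fin n) (Fin n) ℂ)) *ᵥ x).re) →
      ∃ (t : Matrix (Fin k) (Fin k) ℂ) (Y : Matrix (Fin r) (Fin k × Fin n) ℂ), opNorm Y ≤ 1 ∧
        U = Y * (t ⊗ₖ (1 : Matrix (Fin n) (Fin n) ℂ)) ∧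
        T.trace.re = ∑ c : Fin k × Fin k, ‖t c.1 c.2‖ ^ 2 := by
    intro T U hT hU
    obtain ⟨t, ht, rfl⟩ : ∃ t, IsUnit t ∧ T = tᴴ * t := by
      open scoped MatrixOrder Matrix.Norms.L2Operator in
      exact CStarAlgebra.isStrictlyPositive_iff_eq_star_mul_self.1 hT.isStrictlyPositive
    have ht' : t⁻¹ * t = 1 := Matrix.nonsing_inv_mul _ ((Matrix.isUnit_iff_isUnit_det _).1 ht)
    have ht'' : t * t⁻¹ = 1 := Matrix.mul_nonsing_inv _ ((Matrix.isUnit_iff_isUnit_det _).1 ht)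
    refine ⟨t, U * (t⁻¹ ⊗ₖ (1 : Matrix (Fin n) (Fin n) ℂ)), ?_, ?_, ?_⟩
    · rw [opNorm_le_iff' _ _ ENNReal.one_ne_top]
      intro x
      rw [← Matrix.mulVec_mulVec]
      refine (hU _).trans (le_of_eq ?_)
      have e : (tᴴ * t) ⊗ₖ (1 : Matrix (Fin n) (Fin n) ℂ) =
          (t ⊗ₖ (1 : Matrix (Fin n) (Fin n) ℂ))ᴴ * (t ⊗ₖ (1 : Matrix (Fin n) (Fin n) ℂ)) := by
        rw [Matrix.conjTranspose_kronecker, ← Matrix.mul_kronecker_mul]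
        simp
      rw [e, ← Matrix.mulVec_mulVec, Matrix.dotProduct_mulVec, ← Matrix.star_mulVec,
        star_dotProduct_self_re, Matrix.mulVec_mulVec, ← Matrix.mul_kronecker_mul, ht'']
      simp
    · rw [Matrix.mul_assoc, ← Matrix.mul_kronecker_mul, ht']
      simp
    · rw [Matrix.trace, Complex.re_sum, Fintype.sum_prod_type_right]
      refine Finset.sum_congr rfl fun j _ => ?_
      rw [← star_dotProduct_self_re]
      rfl
  obtain ⟨t, Y, hY, rfl, et⟩ := key hT hU
  obtain ⟨s, Z, hZ, rfl, es⟩ := key hS hW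
  rw [Matrix.conjTranspose_mul, ← sandwich_sandwich, et, es]
  set z : Matrix (Fin k) (Fin k) (Matrix (Fin n) (Fin n) X) :=
    (Matrix.comp _ _ _ _ _).symm (sandwich Yᴴ v Z) with hz
  have e1 : sandwich Yᴴ v Z = Matrix.comp _ _ _ _ _ z := by simp [hz]
  have hz1 : matGauge n N k z ≤ 1 := by
    unfold matGauge flatten
    rw [← e1, reindex_sandwich]
    exact hN.sandwich_le_one (by rwa [opNorm_reindex, opNorm_conjTranspose]) hv
      (by rwa [opNorm_reindex])
  rw [e1, matPair_sandwich_kronecker hψ]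
  exact (opNorm_le_one_iff _).1 ((opNorm_blk_le _ φ z hz1).trans hφ) _ _

/-- Perturb T and S by δ · 1. Their traces grow by δk, which is at most ε for δ = ε/(k+1); the +1
covers k = 0. -/
theorem re_matPair_le_of_posSemidef (hN : RuanGauge N)
    {φ : Matrix (Fin k) (Fin k) (Matrix (Fin n) (Fin n) X →ₗ[ℂ] ℂ)}
    (hφ : functionalGauge (matGauge n N) k φ ≤ 1)
    {ψ : Matrix (Fin k × Fin n) (Fin k × Fin n) (X →ₗ[ℂ] ℂ)}
    (hψ : ∀ a b x, φ a b x = ∑ i, ∑ j, ψ (a, i) (b, j) (x i j))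
    {T S : Matrix (Fin k) (Fin k) ℂ} (hT : T.PosSemidef) (hS : S.PosSemidef) {r : ℕ}
    {U W : Matrix (Fin r) (Fin k × Fin n) ℂ} {v : Matrix (Fin r) (Fin r) X} (hv : N r v ≤ 1)
    (hU : ∀ x, ∑ i, ‖(U *ᵥ x) i‖ ^ 2 ≤
      (star x ⬝ᵥ (T ⊗ₖ (1 : Matrix (Fin n) (Fin n) ℂ)) *ᵥ x).re)
    (hW : ∀ x, ∑ i, ‖(W *ᵥ x) i‖ ^ 2 ≤
      (star x ⬝ᵥ (S ⊗ₖ (1 : Matrix (Fin n) (Fin n) ℂ)) *ᵥ x).re) :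
    (matPair ψ (sandwich Uᴴ v W)).re ≤ (T.trace.re + S.trace.re) / 2 := by
  refine le_of_forall_pos_le_add fun ε hε => ?_
  set δ : ℝ := ε / (k + 1) with hδ
  have hδ0 : 0 < δ := by positivity
  have hd : ((δ : ℂ) • (1 : Matrix (Fin k) (Fin k) ℂ)).PosDef :=
    Matrix.PosDef.one.smul (by exact_mod_cast hδ0)
  have mono : ∀ {T : Matrix (Fin k) (Fin k) ℂ} (x : Fin k × Fin n → ℂ),
      (star x ⬝ᵥ (T ⊗ₖ (1 : Matrix (Fin n) (Fin n) ℂ)) *ᵥ x).re ≤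
      (star x ⬝ᵥ ((T + (δ : ℂ) • 1) ⊗ₖ (1 : Matrix (Fin n) (Fin n) ℂ)) *ᵥ x).re := by
    intro T x
    have h : 0 ≤ δ * ∑ i, ‖x i‖ ^ 2 := by positivity
    rw [Matrix.add_kronecker, Matrix.smul_kronecker, Matrix.one_kronecker_one, Matrix.add_mulVec,
      Matrix.smul_mulVec, Matrix.one_mulVec, dotProduct_add, dotProduct_smul, Complex.add_re,
      smul_eq_mul, Complex.re_ofReal_mul, star_dotProduct_self_re]
    linarith
  have h := re_matPair_le_of_posDef hN hφ hψ (hd.posSemidef_add hT) (hd.posSemidef_add hS) hv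
    (fun x => (hU x).trans (mono x)) (fun x => (hW x).trans (mono x))
  refine h.trans ?_
  simp only [Matrix.trace_add, Matrix.trace_smul, Matrix.trace_one, Complex.add_re, smul_eq_mul,
    Complex.re_ofReal_mul, Fintype.card_fin, Complex.natCast_re]
  have : δ * k ≤ ε := by
    rw [hδ, div_mul_eq_mul_div, div_le_iff₀ (by positivity)]
    nlinarith
  linarith


/-- A functional bounded by the `ℓ²` operator norm type pairing is dominated by the sum of two
positive forms whose partial traces are at most `1`. -/
theorem exists_dominating_forms (hN : RuanGauge N)
    {φ : Matrix (Fin k) (Fin k) (Matrix (Fin n) (Fin n) X →ₗ[ℂ] ℂ)}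
    (hφ : functionalGauge (matGauge n N) k φ ≤ 1)
    {ψ : Matrix (Fin k × Fin n) (Fin k × Fin n) (X →ₗ[ℂ] ℂ)}
    (hψ : ∀ a b x, φ a b x = ∑ i, ∑ j, ψ (a, i) (b, j) (x i j)) :
    ∃ ρ σ : Matrix (Fin k × Fin n) (Fin k × Fin n) ℂ →ₗ[ℝ] ℝ,
      (∀ (H : Matrix (Fin k × Fin n) (Fin k × Fin n) ℂ) (T : Matrix (Fin k) (Fin k) ℂ),
        T.PosSemidef → (∀ x, (star x ⬝ᵥ H *ᵥ x).re ≤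
          (star x ⬝ᵥ (T ⊗ₖ (1 : Matrix (Fin n) (Fin n) ℂ)) *ᵥ x).re) → ρ H ≤ T.trace.re) ∧
      (∀ (H : Matrix (Fin k × Fin n) (Fin k × Fin n) ℂ) (T : Matrix (Fin k) (Fin k) ℂ),
        T.PosSemidef → (∀ x, (star x ⬝ᵥ H *ᵥ x).re ≤
          (star x ⬝ᵥ (T ⊗ₖ (1 : Matrix (Fin n) (Fin n) ℂ)) *ᵥ x).re) → σ H ≤ T.trace.re) ∧
      ∀ (r : ℕ) (U W : Matrix (Fin r) (Fin k × Fin n) ℂ) (v : Matrix (Fin r) (Fin r) X),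
        N r v ≤ 1 → (matPair ψ (sandwich Uᴴ v W)).re ≤ (ρ (Uᴴ * U) + σ (Wᴴ * W)) / 2 := by
  -- A point over (H₁, H₂) records H₁ + UᴴU ≤ T ⊗ 1 and H₂ + WᴴW ≤ S ⊗ 1 as inequalities of real
  -- parts of quadratic forms, so H₁ and H₂ need not be Hermitian. Its height is the slack in the
  -- bound of `re_matPair_le_of_posSemidef`.
  refine Exists.elim (exists_linear_le_of_cone
    (V := Matrix (Fin k × Fin n) (Fin k × Fin n) ℂ × Matrix (Fin k × Fin n) (Fin k × Fin n) ℂ)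
    (fun H τ => ∃ (T S : Matrix (Fin k) (Fin k) ℂ) (r : ℕ)
      (U W : Matrix (Fin r) (Fin k × Fin n) ℂ) (v : Matrix (Fin r) (Fin r) X),
      T.PosSemidef ∧ S.PosSemidef ∧ N r v ≤ 1 ∧
      (∀ x, (star x ⬝ᵥ H.1 *ᵥ x).re + ∑ i, ‖(U *ᵥ x) i‖ ^ 2 ≤
        (star x ⬝ᵥ (T ⊗ₖ (1 : Matrix (Fin n) (Fin n) ℂ)) *ᵥ x).re) ∧
      (∀ x, (star x ⬝ᵥ H.2 *ᵥ x).re + ∑ i, ‖(W *ᵥ x) i‖ ^ 2 ≤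
        (star x ⬝ᵥ (S ⊗ₖ (1 : Matrix (Fin n) (Fin n) ℂ)) *ᵥ x).re) ∧
      τ = (T.trace.re + S.trace.re) / 2 - (matPair ψ (sandwich Uᴴ v W)).re)
    ?_ ?_ ?_ ?_) fun g hg => ?_
  · rintro H H' _ _ ⟨T, S, r, U, W, v, hT, hS, hv, hU, hW, rfl⟩
      ⟨T', S', r', U', W', v', hT', hS', hv', hU', hW', rfl⟩
    have q : ∀ (U : Matrix (Fin r) (Fin k × Fin n) ℂ) (U' : Matrix (Fin r') (Fin k × Fin n) ℂ)
        (x : Fin k × Fin n → ℂ),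
        ∑ i, ‖(Matrix.reindex finSumFinEquiv (Equiv.refl _) (Matrix.fromRows U U') *ᵥ x) i‖ ^ 2 =
          ∑ i, ‖(U *ᵥ x) i‖ ^ 2 + ∑ i, ‖(U' *ᵥ x) i‖ ^ 2 := by
      intro U U' x
      rw [← finSumFinEquiv.sum_comp, Fintype.sum_sum_type]
      simp [Matrix.mulVec, dotProduct]
    -- Additivity: stack the rows of U, U' and of W, W', and take v ⊕ v'. No cross terms appear, and
    -- the direct sum stays in the unit ball.
    refine ⟨T + T', S + S', r + r', Matrix.reindex finSumFinEquiv (Equiv.refl _)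
      (Matrix.fromRows U U'), Matrix.reindex finSumFinEquiv (Equiv.refl _)
      (Matrix.fromRows W W'), directSum v v', hT.add hT', hS.add hS',
      (hN.directSum_le _ _ _ _).trans (max_le hv hv'), fun x => ?_, fun x => ?_, ?_⟩
    · have h1 := hU x
      have h2 := hU' x
      rw [q, Prod.fst_add, Matrix.add_mulVec, dotProduct_add, Matrix.add_kronecker,
        Matrix.add_mulVec, dotProduct_add, Complex.add_re, Complex.add_re]
      linarith
    · have h1 := hW x
      have h2 := hW' x
      rw [q, Prod.snd_add, Matrix.add_mulVec, dotProduct_add, Matrix.add_kronecker,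
        Matrix.add_mulVec, dotProduct_add, Complex.add_re, Complex.add_re]
      linarith
    · have e : sandwich (Matrix.reindex finSumFinEquiv (Equiv.refl _) (Matrix.fromRows U U'))ᴴ
          (directSum v v') (Matrix.reindex finSumFinEquiv (Equiv.refl _) (Matrix.fromRows W W')) =
          sandwich Uᴴ v W + sandwich U'ᴴ v' W' := by
        ext1 p q
        simp only [sandwich, directSum, ← finSumFinEquiv.sum_comp, Fintype.sum_sum_type,
          Matrix.of_apply, Matrix.conjTranspose_apply, Matrix.reindex_apply,
          Matrix.submatrix_apply, Equiv.symm_apply_apply, Matrix.add_apply]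
        simp
      rw [e, map_add, Matrix.trace_add, Matrix.trace_add, Complex.add_re, Complex.add_re,
        Complex.add_re]
      ring
  · rintro c H _ hc ⟨T, S, r, U, W, v, hT, hS, hv, hU, hW, rfl⟩
    have hcc : ((Real.sqrt c : ℝ) : ℂ) * (Real.sqrt c : ℝ) = c := by
      exact_mod_cast Real.mul_self_sqrt hc.le
    have hc' : (0 : ℂ) ≤ c := by exact_mod_cast hc.le
    have q : ∀ (H : Matrix (Fin k × Fin n) (Fin k × Fin n) ℂ) (T : Matrix (Fin k) (Fin k) ℂ)
        (U : Matrix (Fin r) (Fin k × Fin n) ℂ), (∀ x, (star x ⬝ᵥ H *ᵥ x).re +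
          ∑ i, ‖(U *ᵥ x) i‖ ^ 2 ≤
            (star x ⬝ᵥ (T ⊗ₖ (1 : Matrix (Fin n) (Fin n) ℂ)) *ᵥ x).re) →
        ∀ x, (star x ⬝ᵥ (c • H) *ᵥ x).re + ∑ i, ‖((((Real.sqrt c : ℝ) : ℂ) • U) *ᵥ x) i‖ ^ 2 ≤
            (star x ⬝ᵥ (((c : ℂ) • T) ⊗ₖ (1 : Matrix (Fin n) (Fin n) ℂ)) *ᵥ x).re := by
      intro H T U h x
      have h1 := mul_le_mul_of_nonneg_left (h x) hc.le
      rw [← Complex.coe_smul c H, Matrix.smul_kronecker, Matrix.smul_mulVec, Matrix.smul_mulVec,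
        Matrix.smul_mulVec, dotProduct_smul, dotProduct_smul, smul_eq_mul, smul_eq_mul,
        Complex.re_ofReal_mul, Complex.re_ofReal_mul]
      simp only [Pi.smul_apply, norm_smul, mul_pow, Complex.norm_real, Real.norm_eq_abs, sq_abs,
        Real.sq_sqrt hc.le, ← Finset.mul_sum]
      linarith
    -- The constraints are quadratic in U and W, so these scale by √c while v is unchanged.
    refine ⟨(c : ℂ) • T, (c : ℂ) • S, r, ((Real.sqrt c : ℝ) : ℂ) • U, ((Real.sqrt c : ℝ) : ℂ) • W,
      v, hT.smul hc', hS.smul hc', hv, q _ _ _ hU, q _ _ _ hW, ?_⟩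
    have e : sandwich (((Real.sqrt c : ℝ) : ℂ) • U)ᴴ v (((Real.sqrt c : ℝ) : ℂ) • W) =
        (c : ℂ) • sandwich Uᴴ v W := by
      ext1 p q
      simp only [sandwich, Matrix.of_apply, Matrix.smul_apply, Finset.smul_sum, smul_smul, ← hcc]
      refine Finset.sum_congr rfl fun i _ => Finset.sum_congr rfl fun j _ => ?_
      congr 1
      simp
      ring
    rw [e, map_smul, Matrix.trace_smul, Matrix.trace_smul, smul_eq_mul, smul_eq_mul, smul_eq_mul,
      Complex.re_ofReal_mul, Complex.re_ofReal_mul, Complex.re_ofReal_mul]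
    ring
  · rintro H
    have q : ∀ H : Matrix (Fin k × Fin n) (Fin k × Fin n) ℂ, ∃ T : Matrix (Fin k) (Fin k) ℂ,
        T.PosSemidef ∧ ∀ x, (star x ⬝ᵥ H *ᵥ x).re + ∑ i,
            ‖((0 : Matrix (Fin 0) (Fin k × Fin n) ℂ) *ᵥ x) i‖ ^ 2 ≤
          (star x ⬝ᵥ (T ⊗ₖ (1 : Matrix (Fin n) (Fin n) ℂ)) *ᵥ x).re := by
      intro H
      -- Nonempty fibres: Re⟨x, Hx⟩ ≤ (‖x‖² + ‖Hx‖²)/2, so this multiple of the identity dominates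
      -- H, with U and v empty.
      refine ⟨(((1 + (opNorm H).toReal ^ 2) / 2 : ℝ) : ℂ) • 1, Matrix.PosSemidef.one.smul ?_,
        fun x => ?_⟩
      · exact Complex.zero_le_real.2 (by positivity)
      have h1 := sum_norm_mul_le x (H *ᵥ x)
      have h2 := opNorm_mulVec_le H x
      rw [Matrix.smul_kronecker, Matrix.one_kronecker_one, Matrix.smul_mulVec, Matrix.one_mulVec,
        dotProduct_smul, smul_eq_mul, Complex.re_ofReal_mul, star_dotProduct_self_re]
      simp
      linarith
    obtain ⟨T, hT, h1⟩ := q H.1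
    obtain ⟨S, hS, h2⟩ := q H.2
    exact ⟨_, T, S, 0, 0, 0, 0, hT, hS, (hN.zero 0).trans_le zero_le, h1, h2, rfl⟩
  · rintro _ ⟨T, S, r, U, W, v, hT, hS, hv, hU, hW, rfl⟩
    have := re_matPair_le_of_posSemidef hN hφ hψ hT hS hv (by simpa using hU) (by simpa using hW)
    linarith
  · have z0 : N 0 0 ≤ 1 := (hN.zero 0).trans_le zero_le
    -- Points with U = W = 0 give the two trace bounds, the factor 2 compensating the half in the
    -- height. Points with T = S = 0, H₁ = -UᴴU and H₂ = -WᴴW give the domination of ψ.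
    refine ⟨2 • g ∘ₗ LinearMap.inl ℝ _ _, 2 • g ∘ₗ LinearMap.inr ℝ _ _, ?_, ?_, ?_⟩
    · intro H T hT hH
      have h := hg (H, 0) (T.trace.re / 2) ⟨T, 0, 0, 0, 0, 0, hT, .zero, z0, by simpa using hH,
        by simp, by simp [sandwich, matPair]⟩
      simp
      linarith
    · intro H T hT hH
      have h := hg (0, H) (T.trace.re / 2) ⟨0, T, 0, 0, 0, 0, .zero, hT, z0, by simp,
        by simpa using hH, by simp [sandwich, matPair]⟩
      simp
      linarith
    · intro r U W v hv
      have q : ∀ (U : Matrix (Fin r) (Fin k × Fin n) ℂ) x,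
          (star x ⬝ᵥ (-(Uᴴ * U)) *ᵥ x).re + ∑ i, ‖(U *ᵥ x) i‖ ^ 2 ≤
            (star x ⬝ᵥ ((0 : Matrix (Fin k) (Fin k) ℂ) ⊗ₖ (1 : Matrix (Fin n) (Fin n) ℂ)) *ᵥ x).re := by
        intro U x
        rw [← star_dotProduct_self_re, Matrix.star_mulVec, ← Matrix.dotProduct_mulVec,
          Matrix.mulVec_mulVec]
        simp [Matrix.neg_mulVec]
      have h := hg (-(Uᴴ * U), -(Wᴴ * W)) _ ⟨0, 0, r, U, W, v, .zero, .zero, hv, q U, q W, rfl⟩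
      have e : g (-(Uᴴ * U), -(Wᴴ * W)) = -(g (Uᴴ * U, 0) + g (0, Wᴴ * W)) := by
        rw [← map_add, ← map_neg]
        simp
      rw [e] at h
      simp at h ⊢
      linarith

end Factorization


/-! ### The factorization theorem for complete contractions M_n(X) → M_k -/

section Factorization

variable {X : Type*} [AddCommGroup X] [Module ℂ X] {N : MatGauge X} {k n : ℕ}

/-- Every real linear form on complex matrices is `M ↦ Re tr(M R)`. -/
theorem exists_re_trace_mul {P : Type*} [Fintype P] [DecidableEq P]
    (ρ : Matrix P P ℂ →ₗ[ℝ] ℝ) : ∃ R : Matrix P P ℂ, ∀ M, ρ M = (M * R).trace.re := by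
  -- With R_pq = ρ(e_qp) - iρ(i e_qp), the real part of M_qp R_pq is Re(M_qp) ρ(e_qp) + Im(M_qp) ρ(i
  -- e_qp).
  refine ⟨Matrix.of fun p q => (ρ (Matrix.single q p 1) : ℂ) -
    (ρ (Matrix.single q p Complex.I) : ℂ) * Complex.I, fun M => ?_⟩
  conv_lhs => rw [Matrix.matrix_eq_sum_single M]
  simp only [map_sum, Matrix.trace, Matrix.diag_apply, Matrix.mul_apply, Complex.re_sum]
  refine Finset.sum_congr rfl fun i _ => Finset.sum_congr rfl fun j _ => ?_
  have e : Matrix.single i j (M i j) = (M i j).re • Matrix.single i j (1 : ℂ) +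
      (M i j).im • Matrix.single i j Complex.I := by
    rw [Matrix.smul_single, Matrix.smul_single, ← Matrix.single_add]
    congr 1
    simp [Complex.re_add_im]
  rw [e, map_add, map_smul, map_smul]
  simp

/-- A vector of ℂ^R ⊗ ℂ^P is an R × P matrix. Changing variables in the functionals by A and B
amounts to multiplying the test matrices by A and B on the right. -/
theorem dotProduct_blk_sandwich_mulVec {P R : Type*} [Fintype P] [Fintype R]
    (ψ : Matrix P P (X →ₗ[ℂ] ℂ)) (A B : Matrix P P ℂ) (v : Matrix R R X) (ξ η : R × P → ℂ) :
    star ξ ⬝ᵥ (Matrix.of fun a b : R × P =>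
        sandwich (A.map star) ψ Bᵀ a.2 b.2 (v a.1 b.1)) *ᵥ η =
      matPair ψ (sandwich (Matrix.of (fun s p => ξ (s, p)) * A)ᴴ v
        (Matrix.of (fun s p => η (s, p)) * B)) := by
  simp only [matPair, LinearMap.coe_mk, AddHom.coe_mk, sandwich, Matrix.of_apply, dotProduct,
    Matrix.mulVec, Fintype.sum_prod_type, Matrix.conjTranspose_apply, Matrix.mul_apply,
    Matrix.map_apply, Matrix.transpose_apply, map_sum, map_smul, LinearMap.sum_apply,
    LinearMap.smul_apply, Pi.star_apply, smul_eq_mul, star_sum, star_mul, Finset.mul_sum,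
    Finset.sum_mul]
  have e := Fintype.sum_equiv
    (⟨fun x => (x.2.2.2.2.1, x.2.2.2.2.2, x.1, x.2.2.1, x.2.2.2.1, x.2.1),
      fun y => (y.2.2.1, y.2.2.2.2.2, y.2.2.2.1, y.2.2.2.2.1, y.1, y.2.1), fun _ => rfl,
      fun _ => rfl⟩ : R × P × R × P × P × P ≃ P × P × R × R × P × P)
    (fun (s, p, t, q, u, w) => star (ξ (s, p)) *
      (star (A p u) * B q w * ψ u w (v s t) * η (t, q)))
    (fun (u, w, s, t, q, p) => star (A p u) * star (ξ (s, p)) *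
      (η (t, q) * B q w) * ψ u w (v s t))
    fun _ => by simp only [Equiv.coe_fn_mk]; ring
  simpa only [Fintype.sum_prod_type] using e

/-- The domination with T = 0 makes ρ a positive form, so its density R is positive semidefinite.
With R + ε = A Aᴴ, the form ρ(UᴴU) is at most the squared Hilbert–Schmidt norm of UA. The domination
on T ⊗ 1 bounds the partial trace of R by 1, that is, it bounds the norm of A with one index moved
to the column side. -/
theorem exists_posDef_of_dominated
    (ρ : Matrix (Fin k × Fin n) (Fin k × Fin n) ℂ →ₗ[ℝ] ℝ)
    (hρ : ∀ (H : Matrix (Fin k × Fin n) (Fin k × Fin n) ℂ) (T : Matrix (Fin k) (Fin k) ℂ),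
        T.PosSemidef → (∀ x, (star x ⬝ᵥ H *ᵥ x).re ≤
          (star x ⬝ᵥ (T ⊗ₖ (1 : Matrix (Fin n) (Fin n) ℂ)) *ᵥ x).re) → ρ H ≤ T.trace.re)
    {ε : ℝ} (hε : 0 < ε) :
    ∃ A B : Matrix (Fin k × Fin n) (Fin k × Fin n) ℂ, B * A = 1 ∧
      (∀ (r : ℕ) (U : Matrix (Fin r) (Fin k × Fin n) ℂ),
        ρ (Uᴴ * U) ≤ ∑ i, ∑ p, ‖(U * A) i p‖ ^ 2) ∧
      opNorm (Matrix.of fun (a : Fin k) (s : Fin n × (Fin k × Fin n)) => star (A (a, s.1) s.2)) ≤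
        ENNReal.ofReal (Real.sqrt (1 + n * ε)) := by
  obtain ⟨R, hR⟩ := exists_re_trace_mul ρ
  have h0 : ∀ H : Matrix (Fin k × Fin n) (Fin k × Fin n) ℂ,
      (∀ x, (star x ⬝ᵥ H *ᵥ x).re ≤ 0) → ρ H ≤ 0 := fun H hH => by
    simpa using hρ H 0 .zero (by simpa using hH)
  have tr : ∀ x : Fin k × Fin n → ℂ, (Matrix.vecMulVec x (star x) * R).trace = star x ⬝ᵥ R *ᵥ x := by
    intro x
    rw [Matrix.vecMulVec_mul, Matrix.trace_vecMulVec, dotProduct_comm, Matrix.dotProduct_mulVec]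
  have vv : ∀ x y : Fin k × Fin n → ℂ,
      star y ⬝ᵥ Matrix.vecMulVec x (star x) *ᵥ y = (‖star x ⬝ᵥ y‖ ^ 2 : ℝ) := by
    intro x y
    rw [Matrix.vecMulVec_mulVec, dotProduct_smul, Complex.ofReal_pow, ← Complex.conj_mul',
      ← Complex.star_def, Matrix.star_dotProduct]
    simp
  have hre : ∀ x, 0 ≤ (star x ⬝ᵥ R *ᵥ x).re := by
    intro x
    have h := h0 (-Matrix.vecMulVec x (star x)) fun y => by
      rw [Matrix.neg_mulVec, dotProduct_neg, vv, Complex.neg_re, Complex.ofReal_re]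
      simp
    rw [map_neg, hR, tr] at h
    linarith
  -- The quadratic form of M - Mᴴ is purely imaginary, so both it and its negative satisfy the
  -- hypothesis of `h0`. This is what forces R to be Hermitian.
  have hskew : ∀ M : Matrix (Fin k × Fin n) (Fin k × Fin n) ℂ, ρ (M - Mᴴ) = 0 := by
    intro M
    have e : ∀ x, (star x ⬝ᵥ (M - Mᴴ) *ᵥ x).re = 0 := by
      intro x
      have h : star x ⬝ᵥ Mᴴ *ᵥ x = star (star x ⬝ᵥ M *ᵥ x) := by
        rw [Matrix.dotProduct_mulVec, ← Matrix.star_mulVec, Matrix.star_dotProduct]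
      rw [Matrix.sub_mulVec, dotProduct_sub, h]
      simp
    refine le_antisymm (h0 _ fun x => (e x).le) ?_
    rw [← neg_nonpos, ← map_neg]
    refine h0 _ fun x => ?_
    rw [Matrix.neg_mulVec, dotProduct_neg, Complex.neg_re, e, neg_zero]
  have hherm : R.IsHermitian := by
    have h : ∀ M : Matrix (Fin k × Fin n) (Fin k × Fin n) ℂ, (M * (R - Rᴴ)).trace.re = 0 := by
      intro M
      have h1 := hskew M
      have h2 : (Mᴴ * R).trace.re = (M * Rᴴ).trace.re := by
        rw [← Matrix.conjTranspose_conjTranspose R, ← Matrix.conjTranspose_mul,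
          Matrix.trace_conjTranspose, Matrix.conjTranspose_conjTranspose, Matrix.trace_mul_comm]
        simp
      rw [map_sub, hR, hR, h2] at h1
      rw [Matrix.mul_sub, Matrix.trace_sub, Complex.sub_re, h1]
    -- The choice M = (R - Rᴴ)ᴴ turns `h` into the vanishing of the Hilbert–Schmidt norm of R - Rᴴ.
    have h3 : ((R - Rᴴ)ᴴ * (R - Rᴴ)).trace = 0 :=
      Complex.ext (h _) (Complex.nonneg_iff.1
        (Matrix.posSemidef_conjTranspose_mul_self (R - Rᴴ)).trace_nonneg).2.symm
    exact (sub_eq_zero.1 (Matrix.trace_conjTranspose_mul_self_eq_zero_iff.1 h3)).symm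
  have hpsd : R.PosSemidef := by
    refine .of_dotProduct_mulVec_nonneg hherm fun x => Complex.nonneg_iff.2 ⟨hre x, ?_⟩
    exact (hherm.im_star_dotProduct_mulVec_self x).symm
  have hpd : (R + (ε : ℂ) • 1).PosDef :=
    (Matrix.PosDef.one.smul (by exact_mod_cast hε)).posSemidef_add hpsd
  obtain ⟨A, hA, eA⟩ : ∃ A, IsUnit A ∧ R + (ε : ℂ) • 1 = A * Aᴴ := by
    open scoped MatrixOrder Matrix.Norms.L2Operator in
    exact CStarAlgebra.isStrictlyPositive_iff_eq_mul_star_self.1 hpd.isStrictlyPositive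
  refine ⟨A, A⁻¹, Matrix.nonsing_inv_mul _ ((Matrix.isUnit_iff_isUnit_det _).1 hA), ?_, ?_⟩
  · intro r U
    have e1 : ∀ V : Matrix (Fin r) (Fin k × Fin n) ℂ,
        ∑ i, ∑ p, ‖V i p‖ ^ 2 = (V * Vᴴ).trace.re := by
      intro V
      rw [Matrix.trace, Complex.re_sum]
      refine Finset.sum_congr rfl fun i _ => ?_
      rw [← star_dotProduct_self_re, dotProduct_comm]
      rfl
    have e2 : (U * A * (U * A)ᴴ).trace = (Uᴴ * U * R).trace + ε * (U * Uᴴ).trace := by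
      rw [Matrix.conjTranspose_mul, Matrix.mul_assoc, ← Matrix.mul_assoc A, ← eA,
        ← Matrix.mul_assoc, Matrix.trace_mul_comm, ← Matrix.mul_assoc, Matrix.mul_add,
        Matrix.trace_add, Matrix.mul_smul, Matrix.trace_smul, Matrix.mul_one,
        Matrix.trace_mul_comm Uᴴ U, smul_eq_mul]
    have h : 0 ≤ (U * Uᴴ).trace.re := by
      rw [← e1]
      positivity
    rw [hR, e1, e2, Complex.add_re, Complex.re_ofReal_mul]
    nlinarith
  · refine opNorm_le_sqrt_of_mul_conjTranspose _ (by positivity) fun ξ => ?_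
    have hξ : (Matrix.vecMulVec (star ξ) ξ).PosSemidef := Matrix.posSemidef_vecMulVec_star_self ξ
    -- Test on the rank-one matrix T built from ξ, with H = T ⊗ 1, so that tr T = ‖ξ‖². The
    -- perturbation ε · 1 contributes nε‖ξ‖² to the partial trace.
    have h := hρ (Matrix.vecMulVec (star ξ) ξ ⊗ₖ (1 : Matrix (Fin n) (Fin n) ℂ)) _ hξ
      fun _ => le_rfl
    have e1 : (Matrix.vecMulVec (star ξ) ξ).trace.re = ∑ i, ‖ξ i‖ ^ 2 := by
      rw [Matrix.trace_vecMulVec, star_dotProduct_self_re]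
    rw [hR, e1] at h
    have e2 : star ξ ⬝ᵥ ((Matrix.of fun (a : Fin k) (s : Fin n × (Fin k × Fin n)) =>
        star (A (a, s.1) s.2)) * (Matrix.of fun (a : Fin k) (s : Fin n × (Fin k × Fin n)) =>
        star (A (a, s.1) s.2))ᴴ) *ᵥ ξ =
        (Matrix.vecMulVec (star ξ) ξ ⊗ₖ (1 : Matrix (Fin n) (Fin n) ℂ) * (A * Aᴴ)).trace := by
      simp only [dotProduct, Matrix.mulVec, Matrix.mul_apply, Matrix.of_apply,
        Matrix.conjTranspose_apply, star_star, Matrix.trace, Matrix.diag_apply,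
        Matrix.kroneckerMap_apply, Matrix.one_apply, Fintype.sum_prod_type, Matrix.vecMulVec_apply,
        Finset.mul_sum, Finset.sum_mul, mul_ite, ite_mul, mul_one, mul_zero, zero_mul,
        Finset.sum_ite_irrel, Finset.sum_const_zero, Finset.sum_ite_eq, Finset.mem_univ, if_true]
      refine Finset.sum_congr rfl fun a _ => ?_
      rw [Finset.sum_comm]
      refine Finset.sum_congr rfl fun i _ => Finset.sum_congr rfl fun b _ =>
        Finset.sum_congr rfl fun c _ => Finset.sum_congr rfl fun d _ => ?_
      ring
    rw [e2, ← eA, Matrix.mul_add, Matrix.trace_add, Matrix.mul_smul, Matrix.mul_one,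
      Matrix.trace_smul, Matrix.trace_kronecker, Matrix.trace_one, Complex.add_re, smul_eq_mul,
      Complex.re_ofReal_mul, Fintype.card_fin, mul_comm _ (n : ℂ), ← Complex.ofReal_natCast,
      Complex.re_ofReal_mul, e1]
    linarith

/-- A completely contractive map `M_n(X) → M_k` factors through the amplification of a completely
contractive map on `X`, up to `ε`. -/
theorem exists_factorization (hN : RuanGauge N)
    (φ : Matrix (Fin k) (Fin k) (Matrix (Fin n) (Fin n) X →ₗ[ℂ] ℂ))
    (hφ : functionalGauge (matGauge n N) k φ ≤ 1) {C : ℝ} (hC : 1 < C) :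
    ∃ (f : Matrix (Fin (k * n)) (Fin (k * n)) (X →ₗ[ℂ] ℂ))
      (α : Matrix (Fin k) (Fin n × Fin (k * n)) ℂ) (β : Matrix (Fin n × Fin (k * n)) (Fin k) ℂ),
      functionalGauge N (k * n) f ≤ 1 ∧ opNorm α ≤ ENNReal.ofReal C ∧
      opNorm β ≤ ENNReal.ofReal C ∧
      ∀ a b x, φ a b x = ∑ r, ∑ s, α a r * β s b * f r.2 s.2 (x r.1 s.1) := by
  set ψ : Matrix (Fin k × Fin n) (Fin k × Fin n) (X →ₗ[ℂ] ℂ) := Matrix.of fun p q =>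
    φ p.1 q.1 ∘ₗ Matrix.singleLinearMap ℂ p.2 q.2 with hψ'
  have hψ : ∀ a b x, φ a b x = ∑ i, ∑ j, ψ (a, i) (b, j) (x i j) := by
    intro a b x
    conv_lhs => rw [Matrix.matrix_eq_sum_single x]
    simp [hψ']
  obtain ⟨ρ, σ, hρ, hσ, hdom⟩ := exists_dominating_forms hN hφ hψ
  obtain ⟨ε, hε, hεC⟩ : ∃ ε : ℝ, 0 < ε ∧ Real.sqrt (1 + n * ε) ≤ C := by
    -- Chosen so that 1 + nε ≤ C²; the denominator n + 1 also covers n = 0.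
    refine ⟨(C ^ 2 - 1) / (n + 1), div_pos (by nlinarith) (by positivity), ?_⟩
    rw [Real.sqrt_le_left (by linarith)]
    have : n * ((C ^ 2 - 1) / (n + 1)) ≤ C ^ 2 - 1 := by
      rw [← mul_div_assoc, div_le_iff₀ (by positivity)]
      nlinarith
    linarith
  obtain ⟨A, A', hA, hA1, hA2⟩ := exists_posDef_of_dominated ρ hρ hε
  obtain ⟨B, B', hB, hB1, hB2⟩ := exists_posDef_of_dominated σ hσ hε
  -- The functionals are rescaled by the inverses A' and B'. On test vectors this replaces ρ and σ
  -- by forms bounded by ‖ξ‖² and ‖η‖², which makes f a complete contraction. The factors A and B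
  -- reappear as α and β.
  set f : Matrix (Fin k × Fin n) (Fin k × Fin n) (X →ₗ[ℂ] ℂ) :=
    sandwich (A'.map star) ψ B'ᵀ with hf
  have e : Fin k × Fin n ≃ Fin (k * n) := finProdFinEquiv
  set α : Matrix (Fin k) (Fin n × (Fin k × Fin n)) ℂ :=
    Matrix.of fun (a : Fin k) (s : Fin n × (Fin k × Fin n)) => star (A (a, s.1) s.2) with hα
  set β : Matrix (Fin k) (Fin n × (Fin k × Fin n)) ℂ :=
    Matrix.of fun (a : Fin k) (s : Fin n × (Fin k × Fin n)) => star (B (a, s.1) s.2) with hβ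
  refine ⟨Matrix.reindex e e f, Matrix.reindex (Equiv.refl _) ((Equiv.refl _).prodCongr e) α,
    Matrix.reindex ((Equiv.refl _).prodCongr e) (Equiv.refl _) βᴴ, ?_, ?_, ?_, ?_⟩
  · refine functionalGauge_le_iff.2 fun r v hv => ?_
    have e1 : blk (Matrix.reindex e e f) v = Matrix.reindex ((Equiv.refl _).prodCongr e)
      ((Equiv.refl _).prodCongr e) (Matrix.of fun a b : Fin r × (Fin k × Fin n) =>
        f a.2 b.2 (v a.1 b.1)) := rfl
    rw [e1, opNorm_reindex, opNorm_le_one_iff]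
    intro ξ η
    have h := hdom r (Matrix.of (fun s p => ξ (s, p)) * A') (Matrix.of (fun s p => η (s, p)) * B')
      v hv
    have h1 := hA1 r (Matrix.of (fun s p => ξ (s, p)) * A')
    have h2 := hB1 r (Matrix.of (fun s p => η (s, p)) * B')
    rw [Matrix.mul_assoc, hA, Matrix.mul_one] at h1
    rw [Matrix.mul_assoc, hB, Matrix.mul_one] at h2
    have e2 : star ξ ⬝ᵥ (Matrix.of fun a b : Fin r × (Fin k × Fin n) =>
        f a.2 b.2 (v a.1 b.1)) *ᵥ η = matPair ψ (sandwich (Matrix.of (fun s p => ξ (s, p)) * A')ᴴ v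
          (Matrix.of (fun s p => η (s, p)) * B')) :=
      dotProduct_blk_sandwich_mulVec ψ A' B' v ξ η
    rw [e2, Fintype.sum_prod_type, Fintype.sum_prod_type]
    refine h.trans ?_
    simp only [Matrix.of_apply] at h1 h2
    linarith
  · rw [opNorm_reindex]
    exact hA2.trans (ENNReal.ofReal_le_ofReal hεC)
  · rw [opNorm_reindex, opNorm_conjTranspose]
    exact hB2.trans (ENNReal.ofReal_le_ofReal hεC)
  · intro a b x
    -- Undoing the rescaling: A'A = 1 and B'B = 1, for square matrices, so f determines ψ and hence
    -- φ.
    have e3 : sandwich (A.map star) f Bᵀ = ψ := by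
      rw [hf, sandwich_sandwich]
      have h1 : A.map star * A'.map star = 1 := by
        have := congrArg (fun M => M.map (starRingEnd ℂ)) (mul_eq_one_comm.1 hA)
        rw [Matrix.map_mul, Matrix.map_one _ (map_zero _) (map_one _)] at this
        exact this
      rw [h1, ← Matrix.transpose_mul, mul_eq_one_comm.1 hB, Matrix.transpose_one, sandwich_one]
    rw [hψ, ← e3]
    simp only [sandwich, Matrix.of_apply, Fintype.sum_prod_type, LinearMap.sum_apply,
      LinearMap.smul_apply, smul_eq_mul, Matrix.map_apply, Matrix.transpose_apply, ← e.sum_comp,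
      Matrix.reindex_apply, Matrix.submatrix_apply, Equiv.prodCongr_symm, Equiv.prodCongr_apply,
      Prod.map, Equiv.symm_apply_apply, Equiv.refl_symm, Equiv.refl_apply,
      Matrix.conjTranspose_apply, hα, hβ, star_star]
    refine Finset.sum_congr rfl fun i _ => ?_
    rw [Finset.sum_comm]
    exact Finset.sum_congr rfl fun p _ => Finset.sum_comm

end Factorization


/-! ### Homogeneous functions -/

/-- Rescale v by 1/(h v + ε), since h v may be 0, and let ε tend to 0. Finiteness of F makes
multiplication by it continuous. -/
theorem le_mul_of_le_one_imp {V : Type*} [AddCommGroup V] [Module ℂ V] {g h : V → ℝ≥0∞}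
    (hg : ∀ (c : ℂ) v, g (c • v) = ‖c‖ₑ * g v) (hh : ∀ (c : ℂ) v, h (c • v) = ‖c‖ₑ * h v)
    {F : ℝ≥0∞} (hF : F ≠ ∞) (H : ∀ v, h v ≤ 1 → g v ≤ F) {v : V} (hv : h v ≠ ∞) :
    g v ≤ F * h v := by
  have key : ∀ ε : ℝ, 0 < ε → g v ≤ F * (h v + ENNReal.ofReal ε) := by
    intro ε hε
    set t : ℝ := (h v).toReal + ε with ht
    have ht0 : 0 < t := by positivity
    have et : h v + ENNReal.ofReal ε = ENNReal.ofReal t := by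
      rw [ht, ENNReal.ofReal_add ENNReal.toReal_nonneg hε.le, ENNReal.ofReal_toReal hv]
    have hn : ‖((t⁻¹ : ℝ) : ℂ)‖ₑ = (ENNReal.ofReal t)⁻¹ := by
      rw [← ofReal_norm, Complex.norm_real, Real.norm_of_nonneg (by positivity),
        ENNReal.ofReal_inv_of_pos ht0]
    have ht1 : ENNReal.ofReal t ≠ 0 := by simpa using ht0
    have h1 : h (((t⁻¹ : ℝ) : ℂ) • v) ≤ 1 := by
      rw [hh, hn, mul_comm, ← div_eq_mul_inv]
      refine ENNReal.div_le_of_le_mul ?_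
      rw [one_mul, ← et]
      exact le_self_add
    have h2 := H _ h1
    rw [hg, hn, mul_comm, ← div_eq_mul_inv, ENNReal.div_le_iff ht1 ENNReal.ofReal_ne_top] at h2
    rwa [et]
  have hlim : Filter.Tendsto (fun ε : ℝ => F * (h v + ENNReal.ofReal ε)) (nhdsWithin 0 (Set.Ioi 0))
      (nhds (F * (h v + ENNReal.ofReal 0))) := by
    refine Filter.Tendsto.mono_left ?_ nhdsWithin_le_nhds
    exact ENNReal.Tendsto.const_mul (tendsto_const_nhds.add
      (ENNReal.continuous_ofReal.tendsto 0)) (Or.inr hF)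
  rw [ENNReal.ofReal_zero, add_zero] at hlim
  exact ge_of_tendsto hlim (Filter.eventually_of_mem self_mem_nhdsWithin key)

theorem le_of_le_one_imp {V : Type*} [AddCommGroup V] [Module ℂ V] {g h : V → ℝ≥0∞}
    (hg : ∀ (c : ℂ) v, g (c • v) = ‖c‖ₑ * g v) (hh : ∀ (c : ℂ) v, h (c • v) = ‖c‖ₑ * h v)
    (H : ∀ v, h v ≤ 1 → g v ≤ 1) (v : V) : g v ≤ h v := by
  rcases eq_or_ne (h v) ∞ with hv | hv
  · rw [hv]
    exact le_top
  · simpa using le_mul_of_le_one_imp hg hh ENNReal.one_ne_top H hv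

theorem le_one_of_forall_le_mul_self {a : ℝ≥0∞}
    (h : ∀ C : ℝ, 1 < C → a ≤ ENNReal.ofReal C * ENNReal.ofReal C) : a ≤ 1 := by
  refine ENNReal.le_of_forall_pos_le_add fun ε hε _ => ?_
  have hε' : (0 : ℝ) < ε := hε
  refine (h (Real.sqrt (1 + ε)) (by rw [Real.lt_sqrt] <;> linarith)).trans (le_of_eq ?_)
  rw [← ENNReal.ofReal_mul (Real.sqrt_nonneg _), Real.mul_self_sqrt (by positivity),
    ENNReal.ofReal_add one_pos.le hε'.le]
  simp

/-! ### Functionals -/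

section Functional

variable {X : Type*} [AddCommGroup X] [Module ℂ X] {N : MatGauge X}

theorem blk_smul {n k : ℕ} (f : Matrix (Fin k) (Fin k) (X →ₗ[ℂ] ℂ)) (c : ℂ)
    (x : Matrix (Fin n) (Fin n) X) : blk f (c • x) = c • blk f x := by
  ext
  simp [blk]

/-- Since ∞ · 0 = 0, definiteness of N settles the case N n x = 0 with an infinite completely
bounded norm. -/
theorem opNorm_blk_le_mul {n k : ℕ} (hN : ∀ (c : ℂ) x, N n (c • x) = ‖c‖ₑ * N n x)
    (f : Matrix (Fin k) (Fin k) (X →ₗ[ℂ] ℂ)) {x : Matrix (Fin n) (Fin n) X}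
    (h0 : N n x = 0 → x = 0) (ht : N n x ≠ ∞) :
    opNorm (blk f x) ≤ functionalGauge N k f * N n x := by
  by_cases hx : N n x = 0
  · rw [h0 hx]
    have : blk f (0 : Matrix (Fin n) (Fin n) X) = 0 := by ext; simp [blk]
    rw [this, opNorm_zero]
    exact zero_le
  by_cases hF : functionalGauge N k f = ∞
  · rw [hF, ENNReal.top_mul hx]
    exact le_top
  · exact le_mul_of_le_one_imp (g := fun x => opNorm (blk f x)) (h := N n)
      (fun c x => by rw [blk_smul, opNorm_smul]) hN hF (fun x hx => opNorm_blk_le N f x hx) ht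

theorem cbNorm_entry_le {k : ℕ} (f : Matrix (Fin k) (Fin k) (X →ₗ[ℂ] ℂ)) (i j : Fin k) :
    cbNorm N scalarGauge (f i j) ≤ functionalGauge N k f := by
  refine cbNorm_scalar_le_iff.2 fun n x hx => ?_
  exact (opNorm_submatrix_le (blk f x) (Prod.mk_left_injective i)
    (Prod.mk_left_injective j)).trans (opNorm_blk_le N f x hx)

theorem enorm_apply_le_cbNorm {φ : X →ₗ[ℂ] ℂ} {x : X} (hx : norm₁ N x ≤ 1) :
    ‖φ x‖ₑ ≤ cbNorm N scalarGauge φ := by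
  refine le_trans ?_ (opNorm_map_le N φ (Matrix.of fun _ _ : Fin 1 => x) hx)
  have e : (Matrix.of fun _ _ : Fin 1 => x).map φ = φ x • (1 : Matrix (Fin 1) (Fin 1) ℂ) := by
    ext i j
    simp [Subsingleton.elim i j]
  have h1 : (1 : ℝ≥0∞) ≤ opNorm (1 : Matrix (Fin 1) (Fin 1) ℂ) := by
    unfold opNorm
    open scoped Matrix.Norms.L2Operator in
    simp [enorm_eq_nnnorm]
  rw [e, opNorm_smul]
  exact le_mul_of_one_le_right' h1

theorem sum_norm_sq_le_opNorm_row {P : Type*} [Fintype P] [DecidableEq P]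
    (α : Matrix (Fin 1) P ℂ) : ∑ p, ‖α 0 p‖ ^ 2 ≤ (opNorm α).toReal ^ 2 := by
  have h := opNorm_mulVec_le αᴴ 1
  rw [opNorm_conjTranspose] at h
  simpa [Matrix.mulVec, dotProduct] using h

theorem opNorm_row_le_one {P : Type*} [Fintype P] [DecidableEq P] {α : Matrix (Fin 1) P ℂ}
    (h : ∑ p, ‖α 0 p‖ ^ 2 ≤ 1) : opNorm α ≤ 1 := by
  rw [← opNorm_conjTranspose, opNorm_le_iff' _ _ ENNReal.one_ne_top]
  intro v
  have e : ∀ p, ‖(αᴴ *ᵥ v) p‖ ^ 2 = ‖α 0 p‖ ^ 2 * ‖v 0‖ ^ 2 := fun p => by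
    simp [Matrix.mulVec, dotProduct, mul_pow]
  simp only [e, ← Finset.sum_mul]
  simp
  exact mul_le_of_le_one_left (by positivity) h

/-- For functionals, the completely bounded norm is the norm. -/
theorem cbNorm_le_one_of_re_le (hN : RuanGauge N) {φ : X →ₗ[ℂ] ℂ}
    (h : ∀ x, norm₁ N x ≤ 1 → (φ x).re ≤ 1) : cbNorm N scalarGauge φ ≤ 1 := by
  refine cbNorm_scalar_le_iff.2 fun n x hx => (opNorm_le_one_iff _).2 fun ξ η => ?_
  refine le_of_forall_pos_le_add fun δ hδ => ?_
  -- The value φ_n(x) between ξ and η is φ at the compression of x by ξ and η. Normalizing by t with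
  -- t² = ‖ξ‖² + δ allows ξ = 0, and ts ≤ (t² + s²)/2 costs only δ.
  have key : ∀ ξ : Fin n → ℂ, ∃ t : ℝ, 0 < t ∧ t ^ 2 = ∑ i, ‖ξ i‖ ^ 2 + δ ∧
      opNorm (Matrix.of fun (_ : Fin 1) i => ((t⁻¹ : ℝ) : ℂ) * star (ξ i)) ≤ 1 := by
    intro ξ
    have h0 : 0 < ∑ i, ‖ξ i‖ ^ 2 + δ := by positivity
    refine ⟨Real.sqrt (∑ i, ‖ξ i‖ ^ 2 + δ), Real.sqrt_pos.2 h0, Real.sq_sqrt h0.le,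
      opNorm_row_le_one ?_⟩
    simp only [Matrix.of_apply, norm_mul, norm_star, mul_pow, ← Finset.mul_sum, Complex.norm_real,
      Real.norm_eq_abs, sq_abs, inv_pow, Real.sq_sqrt h0.le]
    rw [inv_mul_le_iff₀ h0]
    linarith
  obtain ⟨t, ht, et, hξ⟩ := key ξ
  obtain ⟨s, hs, es, hη⟩ := key η
  rw [← opNorm_conjTranspose] at hη
  have h1 := hN.sandwich_le_one hξ hx hη
  set w := ∑ i, ∑ j, (star (ξ i) * η j) • x i j with hw
  have e : sandwich (Matrix.of fun (_ : Fin 1) i => ((t⁻¹ : ℝ) : ℂ) * star (ξ i)) x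
      (Matrix.of fun (_ : Fin 1) i => ((s⁻¹ : ℝ) : ℂ) * star (η i))ᴴ =
      Matrix.of fun _ _ => (((t * s)⁻¹ : ℝ) : ℂ) • w := by
    ext1 a b
    simp only [sandwich, hw, Matrix.of_apply, Matrix.conjTranspose_apply, Finset.smul_sum,
      smul_smul, star_mul, star_star]
    refine Finset.sum_congr rfl fun i _ => Finset.sum_congr rfl fun j _ => ?_
    congr 1
    simp
    ring
  rw [e] at h1
  have h2 := h _ h1
  rw [map_smul, smul_eq_mul, Complex.re_ofReal_mul, inv_mul_le_iff₀ (by positivity), mul_one] at h2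
  have e2 : star ξ ⬝ᵥ (x.map φ) *ᵥ η = φ w := by
    simp only [hw, map_sum, map_smul, dotProduct, Matrix.mulVec, Matrix.map_apply, Finset.mul_sum,
      Pi.star_apply, smul_eq_mul]
    refine Finset.sum_congr rfl fun i _ => Finset.sum_congr rfl fun j _ => ?_
    ring
  rw [e2]
  nlinarith [sq_nonneg (t - s)]

theorem norm₁_matGauge (hN : RuanGauge N) {d : ℕ} (x : Matrix (Fin d) (Fin d) X) :
    norm₁ (matGauge d N) x = N d x := by
  have e : flatten (Matrix.of fun _ _ : Fin 1 => x) =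
      Matrix.reindex (finCongr (one_mul d).symm) (finCongr (one_mul d).symm) x := by
    ext1 i j
    obtain ⟨⟨a, i⟩, rfl⟩ := finProdFinEquiv.surjective i
    obtain ⟨⟨b, j⟩, rfl⟩ := finProdFinEquiv.surjective j
    have h : ∀ (a : Fin 1) (i : Fin d),
        (finCongr (one_mul d).symm).symm (finProdFinEquiv (a, i)) = i := by
      intro a i
      ext
      simp [Subsingleton.elim a 0]
    simp only [Matrix.reindex_apply, Matrix.submatrix_apply, h, flatten, Equiv.symm_apply_apply]
    rfl
  rw [norm₁, matGauge, e, hN.reindex_eq]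

/-- Placing x at position (i, j) of M_d(X) is multiplying it by scalar contractions on both sides.
This makes the restriction of a functional on M_d(X) to one entry completely bounded. -/
theorem matGauge_single_le (hN : RuanGauge N) {d r : ℕ} (i j : Fin d)
    (x : Matrix (Fin r) (Fin r) X) :
    matGauge d N r (x.map fun e => Matrix.single i j e) ≤ N r x := by
  have V : ∀ i : Fin d, opNorm ((1 : Matrix (Fin r × Fin d) (Fin r × Fin d) ℂ).submatrix id
      fun c => (c, i)) ≤ 1 := fun i =>
    (opNorm_submatrix_le _ Function.injective_id (Prod.mk_left_injective i)).trans opNorm_one_le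
  have e : flatten (x.map fun e => Matrix.single i j e) = sandwich
      (Matrix.reindex finProdFinEquiv (Equiv.refl _)
        ((1 : Matrix (Fin r × Fin d) (Fin r × Fin d) ℂ).submatrix id fun c => (c, i))) x
      (Matrix.reindex finProdFinEquiv (Equiv.refl _)
        ((1 : Matrix (Fin r × Fin d) (Fin r × Fin d) ℂ).submatrix id fun c => (c, j)))ᴴ := by
    ext1 a b
    obtain ⟨⟨a, a'⟩, rfl⟩ := finProdFinEquiv.surjective a
    obtain ⟨⟨b, b'⟩, rfl⟩ := finProdFinEquiv.surjective b
    simp only [flatten, sandwich, Matrix.reindex_apply, Matrix.submatrix_apply, Matrix.of_apply,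
      Matrix.comp_apply, Matrix.map_apply, Matrix.conjTranspose_apply, Equiv.symm_apply_apply,
      Matrix.one_apply, Prod.ext_iff, Matrix.single_apply, Equiv.refl_symm, Equiv.refl_apply, id]
    rcases eq_or_ne a' i with rfl | h1 <;> rcases eq_or_ne b' j with rfl | h2 <;>
      simp [*, Ne.symm, apply_ite (starRingEnd ℂ)]
  unfold matGauge
  rw [e]
  refine (hN.sandwich_le _ _ _ _ _).trans ?_
  rw [opNorm_conjTranspose, opNorm_reindex, opNorm_reindex]
  calc _ ≤ 1 * N r x * 1 := by gcongr <;> exact V _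
    _ = N r x := by simp

end Functional


/-! ### S_n^1(E*) as the dual operator space of M_n(E) -/

section TracePairing

variable {E : Type*} [AddCommGroup E] [Module ℂ E] [OperatorSpace E]

/-- The functional `B ↦ tr(AB)` on `M_n(E)` defined by an `E*`-valued matrix `A`. -/
def trPair (E : Type*) [AddCommGroup E] [Module ℂ E] [OperatorSpace E] (n : ℕ) :
    Matrix (Fin n) (Fin n) (Dual E) →ₗ[ℂ] Matrix (Fin n) (Fin n) E →ₗ[ℂ] ℂ :=
  LinearMap.mk₂ ℂ (fun A B => ∑ i, ∑ j, (A i j).1 (B j i))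
    (by simp [Finset.sum_add_distrib]) (by simp [Finset.mul_sum])
    (by simp [Finset.sum_add_distrib]) (by simp [Finset.mul_sum])

theorem trPair_apply {n : ℕ} (A : Matrix (Fin n) (Fin n) (Dual E)) (B : Matrix (Fin n) (Fin n) E) :
    trPair E n A B = ∑ i, ∑ j, (A i j).1 (B j i) := rfl

theorem trPair_single {n : ℕ} (A : Matrix (Fin n) (Fin n) (Dual E)) (i j : Fin n) (e : E) :
    trPair E n A (Matrix.single j i e) = (A i j).1 e := by
  rw [trPair_apply, Finset.sum_eq_single i, Finset.sum_eq_single j]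
  · simp
  · intro j' _ hj
    simp [hj.symm]
  · simp
  · intro i' _ hi
    simp [hi.symm]
  · simp

theorem trPair_injective (n : ℕ) : Function.Injective (trPair E n) := by
  intro A A' h
  ext i j e
  rw [← trPair_single A, h, trPair_single]

theorem cbNorm_comp_single_le {n : ℕ} (ψ : Matrix (Fin n) (Fin n) E →ₗ[ℂ] ℂ) (i j : Fin n) :
    cbNorm OperatorSpace.mnorm scalarGauge (ψ ∘ₗ Matrix.singleLinearMap ℂ i j) ≤
      cbNorm (matGauge n OperatorSpace.mnorm) scalarGauge ψ := by
  refine cbNorm_scalar_le_iff.2 fun r x hx => ?_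
  exact opNorm_map_le _ ψ (x.map fun e => Matrix.single i j e)
    ((matGauge_single_le ruanGauge_mnorm i j x).trans hx)

/-- Every completely bounded functional on `M_n(E)` is given by the trace pairing. -/
theorem exists_trPair_eq {n : ℕ} (ψ : Matrix (Fin n) (Fin n) E →ₗ[ℂ] ℂ)
    (hψ : cbNorm (matGauge n OperatorSpace.mnorm) scalarGauge ψ ≠ ∞) :
    ∃ A, trPair E n A = ψ := by
  refine ⟨Matrix.of fun i j => ⟨ψ ∘ₗ Matrix.singleLinearMap ℂ j i,
    ne_top_of_le_ne_top hψ (cbNorm_comp_single_le ψ j i)⟩, ?_⟩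
  ext B
  conv_rhs => rw [Matrix.matrix_eq_sum_single B]
  rw [trPair_apply, Finset.sum_comm]
  simp

/-- The crude bound by the sum of the norms of the entries suffices: only finiteness matters. -/
theorem cbNorm_trPair_ne_top {n : ℕ} (A : Matrix (Fin n) (Fin n) (Dual E)) :
    cbNorm (matGauge n OperatorSpace.mnorm) scalarGauge (trPair E n A) ≠ ∞ := by
  have h : cbNorm (matGauge n OperatorSpace.mnorm) scalarGauge (trPair E n A) ≤
      ∑ i, ∑ j, cbNorm OperatorSpace.mnorm scalarGauge (A i j).1 := by
    refine cbNorm_scalar_le_iff.2 fun r x hx => ?_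
    have s : ∀ {ι : Type} (t : Finset ι) (A : ι → Matrix (Fin r) (Fin r) ℂ),
        opNorm (∑ i ∈ t, A i) ≤ ∑ i ∈ t, opNorm (A i) := fun t A =>
      Finset.le_sum_of_subadditive _ opNorm_zero.le opNorm_add_le _ _
    have e : x.map (trPair E n A) = ∑ i, ∑ j, (x.map fun B => B j i).map (A i j).1 := by
      ext a b
      simp [Matrix.sum_apply, trPair_apply]
    rw [e]
    refine (s _ _).trans (Finset.sum_le_sum fun i _ => (s _ _).trans
      (Finset.sum_le_sum fun j _ => opNorm_map_le _ _ _ (le_trans ?_ hx)))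
    have e2 : (x.map fun B => B j i) = (flatten x).submatrix (fun c => finProdFinEquiv (c, j))
        (fun c => finProdFinEquiv (c, i)) := by
      ext a b
      simp [flatten, -finProdFinEquiv_apply_val]
    rw [e2]
    exact ruanGauge_mnorm.submatrix_le _
      (finProdFinEquiv.injective.comp (Prod.mk_left_injective j))
      (finProdFinEquiv.injective.comp (Prod.mk_left_injective i))
  refine ne_top_of_le_ne_top ?_ h
  simp only [ne_eq, ENNReal.sum_eq_top, Finset.mem_univ, true_and, not_exists]
  exact fun i j => (A i j).2

/-- The trace pairing on `M_n ⊗ E*`. -/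
def tensorTrPair (E : Type*) [AddCommGroup E] [Module ℂ E] [OperatorSpace E] (n : ℕ) :
    Matrix (Fin n) (Fin n) ℂ ⊗[ℂ] Dual E →ₗ[ℂ] Matrix (Fin n) (Fin n) E →ₗ[ℂ] ℂ :=
  TensorProduct.lift <| LinearMap.mk₂ ℂ
    (fun a φ => trPair E n (Matrix.of fun i j => a i j • φ))
    (fun _ _ _ => by rw [← map_add]; congr 1; ext; simp [add_mul])
    (fun _ _ _ => by rw [← map_smul]; congr 1; ext; simp [mul_assoc])
    (fun _ _ _ => by rw [← map_add]; congr 1; ext; simp)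
    (fun _ _ _ => by rw [← map_smul]; congr 1; ext; simp [mul_left_comm])

theorem tensorTrPair_tmul {n : ℕ} (a : Matrix (Fin n) (Fin n) ℂ) (φ : Dual E)
    (B : Matrix (Fin n) (Fin n) E) :
    tensorTrPair E n (a ⊗ₜ φ) B = ∑ i, ∑ j, a i j * φ.1 (B j i) := by
  simp [tensorTrPair, trPair_apply]

theorem tensorTrPair_matTensor {n : ℕ} (A : Matrix (Fin n) (Fin n) (Dual E)) :
    tensorTrPair E n (matTensor n A) = trPair E n A := by
  ext B
  simp [matTensor, tensorTrPair_tmul, trPair_apply, Matrix.single_apply, ite_and]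

theorem matTensor_single {n : ℕ} (i j : Fin n) (φ : Dual E) :
    matTensor n (Matrix.single i j φ) = Matrix.single i j (1 : ℂ) ⊗ₜ[ℂ] φ := by
  change ∑ i', ∑ j', Matrix.single i' j' (1 : ℂ) ⊗ₜ[ℂ] Matrix.single i j φ i' j' = _
  rw [Finset.sum_eq_single i, Finset.sum_eq_single j]
  · simp
  · intro j' _ hj
    simp [hj.symm]
  · simp
  · intro i' _ hi
    simp [hi.symm]
  · simp

/-- For x = α (y ⊗ f) β and z in the unit ball, apply first f to the entries of z and then y to the
result. The two steps cost ‖f‖ and ‖y‖, and the outer multiplications by 1 ⊗ α and 1 ⊗ β cost ‖α‖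
and ‖β‖. -/
theorem functionalGauge_trPair_le {n k : ℕ}
    (x : Matrix (Fin k) (Fin k) (Matrix (Fin n) (Fin n) (Dual E))) :
    functionalGauge (matGauge n OperatorSpace.mnorm) k (x.map (trPair E n)) ≤
      schattenOneGauge n OperatorSpace.mnorm k x := by
  unfold schattenOneGauge projGauge
  refine le_iInf fun p => le_iInf fun q => le_iInf fun y => le_iInf fun f => le_iInf fun α =>
    le_iInf fun β => le_iInf fun h => functionalGauge_le_iff.2 fun r z hz => ?_
  set Z : Matrix (Fin r × Fin q) (Fin r × Fin q) (Matrix (Fin n) (Fin n) ℂ) :=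
    Matrix.of fun a b => Matrix.of fun i j => (f a.2 b.2).1 (z a.1 b.1 i j) with hZ
  set Z' : Matrix (Fin (r * q)) (Fin (r * q)) (Matrix (Fin n) (Fin n) ℂ) :=
    Matrix.reindex finProdFinEquiv finProdFinEquiv Z with hZ'
  have hZn : matGauge n scalarGauge (r * q) Z' ≤ OperatorSpace.mnorm q f := by
    -- Up to a permutation of the indices, flattening Z' amounts to applying f to the flattened z,
    -- so the complete norm of f controls it.
    have e : flatten Z' = Matrix.reindex
        ((finProdFinEquiv.symm.prodCongr (Equiv.refl (Fin q))).trans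
          (((Equiv.prodAssoc _ _ _).trans ((Equiv.refl _).prodCongr (Equiv.prodComm _ _))).trans
          ((Equiv.prodAssoc _ _ _).symm.trans
          ((finProdFinEquiv.prodCongr (Equiv.refl (Fin n))).trans finProdFinEquiv))))
        ((finProdFinEquiv.symm.prodCongr (Equiv.refl (Fin q))).trans
          (((Equiv.prodAssoc _ _ _).trans ((Equiv.refl _).prodCongr (Equiv.prodComm _ _))).trans
          ((Equiv.prodAssoc _ _ _).symm.trans
          ((finProdFinEquiv.prodCongr (Equiv.refl (Fin n))).trans finProdFinEquiv))))
        (blk (f.map fun φ => (φ : E →ₗ[ℂ] ℂ)) (flatten z)) := by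
      ext1 a b
      obtain ⟨⟨a, a'⟩, rfl⟩ := finProdFinEquiv.surjective a
      obtain ⟨⟨a, a''⟩, rfl⟩ := finProdFinEquiv.surjective a
      obtain ⟨⟨b, b'⟩, rfl⟩ := finProdFinEquiv.surjective b
      obtain ⟨⟨b, b''⟩, rfl⟩ := finProdFinEquiv.surjective b
      simp [flatten, hZ', hZ, blk, -finProdFinEquiv_apply_val, -finProdFinEquiv_symm_apply]
    unfold matGauge scalarGauge
    rw [e, opNorm_reindex]
    exact opNorm_blk_le OperatorSpace.mnorm _ (flatten z) hz
  have hB : opNorm (blk (y.map traceFunctional) Z') ≤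
      traceClassGauge n p y * matGauge n scalarGauge (r * q) Z' := by
    have hflat : ∀ (c : ℂ) (w : Matrix (Fin (r * q)) (Fin (r * q)) (Matrix (Fin n) (Fin n) ℂ)),
      flatten (c • w) = c • flatten w := fun c w => rfl
    refine opNorm_blk_le_mul (fun c w => ?_) _ (fun h => ?_) (opNorm_ne_top _)
    · unfold matGauge scalarGauge
      rw [hflat, opNorm_smul]
    · have h1 := opNorm_eq_zero.1 h
      ext a b i j
      have h2 := congrFun (congrFun h1 (finProdFinEquiv (a, i))) (finProdFinEquiv (b, j))
      simpa [flatten, -finProdFinEquiv_apply_val, -finProdFinEquiv_symm_apply] using h2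
  set e : Fin (r * q) × Fin p ≃ Fin r × (Fin p × Fin q) :=
    (finProdFinEquiv.symm.prodCongr (Equiv.refl (Fin p))).trans
      ((Equiv.prodAssoc _ _ _).trans ((Equiv.refl _).prodCongr (Equiv.prodComm _ _))) with he
  have hx : blk (x.map (trPair E n)) z = ampl (Fin r) α *
      Matrix.reindex e e (blk (y.map traceFunctional) Z') * ampl (Fin r) β := by
    have e1 : ∀ a b, trPair E n (x a b) = ∑ s, ∑ t, (α a s * β t b) •
        tensorTrPair E n (y s.1 t.1 ⊗ₜ[ℂ] f s.2 t.2) := by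
      intro a b
      have := congrArg (tensorTrPair E n) (congrFun (congrFun h a) b)
      rw [Matrix.map_apply, tensorTrPair_matTensor] at this
      rw [this]
      simp only [sandwich, Matrix.of_apply, map_sum, map_smul]
    have e2 : ∀ (c d : Fin r) (s t : Fin p × Fin q),
        Matrix.reindex e e (blk (y.map traceFunctional) Z') (c, s) (d, t) =
          tensorTrPair E n (y s.1 t.1 ⊗ₜ[ℂ] f s.2 t.2) (z c d) := by
      intro c d s t
      simp [blk, he, hZ', hZ, tensorTrPair_tmul, traceFunctional, Matrix.trace, Matrix.mul_apply,
        -finProdFinEquiv_apply_val, -finProdFinEquiv_symm_apply]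
    ext ⟨c, a⟩ ⟨d, b⟩
    simp only [Matrix.mul_apply, Fintype.sum_prod_type (α₁ := Fin r), e2]
    simp only [blk, Matrix.of_apply, Matrix.map_apply, e1, ampl, LinearMap.sum_apply,
      LinearMap.smul_apply, smul_eq_mul, ite_mul, zero_mul, mul_ite, mul_zero,
      Finset.sum_ite_irrel, Finset.sum_const_zero, Finset.sum_ite_eq, Finset.sum_ite_eq',
      Finset.mem_univ, if_true, Finset.sum_mul]
    rw [Finset.sum_comm]
    refine Finset.sum_congr rfl fun s _ => Finset.sum_congr rfl fun t _ => ?_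
    ring
  rw [hx]
  refine (opNorm_mul_le _ _).trans (mul_le_mul' ((opNorm_mul_le _ _).trans ?_)
    (opNorm_ampl_le β))
  rw [mul_assoc, opNorm_reindex]
  exact mul_le_mul' (opNorm_ampl_le α) (hB.trans (mul_le_mul' le_rfl hZn))

/-- Since tr(e_ji b) = b_ij, this matrix of functionals is the identity map of M_n. -/
theorem traceClassGauge_single_le (n : ℕ) :
    traceClassGauge n n (Matrix.of fun i j => Matrix.single j i 1) ≤ 1 := by
  refine functionalGauge_le_iff.2 fun r z hz => le_trans (le_of_eq ?_) hz
  unfold matGauge scalarGauge flatten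
  rw [opNorm_reindex]
  congr 1
  ext ⟨c, i⟩ ⟨d, j⟩
  simp [blk, traceFunctional, Matrix.trace, Matrix.mul_apply, Matrix.single_apply, ite_and]

/-- The factorization theorem expresses x as α (y ⊗ F) β, with y = (e_ji) of norm at most 1 in
M_n(S_n^1) and F in the unit ball of M_{kn}(E*). This is an admissible factorization for the
projective norm, of cost at most C². -/
theorem schattenOneGauge_le_one {n k : ℕ}
    (x : Matrix (Fin k) (Fin k) (Matrix (Fin n) (Fin n) (Dual E)))
    (hx : functionalGauge (matGauge n OperatorSpace.mnorm) k (x.map (trPair E n)) ≤ 1) :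
    schattenOneGauge n OperatorSpace.mnorm k x ≤ 1 := by
  refine le_one_of_forall_le_mul_self fun C hC => ?_
  obtain ⟨f, α, β, hf, hα, hβ, h⟩ := exists_factorization ruanGauge_mnorm _ hx hC
  set F : Matrix (Fin (k * n)) (Fin (k * n)) (Dual E) := Matrix.of fun i j => ⟨f i j,
    ne_top_of_le_ne_top ENNReal.one_ne_top ((cbNorm_entry_le f i j).trans hf)⟩ with hF
  refine (projGauge_le _ _ (Matrix.of fun i j => Matrix.single j i 1) F α β ?_).trans ?_
  · ext1 a b
    have e : x a b = ∑ r, ∑ s, (α a r * β s b) • Matrix.single s.1 r.1 (F r.2 s.2) := by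
      ext i j e
      have h1 := h a b (Matrix.single j i e)
      rw [Matrix.map_apply, trPair_single] at h1
      rw [h1]
      simp only [Matrix.sum_apply, Matrix.smul_apply, Submodule.coe_sum, Submodule.coe_smul,
        LinearMap.sum_apply, LinearMap.smul_apply, smul_eq_mul]
      refine Finset.sum_congr rfl fun r _ => Finset.sum_congr rfl fun s _ => ?_
      rw [Matrix.single_apply, Matrix.single_apply]
      by_cases h1 : i = s.1 <;> by_cases h2 : j = r.1 <;> simp [Ne.symm, *]
    rw [Matrix.map_apply, e]
    simp [map_sum, matTensor_single, sandwich, kron]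
  · calc _ ≤ ENNReal.ofReal C * 1 * 1 * ENNReal.ofReal C := by
          gcongr
          · exact traceClassGauge_single_le n
          · exact hf
      _ = _ := by simp

theorem schattenOneGauge_smul {F : Type*} [AddCommGroup F] [Module ℂ F] [OperatorSpace F] {n k : ℕ}
    (c : ℂ) (x : Matrix (Fin k) (Fin k) (Matrix (Fin n) (Fin n) F)) :
    schattenOneGauge n OperatorSpace.mnorm k (c • x) =
      ‖c‖ₑ * schattenOneGauge n OperatorSpace.mnorm k x := by
  generalize hg : schattenOneGauge n (OperatorSpace.mnorm (E := F)) k = g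
  have h : ∀ (c : ℂ) v, g (c • v) ≤ ‖c‖ₑ * g v := by
    intro c v
    rw [← hg]
    exact schattenOne_smul_le n k c v
  exact smul_eq_of_smul_le g h c x

theorem functionalGauge_trPair_smul {n k : ℕ} (c : ℂ)
    (x : Matrix (Fin k) (Fin k) (Matrix (Fin n) (Fin n) (Dual E))) :
    functionalGauge (matGauge n OperatorSpace.mnorm) k ((c • x).map (trPair E n)) =
      ‖c‖ₑ * functionalGauge (matGauge n OperatorSpace.mnorm) k (x.map (trPair E n)) := by
  rw [← functionalGauge_smul]
  congr 1
  ext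
  simp

/-- `S_n^1(E*)` is the dual operator space of `S_n^∞(E)` under the trace pairing. -/
theorem schattenOneGauge_eq {n k : ℕ}
    (x : Matrix (Fin k) (Fin k) (Matrix (Fin n) (Fin n) (Dual E))) :
    schattenOneGauge n OperatorSpace.mnorm k x =
      functionalGauge (matGauge n OperatorSpace.mnorm) k (x.map (trPair E n)) := by
  refine le_antisymm ?_ (functionalGauge_trPair_le x)
  have h1 := schattenOneGauge_smul (F := Dual E) (n := n) (k := k)
  have h2 := schattenOneGauge_le_one (E := E) (n := n) (k := k)
  have h3 := functionalGauge_trPair_smul (E := E) (n := n) (k := k)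
  generalize schattenOneGauge n (OperatorSpace.mnorm (E := Dual E)) k = g at h1 h2 ⊢
  generalize hh : (fun x : Matrix (Fin k) (Fin k) (Matrix (Fin n) (Fin n) (Dual E)) =>
    functionalGauge (matGauge n (OperatorSpace.mnorm (E := E))) k (x.map (trPair E n))) = h
  have e : ∀ x, functionalGauge (matGauge n (OperatorSpace.mnorm (E := E))) k
    (x.map (trPair E n)) = h x := fun x => congrFun hh x
  simp only [e] at h2 h3 ⊢
  exact le_of_le_one_imp h1 h3 h2 x

theorem norm₁_schattenOneGauge {n : ℕ} (A : Matrix (Fin n) (Fin n) (Dual E)) :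
    norm₁ (schattenOneGauge n OperatorSpace.mnorm) A =
      cbNorm (matGauge n OperatorSpace.mnorm) scalarGauge (trPair E n A) := by
  rw [← norm₁_functionalGauge, norm₁, schattenOneGauge_eq]
  rfl

end TracePairing


/-! ### Approximating complete contractions on S_n^1(E*) by elements of M_m(M_n(E)) -/

section Goldstine

variable {E : Type*} [AddCommGroup E] [Module ℂ E] [OperatorSpace E]

theorem le_cbNorm {X Y : Type*} [AddCommGroup X] [Module ℂ X] [AddCommGroup Y] [Module ℂ Y]
    {N : MatGauge X} {N' : MatGauge Y} (u : X →ₗ[ℂ] Y) {k : ℕ} {x : Matrix (Fin k) (Fin k) X}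
    (hx : N k x ≤ 1) : N' k (x.map u) ≤ cbNorm N N' u :=
  le_iSup_of_le k <| le_iSup_of_le x <| le_iSup_of_le hx le_rfl

/-- The trace pairing of an element of the unit ball of the predual of `M_m(S_n^1(E*))` with a
completely contractive map on `S_n^1(E*)` is at most `1`. -/
theorem re_sum_apply_le_one {n m : ℕ}
    (u : Matrix (Fin n) (Fin n) (Dual E) →ₗ[ℂ] Matrix (Fin m) (Fin m) ℂ)
    (hu : cbNorm (schattenOneGauge n OperatorSpace.mnorm) (matGauge m scalarGauge) u ≤ 1)
    (y : Matrix (Fin m) (Fin m) (Matrix (Fin n) (Fin n) (Dual E)))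
    (hy : ∀ b : Matrix (Fin m) (Fin m) (Matrix (Fin n) (Fin n) E),
      matGauge n OperatorSpace.mnorm m b ≤ 1 → (∑ c, ∑ d, trPair E n (y c d) (b c d)).re ≤ 1) :
    (∑ c, ∑ d, u (y c d) c d).re ≤ 1 := by
  have hR : RuanGauge (matGauge n (OperatorSpace.mnorm (E := E))) := ruanGauge_mnorm.matGauge n
  set φ : Matrix (Fin m) (Fin m) (Matrix (Fin n) (Fin n) E) →ₗ[ℂ] ℂ :=
    matPair (y.map (trPair E n)) with hφ
  have hφ1 : functionalGauge (matGauge m (matGauge n OperatorSpace.mnorm)) 1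
      (Matrix.of fun _ _ => φ) ≤ 1 := by
    have h := cbNorm_le_one_of_re_le (hR.matGauge m) (φ := φ) fun b hb => by
      rw [norm₁_matGauge hR] at hb
      exact hy b hb
    rwa [← norm₁_functionalGauge] at h
  refine le_of_forall_pos_le_add fun ε hε => ?_
  -- The pairing with y is a contractive functional on M_m(M_n(E)), hence completely contractive. It
  -- is factored as a map into M_1 with coefficient space M_n(E), so α is a row and β a column.
  obtain ⟨f, α, β, hf, hα, hβ, h⟩ := exists_factorization hR _ hφ1
    (C := Real.sqrt (1 + ε)) (by rw [Real.lt_sqrt] <;> linarith)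
  have hF : ∀ p q, ∃ A, trPair E n A = f p q := fun p q => exists_trPair_eq _
    (ne_top_of_le_ne_top ENNReal.one_ne_top ((cbNorm_entry_le f p q).trans hf))
  choose F hF using hF
  -- The identification of S_n^1(E*) as a dual puts F in the unit ball of M_m(S_n^1(E*)), where the
  -- hypothesis on u applies.
  have hF1 : schattenOneGauge n OperatorSpace.mnorm (1 * m) (Matrix.of F) ≤ 1 := by
    rw [schattenOneGauge_eq]
    refine le_trans (le_of_eq ?_) hf
    congr 1
    ext1 p q
    exact hF p q
  have hG : matGauge m scalarGauge (1 * m) ((Matrix.of F).map u) ≤ 1 :=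
    (le_cbNorm u hF1).trans hu
  unfold matGauge scalarGauge flatten at hG
  rw [opNorm_reindex, opNorm_le_one_iff] at hG
  -- Evaluating the factorization on matrices supported at the single entry (c, d) recovers y from
  -- F.
  have hy' : ∀ c d, y c d = ∑ p, ∑ q, (α 0 (c, p) * β (d, q) 0) • F p q := by
    intro c d
    apply trPair_injective
    ext B
    have h1 := h 0 0 (Matrix.single c d B)
    rw [Matrix.of_apply, hφ, matPair] at h1
    simp only [LinearMap.coe_mk, AddHom.coe_mk, Fintype.sum_prod_type] at h1
    rw [Finset.sum_eq_single c, Finset.sum_eq_single d, Matrix.single_apply_same,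
      Finset.sum_eq_single c] at h1
    · rw [Matrix.map_apply] at h1
      rw [h1]
      simp only [map_sum, map_smul, LinearMap.sum_apply, LinearMap.smul_apply, hF, smul_eq_mul]
      refine Finset.sum_congr rfl fun p _ => ?_
      rw [Finset.sum_eq_single d]
      · simp
      · intro d' _ hd
        simp [hd.symm]
      · simp
    · intro c' _ hc
      simp [hc.symm]
    · simp
    · intro d' _ hd
      simp [hd.symm]
    · simp
    · intro c' _ hc
      simp [hc.symm]
    · simp
  -- The pairing of u with y is the matrix u(F) tested between the vectors α and β, of squared norm
  -- at most 1 + ε.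
  have h2 := hG (fun a => star (α 0 (a.2, a.1))) (fun b => β (b.2, b.1) 0)
  have e : ∑ c, ∑ d, u (y c d) c d = (star fun a : Fin (1 * m) × Fin m => star (α 0 (a.2, a.1))) ⬝ᵥ
      (Matrix.comp _ _ _ _ _ ((Matrix.of F).map u)) *ᵥ fun b => β (b.2, b.1) 0 := by
    simp only [hy', map_sum, map_smul, Matrix.sum_apply, Matrix.smul_apply, dotProduct,
      Matrix.mulVec, Pi.star_apply, star_star, Matrix.comp_apply, Matrix.map_apply,
      Matrix.of_apply, Fintype.sum_prod_type, Finset.mul_sum, smul_eq_mul]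
    have e := Fintype.sum_equiv
      (⟨fun x => (x.2.2.1, x.1, x.2.2.2, x.2.1), fun x => (x.2.1, x.2.2.2, x.1, x.2.2.1),
        fun _ => rfl, fun _ => rfl⟩ : Fin m × Fin m × Fin (1 * m) × Fin (1 * m) ≃
        Fin (1 * m) × Fin m × Fin (1 * m) × Fin m)
      (fun (c, d, p, q) => α 0 (c, p) * β (d, q) 0 * u (F p q) c d)
      (fun (p, c, q, d) => α 0 (c, p) * (u (F p q) c d * β (d, q) 0))
      fun _ => by simp only [Equiv.coe_fn_mk]; ring
    simpa only [Fintype.sum_prod_type] using e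
  have hsq : ∀ {P : Type} [Fintype P] [DecidableEq P] (γ : Matrix (Fin 1) P ℂ),
      opNorm γ ≤ ENNReal.ofReal (Real.sqrt (1 + ε)) → ∑ p, ‖γ 0 p‖ ^ 2 ≤ 1 + ε := by
    intro P _ _ γ hγ
    refine (sum_norm_sq_le_opNorm_row γ).trans ?_
    rw [← Real.le_sqrt ENNReal.toReal_nonneg (by positivity)]
    exact ENNReal.toReal_le_of_le_ofReal (Real.sqrt_nonneg _) hγ
  have hα1 := hsq α hα
  have hβ1 := hsq βᴴ ((opNorm_conjTranspose β).trans_le hβ)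
  rw [e]
  refine h2.trans ?_
  simp only [Fintype.sum_prod_type, Matrix.conjTranspose_apply, norm_star] at hα1 hβ1 ⊢
  rw [Finset.sum_comm] at hα1 hβ1
  linarith

/-- The unit ball of `M_m(S_n^∞(E))` is point-weakly dense in the set of complete contractions
`S_n^1(E*) → M_m`. -/
theorem exists_trPair_approx {n m : ℕ} {J : Type*} [Fintype J]
    (u : Matrix (Fin n) (Fin n) (Dual E) →ₗ[ℂ] Matrix (Fin m) (Fin m) ℂ)
    (hu : cbNorm (schattenOneGauge n OperatorSpace.mnorm) (matGauge m scalarGauge) u ≤ 1)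
    (x : J → Matrix (Fin n) (Fin n) (Dual E)) {δ : ℝ} (hδ : 0 < δ) :
    ∃ b : Matrix (Fin m) (Fin m) (Matrix (Fin n) (Fin n) E),
      matGauge n OperatorSpace.mnorm m b ≤ 1 ∧
      ∀ j c d, ‖u (x j) c d - trPair E n (x j) (b c d)‖ < δ := by
  classical
  have hR : RuanGauge (matGauge n (OperatorSpace.mnorm (E := E))) := ruanGauge_mnorm.matGauge n
  set L : Matrix (Fin m) (Fin m) (Matrix (Fin n) (Fin n) E) → (J × Fin m × Fin m → ℂ) :=
    fun b t => trPair E n (x t.1) (b t.2.1 t.2.2) with hL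
  set K : Set (J × Fin m × Fin m → ℂ) := L '' {b | matGauge n OperatorSpace.mnorm m b ≤ 1} with hK
  set p : J × Fin m × Fin m → ℂ := fun t => u (x t.1) t.2.1 t.2.2 with hp
  by_cases hmem : p ∈ closure K
  · obtain ⟨_, ⟨b, hb, rfl⟩, hd⟩ := Metric.mem_closure_iff.1 hmem δ hδ
    refine ⟨b, hb, fun j c d => ?_⟩
    rw [← dist_eq_norm]
    exact (dist_le_pi_dist p (L b) (j, c, d)).trans_lt hd
  exfalso
  have hconv : Convex ℝ K := by
    rintro _ ⟨b, hb, rfl⟩ _ ⟨b', hb', rfl⟩ s t hs ht hst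
    refine ⟨(s : ℂ) • b + (t : ℂ) • b', hR.convex_le_one hb hb' hs ht hst, ?_⟩
    ext r
    simp [hL]
  -- If the values of u lay outside the closed convex set of trace pairings, a functional would
  -- separate them in ℂ^(J × m × m). Since 0 belongs to that set, the level s is positive.
  obtain ⟨f, s, hfs, hsf⟩ := RCLike.geometric_hahn_banach_closed_point (𝕜 := ℂ) hconv.closure
    isClosed_closure hmem
  have h0 : L 0 ∈ closure K := subset_closure ⟨0, (hR.zero m).trans_le zero_le, rfl⟩
  have hL0 : L 0 = 0 := by
    ext t
    simp [hL]
  have hs : 0 < s := by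
    have := hfs _ h0
    rwa [hL0, map_zero, map_zero] at this
  have hf : ∀ v, f v = ∑ t, v t * f (Pi.single t 1) := by
    intro v
    have := LinearMap.pi_apply_eq_sum_univ f.toLinearMap v
    have e : ∀ t : J × Fin m × Fin m,
        (Pi.single t 1 : J × Fin m × Fin m → ℂ) = fun j => if t = j then 1 else 0 := by
      intro t
      ext j
      simp [Pi.single_apply, eq_comm]
    simp only [e]
    exact this
  -- The separating functional, divided by s, is the pairing with this y. It is at most 1 on the
  -- unit ball, so `re_sum_apply_le_one` bounds it by 1 at u too, contradicting separation.
  set y : Matrix (Fin m) (Fin m) (Matrix (Fin n) (Fin n) (Dual E)) := Matrix.of fun c d =>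
    ((s⁻¹ : ℝ) : ℂ) • ∑ j, f (Pi.single (j, c, d) 1) • x j with hy
  have key : ∀ g : Fin m → Fin m → Matrix (Fin n) (Fin n) (Dual E) →ₗ[ℂ] ℂ,
      (∑ c, ∑ d, g c d (y c d)).re = s⁻¹ * (f fun t => g t.2.1 t.2.2 (x t.1)).re := by
    intro g
    rw [hf]
    simp only [hy, Matrix.of_apply, map_smul, map_sum, smul_eq_mul, ← Finset.mul_sum,
      Complex.re_ofReal_mul]
    congr 2
    simp only [Fintype.sum_prod_type]
    rw [Finset.sum_comm (s := (Finset.univ : Finset J))]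
    refine Finset.sum_congr rfl fun c _ => ?_
    rw [Finset.sum_comm]
    exact Finset.sum_congr rfl fun d _ => Finset.sum_congr rfl fun j _ => mul_comm _ _
  have h1 := re_sum_apply_le_one u hu y fun b hb => by
    refine (key fun c d => (trPair E n).flip (b c d)).trans_le ?_
    rw [inv_mul_le_iff₀ hs, mul_one]
    exact (hfs _ (subset_closure ⟨b, hb, rfl⟩)).le
  have h2 := key fun c d => (Matrix.entryLinearMap ℂ ℂ c d) ∘ₗ u
  have h3 : (∑ c, ∑ d, u (y c d) c d).re = s⁻¹ * (f p).re := h2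
  rw [h3, inv_mul_le_iff₀ hs, mul_one] at h1
  exact absurd hsf (not_lt.2 h1)

end Goldstine


/-! ### Norm estimates for the trace pairing -/

/-- Closed balls are closed under entrywise limits, which allows truncating series and approximating
entry by entry. -/
theorem opNorm_le_of_forall_approx {m n : Type*} [Fintype m] [Fintype n] [DecidableEq m]
    [DecidableEq n] {A : Matrix m n ℂ} {C : ℝ≥0∞}
    (h : ∀ δ : ℝ, 0 < δ → ∃ B : Matrix m n ℂ, opNorm B ≤ C ∧ ∀ i j, ‖A i j - B i j‖ < δ) :
    opNorm A ≤ C := by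
  choose B hB hd using fun k : ℕ => h (1 / (k + 1)) (by positivity)
  have ht : Filter.Tendsto B Filter.atTop (nhds A) := by
    refine tendsto_pi_nhds.2 fun i => tendsto_pi_nhds.2 fun j => ?_
    rw [tendsto_iff_norm_sub_tendsto_zero]
    refine squeeze_zero (fun _ => norm_nonneg _) (fun k => ?_)
      (tendsto_one_div_add_atTop_nhds_zero_nat (𝕜 := ℝ))
    rw [norm_sub_rev]
    exact (hd k i j).le
  exact le_of_tendsto' (tendsto_opNorm ht) hB

theorem cbNorm_smul {X : Type*} [AddCommGroup X] [Module ℂ X] (N : MatGauge X) (c : ℂ)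
    (φ : X →ₗ[ℂ] ℂ) : cbNorm N scalarGauge (c • φ) = ‖c‖ₑ * cbNorm N scalarGauge φ := by
  rw [← norm₁_functionalGauge, ← norm₁_functionalGauge, norm₁, norm₁, ← functionalGauge_smul]
  rfl

section TracePairingNorm

variable {E : Type*} [AddCommGroup E] [Module ℂ E] [OperatorSpace E] {n : ℕ}

theorem enorm_trPair_le (A : Matrix (Fin n) (Fin n) (Dual E)) (B : Matrix (Fin n) (Fin n) E) :
    ‖trPair E n A B‖ₑ ≤
      cbNorm (matGauge n OperatorSpace.mnorm) scalarGauge (trPair E n A) *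
        OperatorSpace.mnorm n B := by
  refine le_mul_of_le_one_imp (g := fun B => ‖trPair E n A B‖ₑ) (h := OperatorSpace.mnorm n)
    (fun c B => by rw [map_smul, smul_eq_mul, enorm_mul]) (OperatorSpace.mnorm_smul n)
    (cbNorm_trPair_ne_top A) (fun B hB => ?_) (OperatorSpace.mnorm_ne_top n B)
  refine enorm_apply_le_cbNorm ?_
  rwa [norm₁_matGauge ruanGauge_mnorm]

/-- An element of the unit ball of `M_r(M_n(E))` defines a complete contraction
`S_n^1(E*) → M_r`. -/
theorem functionalGauge_flip_trPair_le {r : ℕ}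
    {z : Matrix (Fin r) (Fin r) (Matrix (Fin n) (Fin n) E)}
    (hz : matGauge n OperatorSpace.mnorm r z ≤ 1) :
    functionalGauge (schattenOneGauge n OperatorSpace.mnorm) r (z.map (trPair E n).flip) ≤ 1 := by
  refine functionalGauge_le_iff.2 fun k y hy => ?_
  rw [schattenOneGauge_eq] at hy
  refine le_trans (le_of_eq ?_) ((opNorm_blk_le _ (y.map (trPair E n)) z hz).trans hy)
  rw [← opNorm_reindex _ (Equiv.prodComm _ _) (Equiv.prodComm _ _)]
  rfl

/-- An entry of u is a contractive functional. The bound gives absolute convergence of ∑ d_π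
u_π(A^π) for A in L^1. -/
theorem enorm_apply_le_cbNorm_trPair {m : ℕ}
    {u : Matrix (Fin n) (Fin n) (Dual E) →ₗ[ℂ] Matrix (Fin m) (Fin m) ℂ}
    (hu : cbNorm (schattenOneGauge n OperatorSpace.mnorm) (matGauge m scalarGauge) u ≤ 1)
    (A : Matrix (Fin n) (Fin n) (Dual E)) (c d : Fin m) :
    ‖u A c d‖ₑ ≤ cbNorm (matGauge n OperatorSpace.mnorm) scalarGauge (trPair E n A) := by
  set f : Matrix (Fin m) (Fin m) (Matrix (Fin n) (Fin n) (Dual E) →ₗ[ℂ] ℂ) :=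
    Matrix.of fun c d => Matrix.entryLinearMap ℂ ℂ c d ∘ₗ u with hf
  have e : matrixMap f = u := by
    ext A c d
    rfl
  have h : cbNorm (schattenOneGauge n OperatorSpace.mnorm) scalarGauge (f c d) ≤ 1 := by
    refine (cbNorm_entry_le f c d).trans ?_
    unfold functionalGauge
    rwa [e]
  refine le_of_le_one_imp (g := fun A => ‖u A c d‖ₑ)
    (h := fun A => cbNorm (matGauge n OperatorSpace.mnorm) scalarGauge (trPair E n A))
    (fun c A => by rw [map_smul, Matrix.smul_apply, smul_eq_mul, enorm_mul])
    (fun c A => by rw [map_smul, cbNorm_smul]) (fun A hA => ?_) A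
  rw [← norm₁_schattenOneGauge] at hA
  exact (enorm_apply_le_cbNorm hA).trans h

/-- Otherwise Re tr(AB) < t on the whole unit ball, for t the norm of A minus ε; B = 0 shows t > 0.
Then A/t would have norm at most 1, since for functionals the norm is the completely bounded norm.
-/
theorem exists_le_re_trPair (A : Matrix (Fin n) (Fin n) (Dual E)) {ε : ℝ} (hε : 0 < ε) :
    ∃ B, OperatorSpace.mnorm n B ≤ 1 ∧
      (cbNorm (matGauge n OperatorSpace.mnorm) scalarGauge (trPair E n A)).toReal - ε ≤
        (trPair E n A B).re := by
  by_contra! h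
  set t := (cbNorm (matGauge n OperatorSpace.mnorm) scalarGauge (trPair E n A)).toReal - ε with ht
  have ht0 : 0 < t := by
    have := h 0 (by rw [mnorm_zero]; exact zero_le)
    simpa using this
  have h1 : cbNorm (matGauge n OperatorSpace.mnorm) scalarGauge
      (((t⁻¹ : ℝ) : ℂ) • trPair E n A) ≤ 1 := by
    refine cbNorm_le_one_of_re_le (ruanGauge_mnorm.matGauge n) fun B hB => ?_
    rw [norm₁_matGauge ruanGauge_mnorm] at hB
    rw [LinearMap.smul_apply, smul_eq_mul, Complex.re_ofReal_mul, inv_mul_le_iff₀ ht0, mul_one]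
    exact (h B hB).le
  rw [cbNorm_smul, ← ofReal_norm, Complex.norm_real, Real.norm_of_nonneg (by positivity)] at h1
  have h2 := ENNReal.toReal_mono ENNReal.one_ne_top h1
  rw [ENNReal.toReal_mul, ENNReal.toReal_ofReal (by positivity), ENNReal.toReal_one,
    inv_mul_le_iff₀ ht0] at h2
  linarith

end TracePairingNorm


/-! ### Duality of C_0-sums and weighted ℓ^1-sums over the dual object -/

section DualityOfSums

variable {G : Type*} [Group G] [TopologicalSpace G]

theorem DualObject.deg_pos (π : DualObject G) : 0 < π.deg :=
  Quotient.ind (motive := fun π : DualObject G => 0 < π.deg) IrrepU.d_pos π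

theorem DualObject.deg_ne_zero (π : DualObject G) : (π.deg : ℂ) ≠ 0 :=
  Nat.cast_ne_zero.2 π.deg_pos.ne'

variable {E : Type*} [AddCommGroup E] [Module ℂ E] [OperatorSpace E]

/-! ### The space `C_0(Ĝ, E)` -/

theorem gaugeC0_le_iff {k : ℕ} {x : Matrix (Fin k) (Fin k) (C0 G E)} {C : ℝ≥0∞} :
    gaugeC0 G E k x ≤ C ↔
      ∀ π : DualObject G, matGauge π.deg OperatorSpace.mnorm k (x.map fun B => B.1 π) ≤ C :=
  iSup_le_iff

theorem norm₁_gaugeC0_le_iff {B : C0 G E} {C : ℝ≥0∞} :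
    norm₁ (gaugeC0 G E) B ≤ C ↔
      ∀ π : DualObject G, OperatorSpace.mnorm π.deg (B.1 π) ≤ C := by
  rw [norm₁, gaugeC0_le_iff]
  refine forall_congr' fun π => ?_
  rw [← norm₁_matGauge ruanGauge_mnorm]
  rfl

theorem mem_C0_of_finite {B : MatFamily G E} (S : Finset (DualObject G))
    (h : ∀ π ∉ S, B π = 0) : B ∈ C0 G E := by
  refine ⟨?_, fun ε hε => S.finite_toSet.subset fun π hπ => ?_⟩
  · have : normLInfty G E B ≤ ∑ π ∈ S, OperatorSpace.mnorm π.deg (B π) := by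
      refine iSup_le fun π => ?_
      by_cases hπ : π ∈ S
      · exact Finset.single_le_sum (f := fun π => OperatorSpace.mnorm π.deg (B π))
          (fun _ _ => zero_le) hπ
      · rw [h π hπ, mnorm_zero]
        exact zero_le
    exact this.trans_lt (ENNReal.sum_lt_top.2 fun π _ =>
      (OperatorSpace.mnorm_ne_top π.deg _).lt_top)
  · by_contra hc
    refine hπ ?_
    rw [h π hc, mnorm_zero]
    exact hε

open Classical in
/-- The family supported at the single class `π`. -/
def singleC0 (π : DualObject G) : Matrix (Fin π.deg) (Fin π.deg) E →ₗ[ℂ] C0 G E :=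
  LinearMap.codRestrict (C0 G E)
    (LinearMap.single ℂ (fun π : DualObject G => Matrix (Fin π.deg) (Fin π.deg) E) π)
    fun b => mem_C0_of_finite {π} fun _ hσ => Pi.single_eq_of_ne
      (M := fun π : DualObject G => Matrix (Fin π.deg) (Fin π.deg) E)
      (Finset.notMem_singleton.1 hσ) b

theorem singleC0_same (π : DualObject G) (b : Matrix (Fin π.deg) (Fin π.deg) E) :
    (singleC0 π b).1 π = b := by
  classical
  exact Pi.single_eq_same (M := fun π : DualObject G => Matrix (Fin π.deg) (Fin π.deg) E) π b

theorem singleC0_of_ne {π σ : DualObject G} (h : σ ≠ π) (b : Matrix (Fin π.deg) (Fin π.deg) E) :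
    (singleC0 π b).1 σ = 0 := by
  classical
  exact Pi.single_eq_of_ne (M := fun π : DualObject G => Matrix (Fin π.deg) (Fin π.deg) E) h b

theorem gaugeC0_singleC0_le {k : ℕ} (π : DualObject G)
    (x : Matrix (Fin k) (Fin k) (Matrix (Fin π.deg) (Fin π.deg) E)) :
    gaugeC0 G E k (x.map (singleC0 π)) ≤ matGauge π.deg OperatorSpace.mnorm k x := by
  refine gaugeC0_le_iff.2 fun σ => ?_
  rcases eq_or_ne σ π with rfl | h
  · refine le_of_eq (congrArg _ ?_)
    ext1 a b
    exact singleC0_same σ (x a b)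
  · have : ((x.map (singleC0 π)).map fun B => B.1 σ) = 0 := by
      ext1 a b
      exact singleC0_of_ne h (x a b)
    rw [this, (ruanGauge_mnorm.matGauge σ.deg).zero]
    exact zero_le

open Classical in
theorem sum_singleC0_apply (S : Finset (DualObject G)) (B : MatFamily G E) (σ : DualObject G) :
    (∑ π ∈ S, singleC0 π (B π)).1 σ = if σ ∈ S then B σ else 0 := by
  rw [Submodule.coe_sum, Finset.sum_apply]
  split_ifs with h
  · rw [Finset.sum_eq_single_of_mem σ h fun π _ hπ => singleC0_of_ne hπ.symm _, singleC0_same]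
  · exact Finset.sum_eq_zero fun π hπ =>
      singleC0_of_ne (fun e : σ = π => h (by rwa [e])) _

/-- A bounded functional on `C_0(Ĝ, E)` vanishing on all families supported at one class is zero. -/
theorem eq_zero_of_comp_singleC0 {ψ : C0 G E →ₗ[ℂ] ℂ}
    (hψ : cbNorm (gaugeC0 G E) scalarGauge ψ ≠ ∞)
    (h : ∀ (π : DualObject G) b, ψ (singleC0 π b) = 0) : ψ = 0 := by
  classical
  ext B
  have key : ∀ ε : ℝ, 0 < ε → ‖ψ B‖ ≤ ε * (cbNorm (gaugeC0 G E) scalarGauge ψ).toReal := by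
    intro ε hε
    have hε' : 0 < ENNReal.ofReal ε := ENNReal.ofReal_pos.2 hε
    -- Membership in C_0 makes finite the set of classes where the norm of B is not below ε.
    -- Removing those blocks does not change ψ and leaves a remainder of norm at most ε.
    set S := (B.2.2 _ hε').toFinset with hS
    set D : C0 G E := B - ∑ π ∈ S, singleC0 π (B.1 π) with hD
    have e : ψ B = ψ D := by
      rw [hD, map_sub, map_sum, Finset.sum_eq_zero fun π _ => h π _, sub_zero]
    have hn : ‖((ε⁻¹ : ℝ) : ℂ)‖ₑ = (ENNReal.ofReal ε)⁻¹ := by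
      rw [← ofReal_norm, Complex.norm_real, Real.norm_of_nonneg (by positivity),
        ENNReal.ofReal_inv_of_pos hε]
    have h1 : norm₁ (gaugeC0 G E) (((ε⁻¹ : ℝ) : ℂ) • D) ≤ 1 := by
      refine norm₁_gaugeC0_le_iff.2 fun σ => ?_
      have e1 : (((ε⁻¹ : ℝ) : ℂ) • D).1 σ =
          ((ε⁻¹ : ℝ) : ℂ) • (B.1 σ - if σ ∈ S then B.1 σ else 0) := by
        rw [← sum_singleC0_apply]
        rfl
      rw [e1, OperatorSpace.mnorm_smul, hn, mul_comm, ← div_eq_mul_inv]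
      refine ENNReal.div_le_of_le_mul ?_
      rw [one_mul]
      split_ifs with hσ
      · rw [sub_self, mnorm_zero]
        exact zero_le
      · rw [sub_zero]
        rw [hS, Set.Finite.mem_toFinset, Set.mem_ofPred_eq, not_not] at hσ
        exact hσ.le
    have h2 := ENNReal.toReal_mono hψ (enorm_apply_le_cbNorm (φ := ψ) h1)
    rw [toReal_enorm, map_smul, norm_smul, Complex.norm_real, Real.norm_of_nonneg (by positivity),
      inv_mul_le_iff₀ hε] at h2
    rwa [e]
  have hlim : Filter.Tendsto (fun ε : ℝ => ε * (cbNorm (gaugeC0 G E) scalarGauge ψ).toReal)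
      (nhdsWithin 0 (Set.Ioi 0)) (nhds 0) := by
    refine Filter.Tendsto.mono_left ?_ nhdsWithin_le_nhds
    exact (continuous_mul_const _).tendsto' _ _ (zero_mul _)
  exact norm_le_zero_iff.1 (ge_of_tendsto hlim (Filter.eventually_of_mem self_mem_nhdsWithin key))

/-! ### The duality between `L^1` and `C_0` -/

theorem normL1_eq (A : MatFamily G (Dual E)) :
    normL1 G (Dual E) A = ∑' π : DualObject G, (π.deg : ℝ≥0∞) *
      cbNorm (matGauge π.deg OperatorSpace.mnorm) scalarGauge (trPair E π.deg (A π)) :=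
  tsum_congr fun π => by rw [norm₁_schattenOneGauge]

theorem enorm_natCast (d : ℕ) : ‖(d : ℂ)‖ₑ = d := by
  rw [enorm_eq_nnnorm]
  simp

theorem summable_trPair (A : L1 G (Dual E)) (B : C0 G E) :
    Summable fun π : DualObject G => (π.deg : ℂ) * trPair E π.deg (A.1 π) (B.1 π) := by
  refine Summable.of_enorm (ne_top_of_le_ne_top (ENNReal.mul_ne_top A.2.ne B.2.1.ne) ?_)
  rw [normL1_eq, ← ENNReal.tsum_mul_right]
  refine ENNReal.tsum_le_tsum fun π => ?_
  rw [enorm_mul, enorm_natCast, mul_assoc]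
  refine mul_le_mul' le_rfl ((enorm_trPair_le _ _).trans (mul_le_mul' le_rfl ?_))
  exact le_iSup (fun π : DualObject G => OperatorSpace.mnorm π.deg (B.1 π)) π

/-- The pairing `∑ d_π tr(A^π B^π)` of `L^1_{E*}(Ĝ)` with `C_0(Ĝ, E)`. -/
def l1Pairing (G : Type*) [Group G] [TopologicalSpace G]
    (E : Type*) [AddCommGroup E] [Module ℂ E] [OperatorSpace E] :
    L1 G (Dual E) →ₗ[ℂ] C0 G E →ₗ[ℂ] ℂ :=
  LinearMap.mk₂ ℂ
    (fun A B => ∑' π : DualObject G, (π.deg : ℂ) * trPair E π.deg (A.1 π) (B.1 π))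
    (fun A A' B => by
      rw [← (summable_trPair A B).tsum_add (summable_trPair A' B)]
      simp [mul_add])
    (fun c A B => by
      rw [smul_eq_mul, ← tsum_mul_left]
      simp [mul_left_comm])
    (fun A B B' => by
      rw [← (summable_trPair A B).tsum_add (summable_trPair A B')]
      simp [mul_add])
    (fun c A B => by
      rw [smul_eq_mul, ← tsum_mul_left]
      simp [mul_left_comm])

theorem hasSum_l1Pairing (A : L1 G (Dual E)) (B : C0 G E) :
    HasSum (fun π : DualObject G => (π.deg : ℂ) * trPair E π.deg (A.1 π) (B.1 π))
      (l1Pairing G E A B) :=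
  (summable_trPair A B).hasSum

theorem l1Pairing_singleC0 (A : L1 G (Dual E)) (π : DualObject G)
    (b : Matrix (Fin π.deg) (Fin π.deg) E) :
    l1Pairing G E A (singleC0 π b) = π.deg * trPair E π.deg (A.1 π) b := by
  have h := hasSum_single (f := fun σ : DualObject G =>
    (σ.deg : ℂ) * trPair E σ.deg (A.1 σ) ((singleC0 π b).1 σ)) π fun σ hσ => by
      rw [singleC0_of_ne hσ, map_zero, mul_zero]
  rw [singleC0_same] at h
  exact (hasSum_l1Pairing A (singleC0 π b)).unique h

/-- On finite partial sums this is the triangle inequality, each block of Z being in the unit ball;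
the series is approximated entrywise by them. -/
theorem cbNorm_l1Pairing_le (A : L1 G (Dual E)) :
    cbNorm (gaugeC0 G E) scalarGauge (l1Pairing G E A) ≤ normL1 G (Dual E) A.1 := by
  refine cbNorm_scalar_le_iff.2 fun r Z hZ => opNorm_le_of_forall_approx fun δ hδ => ?_
  have hev : ∀ᶠ S : Finset (DualObject G) in Filter.atTop, ∀ c d,
      ‖l1Pairing G E A (Z c d) -
        ∑ π ∈ S, (π.deg : ℂ) * trPair E π.deg (A.1 π) ((Z c d).1 π)‖ < δ := by
    refine Filter.eventually_all.2 fun c => Filter.eventually_all.2 fun d => ?_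
    have h := (Metric.tendsto_nhds.1 (hasSum_l1Pairing A (Z c d))) δ hδ
    refine h.mono fun S hS => ?_
    rwa [← dist_eq_norm, dist_comm]
  obtain ⟨S, hS⟩ := hev.exists
  refine ⟨∑ π ∈ S, (π.deg : ℂ) • (Z.map fun B => B.1 π).map (trPair E π.deg (A.1 π)), ?_,
    fun c d => ?_⟩
  · rw [normL1_eq]
    refine le_trans ?_ (ENNReal.sum_le_tsum S)
    refine (Finset.le_sum_of_subadditive _ opNorm_zero.le opNorm_add_le _ _).trans
      (Finset.sum_le_sum fun π _ => ?_)
    rw [opNorm_smul, enorm_natCast]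
    exact mul_le_mul' le_rfl (opNorm_map_le _ _ _ (gaugeC0_le_iff.1 hZ π))
  · simpa [Matrix.sum_apply] using hS c d

/-- On finitely many classes, choose blocks b_π in the unit ball nearly norming A^π. Their sum lies
in the unit ball of C_0, where norms are suprema. The family A is not assumed to be in L^1, because
the lemma also proves membership when A comes from a functional. -/
theorem normL1_le_cbNorm {φ : C0 G E →ₗ[ℂ] ℂ} {A : MatFamily G (Dual E)}
    (h : ∀ (π : DualObject G) b, φ (singleC0 π b) = π.deg * trPair E π.deg (A π) b) :
    normL1 G (Dual E) A ≤ cbNorm (gaugeC0 G E) scalarGauge φ := by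
  classical
  rcases eq_or_ne (cbNorm (gaugeC0 G E) scalarGauge φ) ∞ with ht | ht
  · rw [ht]
    exact le_top
  rw [normL1_eq, ENNReal.tsum_eq_iSup_sum]
  refine iSup_le fun S => ?_
  have hfin : ∀ π ∈ S, (π.deg : ℝ≥0∞) *
      cbNorm (matGauge π.deg OperatorSpace.mnorm) scalarGauge (trPair E π.deg (A π)) ≠ ∞ :=
    fun π _ => ENNReal.mul_ne_top (ENNReal.natCast_ne_top _) (cbNorm_trPair_ne_top _)
  rw [← ENNReal.toReal_le_toReal (ENNReal.sum_ne_top.2 hfin) ht, ENNReal.toReal_sum hfin]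
  simp only [ENNReal.toReal_mul, ENNReal.toReal_natCast]
  set D : ℝ := ∑ π ∈ S, (π.deg : ℝ) with hD
  have hD0 : 0 ≤ D := Finset.sum_nonneg fun _ _ => Nat.cast_nonneg _
  refine le_of_forall_pos_le_add fun ε hε => ?_
  -- The weighted errors sum to Dε/(D+1) ≤ ε.
  choose b hb hb' using fun π : DualObject G =>
    exists_le_re_trPair (A π) (ε := ε / (D + 1)) (by positivity)
  have h1 : norm₁ (gaugeC0 G E) (∑ π ∈ S, singleC0 π (b π)) ≤ 1 := by
    refine norm₁_gaugeC0_le_iff.2 fun σ => ?_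
    rw [sum_singleC0_apply S b]
    split_ifs
    · exact hb σ
    · rw [mnorm_zero]
      exact zero_le
  have h2 := ENNReal.toReal_mono ht (enorm_apply_le_cbNorm (φ := φ) h1)
  rw [toReal_enorm] at h2
  have h3 := (Complex.re_le_norm _).trans h2
  have h4 : ∑ π ∈ S, (π.deg : ℝ) * ((cbNorm (matGauge π.deg OperatorSpace.mnorm) scalarGauge
      (trPair E π.deg (A π))).toReal - ε / (D + 1)) ≤ (φ (∑ π ∈ S, singleC0 π (b π))).re := by
    rw [map_sum, Complex.re_sum]
    refine Finset.sum_le_sum fun π _ => ?_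
    rw [h, ← Complex.ofReal_natCast, Complex.re_ofReal_mul]
    exact mul_le_mul_of_nonneg_left (hb' π) (Nat.cast_nonneg _)
  simp only [mul_sub, Finset.sum_sub_distrib, ← Finset.sum_mul, ← hD] at h4
  have h5 : D * (ε / (D + 1)) ≤ ε := by
    rw [mul_div_assoc', div_le_iff₀ (by positivity)]
    nlinarith
  linarith

theorem cbNorm_l1Pairing (A : L1 G (Dual E)) :
    cbNorm (gaugeC0 G E) scalarGauge (l1Pairing G E A) = normL1 G (Dual E) A.1 :=
  le_antisymm (cbNorm_l1Pairing_le A) (normL1_le_cbNorm (l1Pairing_singleC0 A))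

theorem l1Pairing_injective : Function.Injective (l1Pairing G E) := by
  intro A A' h
  refine Subtype.ext (funext fun π => trPair_injective _ (LinearMap.ext fun b => ?_))
  have := LinearMap.congr_fun h (singleC0 π b)
  rw [l1Pairing_singleC0, l1Pairing_singleC0] at this
  exact mul_left_cancel₀ π.deg_ne_zero this

/-- Restrict φ to each block and represent the restriction, divided by d_π, by the trace pairing.
The resulting family is in L^1, and the two functionals agree on single blocks, hence everywhere. -/
theorem exists_l1Pairing_eq {φ : C0 G E →ₗ[ℂ] ℂ}
    (hφ : cbNorm (gaugeC0 G E) scalarGauge φ ≠ ∞) : ∃ A, l1Pairing G E A = φ := by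
  have h1 : ∀ π : DualObject G, cbNorm (matGauge π.deg OperatorSpace.mnorm) scalarGauge
      ((π.deg : ℂ)⁻¹ • φ ∘ₗ singleC0 π) ≠ ∞ := by
    intro π
    rw [cbNorm_smul]
    refine ENNReal.mul_ne_top enorm_ne_top (ne_top_of_le_ne_top hφ ?_)
    refine cbNorm_scalar_le_iff.2 fun r x hx => ?_
    exact opNorm_map_le _ φ (x.map (singleC0 π)) ((gaugeC0_singleC0_le π x).trans hx)
  choose A hA using fun π => exists_trPair_eq _ (h1 π)
  have h2 : ∀ (π : DualObject G) b, φ (singleC0 π b) = π.deg * trPair E π.deg (A π) b := by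
    intro π b
    rw [hA, LinearMap.smul_apply, smul_eq_mul, mul_inv_cancel_left₀ π.deg_ne_zero]
    rfl
  refine ⟨⟨A, (normL1_le_cbNorm h2).trans_lt hφ.lt_top⟩, ?_⟩
  set A' : L1 G (Dual E) := ⟨A, (normL1_le_cbNorm h2).trans_lt hφ.lt_top⟩
  have hm : l1Pairing G E A' - φ ∈ cbDual (gaugeC0 G E) := Submodule.sub_mem _
    (show cbNorm _ _ _ ≠ ∞ from ne_top_of_le_ne_top A'.2.ne (cbNorm_l1Pairing_le A')) hφ
  refine sub_eq_zero.1 (eq_zero_of_comp_singleC0 hm fun π b => ?_)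
  rw [LinearMap.sub_apply, l1Pairing_singleC0, h2]
  exact sub_self _

/-! ### Matrix norms -/

/-- Each block of Z in the unit ball of M_r(C_0) defines by the trace pairing a complete contraction
S^1 → M_r. The family of these is one of those in the supremum defining the ℓ^1-norm. -/
theorem functionalGauge_l1Pairing_le {k : ℕ} (x : Matrix (Fin k) (Fin k) (L1 G (Dual E))) :
    functionalGauge (gaugeC0 G E) k (x.map (l1Pairing G E)) ≤ gaugeL1 G (Dual E) k x := by
  refine functionalGauge_le_iff.2 fun r Z hZ => ?_
  set u : ∀ π : DualObject G,
      Matrix (Fin π.deg) (Fin π.deg) (Dual E) →ₗ[ℂ] Matrix (Fin r) (Fin r) ℂ := fun π =>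
    matrixMap ((Z.map fun B => B.1 π).map (trPair E π.deg).flip) with hu
  refine le_trans (le_of_eq ?_) (le_iSup_of_le r (le_iSup_of_le u (le_iSup_of_le
    (fun π => functionalGauge_flip_trPair_le (gaugeC0_le_iff.1 hZ π)) le_rfl)))
  have e : ∀ a b, ∑' π : DualObject G, (π.deg : ℂ) • u π ((x a b).1 π) =
      Matrix.of fun c d => l1Pairing G E (x a b) (Z c d) := by
    intro a b
    refine HasSum.tsum_eq (Pi.hasSum.2 fun c => Pi.hasSum.2 fun d => ?_)
    exact hasSum_l1Pairing (x a b) (Z c d)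
  unfold matGauge scalarGauge flatten
  rw [opNorm_reindex, ← opNorm_reindex _ (Equiv.prodComm _ _) (Equiv.prodComm _ _)]
  congr 1
  ext ⟨a, c⟩ ⟨b, d⟩
  exact (congrFun (congrFun (e a b) c) d).symm

/-- Given complete contractions u_π, keep finitely many classes and replace each u_π, on the entries
of x, by the pairing with an element of the unit ball of M_m(M_{d_π}(E)). These blocks form an
element of the unit ball of M_m(C_0), being combined by a supremum. -/
theorem gaugeL1_le_functionalGauge {k : ℕ} (x : Matrix (Fin k) (Fin k) (L1 G (Dual E))) :
    gaugeL1 G (Dual E) k x ≤ functionalGauge (gaugeC0 G E) k (x.map (l1Pairing G E)) := by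
  classical
  refine iSup_le fun m => iSup_le fun u => iSup_le fun hu => ?_
  unfold matGauge scalarGauge flatten
  rw [opNorm_reindex]
  refine opNorm_le_of_forall_approx fun δ hδ => ?_
  have hs : ∀ a b, HasSum (fun π : DualObject G => (π.deg : ℂ) • u π ((x a b).1 π))
      (∑' π : DualObject G, (π.deg : ℂ) • u π ((x a b).1 π)) := by
    intro a b
    refine Summable.hasSum (Pi.summable.2 fun c => Pi.summable.2 fun d => ?_)
    refine Summable.of_enorm (ne_top_of_le_ne_top (x a b).2.ne ?_)
    rw [normL1_eq]
    refine ENNReal.tsum_le_tsum fun π => ?_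
    rw [Matrix.smul_apply, smul_eq_mul, enorm_mul, enorm_natCast]
    exact mul_le_mul' le_rfl (enorm_apply_le_cbNorm_trPair (hu π) _ c d)
  set T : Fin k → Fin k → Matrix (Fin m) (Fin m) ℂ := fun a b =>
    ∑' π : DualObject G, (π.deg : ℂ) • u π ((x a b).1 π) with hT
  have hev : ∀ᶠ S : Finset (DualObject G) in Filter.atTop, ∀ a b c d,
      ‖T a b c d - ∑ π ∈ S, (π.deg : ℂ) * u π ((x a b).1 π) c d‖ < δ / 2 := by
    refine Filter.eventually_all.2 fun a => Filter.eventually_all.2 fun b =>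
      Filter.eventually_all.2 fun c => Filter.eventually_all.2 fun d => ?_
    have h := (Metric.tendsto_nhds.1 (Pi.hasSum.1 (Pi.hasSum.1 (hs a b) c) d)) (δ / 2) (half_pos hδ)
    refine h.mono fun S hS => ?_
    rwa [← dist_eq_norm, dist_comm]
  obtain ⟨S, hS⟩ := hev.exists
  set D : ℝ := ∑ π ∈ S, (π.deg : ℝ) with hD
  have hD0 : 0 ≤ D := Finset.sum_nonneg fun _ _ => Nat.cast_nonneg _
  -- One half of δ pays for truncating to S; the other pays for the approximations, whose errors
  -- weighted by d_π sum to at most Dδ/(2(D+1)).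
  choose b hb hb' using fun π : DualObject G =>
    exists_trPair_approx (u π) (hu π) (fun j : Fin k × Fin k => (x j.1 j.2).1 π)
      (δ := δ / (2 * (D + 1))) (by positivity)
  set Z : Matrix (Fin m) (Fin m) (C0 G E) :=
    Matrix.of fun c d => ∑ π ∈ S, singleC0 π (b π c d) with hZ
  have hZ1 : gaugeC0 G E m Z ≤ 1 := by
    refine gaugeC0_le_iff.2 fun σ => ?_
    have e : (Z.map fun B => B.1 σ) = if σ ∈ S then b σ else 0 := by
      ext1 c d
      refine (sum_singleC0_apply S (fun π => b π c d) σ).trans ?_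
      split_ifs <;> rfl
    rw [e]
    split_ifs
    · exact hb σ
    · rw [(ruanGauge_mnorm.matGauge σ.deg).zero]
      exact zero_le
  refine ⟨Matrix.reindex (Equiv.prodComm _ _) (Equiv.prodComm _ _)
    (blk (x.map (l1Pairing G E)) Z), ?_, ?_⟩
  · rw [opNorm_reindex]
    exact opNorm_blk_le _ _ Z hZ1
  rintro ⟨a, c⟩ ⟨a', d⟩
  have e : l1Pairing G E (x a a') (Z c d) =
      ∑ π ∈ S, (π.deg : ℂ) * trPair E π.deg ((x a a').1 π) (b π c d) := by
    rw [hZ, Matrix.of_apply, map_sum]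
    exact Finset.sum_congr rfl fun π _ => l1Pairing_singleC0 _ _ _
  change ‖T a a' c d - l1Pairing G E (x a a') (Z c d)‖ < δ
  rw [e, ← sub_add_sub_cancel _ (∑ π ∈ S, (π.deg : ℂ) * u π ((x a a').1 π) c d),
    ← Finset.sum_sub_distrib]
  refine (norm_add_le _ _).trans_lt ?_
  have h2 : ‖∑ π ∈ S, ((π.deg : ℂ) * u π ((x a a').1 π) c d -
      (π.deg : ℂ) * trPair E π.deg ((x a a').1 π) (b π c d))‖ ≤ D * (δ / (2 * (D + 1))) := by
    rw [hD, Finset.sum_mul]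
    refine norm_sum_le_of_le _ fun π _ => ?_
    rw [← mul_sub, norm_mul, Complex.norm_natCast]
    exact mul_le_mul_of_nonneg_left (hb' π (a, a') c d).le (Nat.cast_nonneg _)
  have h3 : D * (δ / (2 * (D + 1))) ≤ δ / 2 := by
    rw [mul_div_assoc', div_le_iff₀ (by positivity)]
    nlinarith
  linarith [hS a a' c d]

/-- The isomorphism of `L^1_{E*}(Ĝ)` onto the dual of `C_0(Ĝ, E)`. -/
def l1EquivDual (G : Type*) [Group G] [TopologicalSpace G]
    (E : Type*) [AddCommGroup E] [Module ℂ E] [OperatorSpace E] :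
    L1 G (Dual E) ≃ₗ[ℂ] cbDual (gaugeC0 G E) :=
  LinearEquiv.ofBijective
    (LinearMap.codRestrict (cbDual (gaugeC0 G E)) (l1Pairing G E) fun A =>
      ne_top_of_le_ne_top A.2.ne (cbNorm_l1Pairing_le A))
    ⟨fun _ _ h => l1Pairing_injective (congrArg Subtype.val h), fun φ =>
      (exists_l1Pairing_eq φ.2).imp fun _ h => Subtype.ext h⟩

end DualityOfSums

end OpSpace

end

theorem mainTheorem12
    {G : Type*} [Group G] [TopologicalSpace G] [IsTopologicalGroup G] [CompactSpace G] [T2Space G]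
    {E : Type*} [AddCommGroup E] [Module ℂ E] [OpSpace.OperatorSpace E] :
    ∃ Λ : OpSpace.L1 G (OpSpace.Dual E) ≃ₗ[ℂ] OpSpace.cbDual (OpSpace.gaugeC0 G E),
      (∀ (A : OpSpace.L1 G (OpSpace.Dual E)) (B : OpSpace.C0 G E),
        HasSum (fun π : OpSpace.DualObject G => (π.deg : ℂ) *
            ∑ i, ∑ j, (A.1 π i j).1 (B.1 π j i))
          ((Λ A).1 B)) ∧
      (∀ A : OpSpace.L1 G (OpSpace.Dual E),
        OpSpace.norm₁ (OpSpace.dualGauge (OpSpace.gaugeC0 G E)) (Λ A) =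
          OpSpace.normL1 G (OpSpace.Dual E) A.1) ∧
      OpSpace.IsCompleteIsometry (OpSpace.gaugeL1 G (OpSpace.Dual E))
        (OpSpace.dualGauge (OpSpace.gaugeC0 G E)) Λ.toLinearMap := by
  refine ⟨OpSpace.l1EquivDual G E, OpSpace.hasSum_l1Pairing, fun A => ?_, fun k x => ?_⟩
  · rw [OpSpace.norm₁_dualGauge]
    exact OpSpace.cbNorm_l1Pairing A
  · exact le_antisymm (OpSpace.functionalGauge_l1Pairing_le x)
      (OpSpace.gaugeL1_le_functionalGauge x)
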